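/- Let $\mathcal S\subset\mathbb Z^2$ be a finite set of steps with step polynomial $S(x,y)=\sum_{(i,j)\in\mathcal S}x^iy^j$, and assume that the model is Hadamard: $S(x,y)=U(x)+V(x)T(y)$ for some Laurent polynomials $U,V,T$ with complex coefficients. Let $-m$ and $M$ be the smallest and largest $x$-coordinates of the steps, and $-m'$ and $M'$ the smallest and largest $y$-coordinates; assume $m,m'\ge 0$ and $M,M'>0$. Let $Q(x,y)=\sum_{n\ge 0}t^n\sum_{w}x^{i(w)}y^{j(w)}$ be the generating function of quadrant walks, where $w$ runs over the walks of length $n$ that start at $(0,0)$, take their steps in $\mathcal S$ and remain in $\mathbb N^2$, and $(i(w),j(w))$ is the endpoint of $w$. Let $K(x,y)=1-tS(x,y)$, $\bar x=1/x$, $\bar y=1/y$, and let $B_k(y)$ be the coefficient of $x^k$ in $S(x,y)$. All series below belong to the field of Puiseux series in $t$ whose coefficients are Puiseux series in $\bar x$ with coefficients in the field of Puiseux series in $\bar y$ over $\mathbb C$ (so that quotients are expanded first in $t$, then in $\bar x$, and finally in $\bar y$). The operators $[x^{\ge}]$ and $[y^{\ge}]$ keep the terms with a non-negative exponent of $x$,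 resp. of $y$, and $[x^{\ge}y^{\ge}]$ keeps the terms where both exponents are non-negative. (1) The equation $S(X,y)=S(x,y)$, solved for $X\neq 0$, has exactly $m+M$ distinct solutions $x_0=x,x_1,\dots,x_{m+M-1}$ in the field of Puiseux series in $\bar x$ over Puiseux series in $\bar y$; their coefficients are algebraic over $\mathbb Q(y)$. Exactly $m$ of them, say $x_1,\dots,x_m$, do not involve positive powers of $x$. (2) The equation $S(x,Y)=S(x,y)$, solved for $Y\ne0$, is equivalent to $T(Y)=T(y)$. It has exactly $m'+M'$ distinct solutions $y_0=y,y_1,\dots,y_{m'+M'-1}$, which are Puiseux series in $\bar y$ with coefficients in $\mathbb C$. Exactly $m'$ of them, say $y_1,\dots,y_{m'}$, do not involve positive powers of $y$. (3) Call two distinct pairs of non-zero elements adjacent if they differ by one coordinate only and $S$ takes the same value at both, and let the orbit of $(x,y)$ be its class for the reflexive and transitive closure of adjacency. This orbit consists of all pairs $(x_i,y_j)$ with $0\le i<m+M$ and $0\le j<m'+M'$. (4) One has $$Q(x,y)=[x^{\ge}y^{\ge}]\frac{\prod_{i=1}^m(1-\bar x x_i)\prod_{j=1}^{m'}(1-\bar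 y y_j)}{K(x,y)}.$$ (5) The equation $1-tS(X,y)=0$, solved for $X\ne 0$, has exactly $m+M$ distinct solutions $X_1,\dots,X_{m+M}$ in the field of Puiseux series in $t$ over Puiseux series in $\bar y$; their coefficients are algebraic over $\mathbb Q(y)$. Exactly $m$ of them, say $X_1,\dots,X_m$, are finite at $t=0$ (contain no negative power of $t$), and $$Q(x,y)=[y^{\ge}]\frac{\prod_{i=1}^m(1-\bar x X_i)\prod_{j=1}^{m'}(1-\bar y y_j)}{K(x,y)}=-[y^{\ge}]\frac{\prod_{j=1}^{m'}(1-\bar y y_j)}{t\,B_M(y)\prod_{i=m+1}^{m+M}(x-X_i)}.$$ (6) If $M=1$, then $S_x(x,y)=B_1(y)\prod_{i=1}^m(1-\bar x x_i)$. If $M'=1$, then $T_y(y)=\tau\prod_{j=1}^{m'}(1-\bar y y_j)$, where $\tau$ is the coefficient of $y$ in $T(y)$. If $M=M'=1$, then $\tau\neq 0$ and $$Q(x,y)=[x^{\ge}y^{\ge}]\frac{S_x(x,y)\,T_y(y)}{\tau\,B_1(y)\,K(x,y)}.$$ In particular, if $T$ is normalized so that $\tau=1$ (for instance if $T$ is the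 generating polynomial of a subset of $\mathbb Z$), these are $T_y(y)=\prod_{j=1}^{m'}(1-\bar y y_j)$ and $Q(x,y)=[x^{\ge}y^{\ge}]\,S_x(x,y)T_y(y)/(B_1(y)K(x,y))$. -/

import Mathlib

open scoped LaurentPolynomial

noncomputable section

/-! ### Puiseux series -/

/-- A Hahn series with rational exponents has *bounded denominators* if all its exponents lie in
`(1/n)ℤ` for some positive integer `n`. Since the support of a Hahn series is well-ordered, such a
series is exactly a Puiseux series `∑_{k ≥ k₀} c_k z^{k/n}` in the variable `z`. -/
def HasBoundedDenominators {K : Type} [Field K] (f : HahnSeries ℚ K) : Prop :=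
  ∃ n : ℕ, 0 < n ∧ ∀ q ∈ f.support, ∃ k : ℤ, (n : ℚ) * q = k

/-- Hahn series with exponents in `(1/n)ℤ`, as the image of Laurent series in one variable. -/
def scaleExponents (K : Type) [Field K] (n : ℕ) (hn : 0 < n) :
    HahnSeries ℤ K →+* HahnSeries ℚ K :=
  HahnSeries.embDomainRingHom
    ((AddMonoidHom.mulLeft ((n : ℚ)⁻¹)).comp (Int.castAddHom ℚ))
    (fun a b h => by
      have hn' : ((n : ℚ)⁻¹) ≠ 0 := inv_ne_zero (by exact_mod_cast hn.ne')
      simpa [hn.ne'] using h)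
    (fun a b => by
      have hn' : 0 < ((n : ℚ)⁻¹) := inv_pos.mpr (by exact_mod_cast hn)
      simp [hn'])

lemma exists_scaleExponents {K : Type} [Field K] (f : HahnSeries ℚ K) (n : ℕ) (hn : 0 < n)
    (hf : ∀ q ∈ f.support, ∃ k : ℤ, (n : ℚ) * q = k) :
    ∃ g : HahnSeries ℤ K, scaleExponents K n hn g = f := by
  have hn' : (n : ℚ) ≠ 0 := by exact_mod_cast hn.ne'
  have hinv : 0 < ((n : ℚ)⁻¹) := inv_pos.mpr (by exact_mod_cast hn)
  refine ⟨⟨fun k => f.coeff ((n : ℚ)⁻¹ * k), ?_⟩, ?_⟩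
  · rw [Set.isPWO_iff_isWF, Set.isWF_iff_no_descending_seq]
    intro u hu hmem
    have h2 := f.isPWO_support.isWF
    rw [Set.isWF_iff_no_descending_seq] at h2
    refine h2 (fun i => (n : ℚ)⁻¹ * (u i : ℚ)) (fun a b hab => ?_) (fun i => hmem i)
    have : (u b : ℚ) < u a := by exact_mod_cast hu hab
    exact mul_lt_mul_of_pos_left this hinv
  · ext q
    by_cases hq : q ∈ f.support
    · obtain ⟨k, hk⟩ := hf q hq
      have hq' : q = (n : ℚ)⁻¹ * k := by rw [← hk]; field_simp
      subst hq'
      exact HahnSeries.embDomain_coeff (a := k)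
    · have h0 : f.coeff q = 0 := by simpa using hq
      rw [h0]
      refine HahnSeries.embDomain_notin_image_support ?_
      rintro ⟨k, hk, rfl⟩
      exact hk h0

lemma hasBoundedDenominators_scaleExponents {K : Type} [Field K] (n : ℕ) (hn : 0 < n)
    (g : HahnSeries ℤ K) : HasBoundedDenominators (scaleExponents K n hn g) := by
  have hn' : (n : ℚ) ≠ 0 := by exact_mod_cast hn.ne'
  refine ⟨n, hn, fun q hq => ?_⟩
  obtain ⟨k, -, rfl⟩ := HahnSeries.support_embDomain_subset hq
  refine ⟨k, ?_⟩
  show (n : ℚ) * ((n : ℚ)⁻¹ * k) = k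
  field_simp

/-- The field of Puiseux series with coefficients in `K`. -/
def puiseuxSubfield (K : Type) [Field K] : Subfield (HahnSeries ℚ K) where
  carrier := {f | HasBoundedDenominators f}
  mul_mem' := by
    rintro a b ⟨n, hn, ha⟩ ⟨m, hm, hb⟩
    refine ⟨n * m, Nat.mul_pos hn hm, fun q hq => ?_⟩
    obtain ⟨i, hi, j, hj, rfl⟩ := Set.mem_add.mp (HahnSeries.support_mul_subset hq)
    obtain ⟨k, hk⟩ := ha i hi
    obtain ⟨l, hl⟩ := hb j hj
    refine ⟨m * k + n * l, ?_⟩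
    push_cast
    rw [← hk, ← hl]
    ring
  one_mem' := ⟨1, one_pos, fun q hq => by
    have h := HahnSeries.support_one (R := K) (Γ := ℚ)
    rw [h] at hq
    exact ⟨0, by simp [Set.mem_singleton_iff.mp hq]⟩⟩
  add_mem' := by
    rintro a b ⟨n, hn, ha⟩ ⟨m, hm, hb⟩
    refine ⟨n * m, Nat.mul_pos hn hm, fun q hq => ?_⟩
    rcases HahnSeries.support_add_subset _ _ hq with h | h
    · obtain ⟨k, hk⟩ := ha q h
      exact ⟨m * k, by push_cast; rw [← hk]; ring⟩
    · obtain ⟨k, hk⟩ := hb q h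
      exact ⟨n * k, by push_cast; rw [← hk]; ring⟩
  zero_mem' := ⟨1, one_pos, fun q hq => absurd rfl hq⟩
  neg_mem' := by
    rintro a ⟨n, hn, ha⟩
    exact ⟨n, hn, fun q hq => ha q (by simpa using hq)⟩
  inv_mem' := by
    rintro a ⟨n, hn, ha⟩
    obtain ⟨g, rfl⟩ := exists_scaleExponents a n hn ha
    rw [← map_inv₀]
    exact hasBoundedDenominators_scaleExponents n hn _

/-- Puiseux series over `K` in one variable (which we do not name in the type). Iterating gives
iterated Puiseux series, the outermost variable being the one that is expanded first. -/
abbrev Puiseux (K : Type) [Field K] : Type := puiseuxSubfield K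

namespace Puiseux

variable {K L : Type} [Field K] [Field L]

/-- The coefficient of the `q`-th power of the variable. -/
def coeff (f : Puiseux K) (q : ℚ) : K := f.1.coeff q

/-- The variable itself. -/
def gen (K : Type) [Field K] : Puiseux K :=
  ⟨HahnSeries.single 1 1, 1, one_pos, fun q hq =>
    ⟨1, by simp [Set.mem_singleton_iff.mp (HahnSeries.support_single_subset hq)]⟩⟩

/-- Constants. -/
def const (K : Type) [Field K] : K →+* Puiseux K :=
  RingHom.codRestrict (HahnSeries.C : K →+* HahnSeries ℚ K) (puiseuxSubfield K) fun c =>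
    ⟨1, one_pos, fun q hq =>
      ⟨0, by simp [Set.mem_singleton_iff.mp (HahnSeries.support_single_subset hq)]⟩⟩

/-- Formal power series, seen as Puiseux series. -/
def ofPowerSeries (K : Type) [Field K] : PowerSeries K →+* Puiseux K :=
  RingHom.codRestrict (HahnSeries.ofPowerSeries ℚ K) (puiseuxSubfield K) fun f =>
    ⟨1, one_pos, fun q hq => by
      obtain ⟨k, -, rfl⟩ := HahnSeries.support_embDomain_subset hq
      exact ⟨k, by simp⟩⟩

/-- Apply a zero-preserving map to each coefficient. -/
def mapCoeff (φ : ZeroHom K L) : ZeroHom (Puiseux K) (Puiseux L) where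
  toFun f := ⟨f.1.map φ, by
    obtain ⟨n, hn, hf⟩ := f.2
    exact ⟨n, hn, fun q hq => hf q (HahnSeries.support_map_subset f.1 φ hq)⟩⟩
  map_zero' := Subtype.ext (HahnSeries.map_zero φ)

/-- The series contains no negative power of its variable. For a series in `z̄ = 1/z` this says
that it contains no positive power of `z`; for a series in `t`, that it is finite at `t = 0`. -/
def NoNegativePower (f : Puiseux K) : Prop := ∀ q : ℚ, q < 0 → f.coeff q = 0

/-- The operator `[z^≥]` on a Puiseux series in the variable `z̄ = 1/z`: it keeps the terms whose
exponent in `z` is non-negative, that is, whose exponent in `z̄` is non-positive. -/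
def nonnegPart (K : Type) [Field K] : ZeroHom (Puiseux K) (Puiseux K) where
  toFun f := ⟨⟨fun q => if q ≤ 0 then f.1.coeff q else 0,
      f.1.isPWO_support.mono fun q hq => by
        simp only [Function.mem_support, ne_eq, ite_eq_right_iff, not_forall] at hq
        exact hq.2⟩, by
    obtain ⟨n, hn, hf⟩ := f.2
    refine ⟨n, hn, fun q hq => hf q ?_⟩
    simp only [HahnSeries.mem_support, ne_eq, ite_eq_right_iff, not_forall] at hq
    exact hq.2⟩
  map_zero' := by
    apply Subtype.ext
    ext q
    simp

end Puiseux

open Puiseux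

/-! ### The fields of iterated series -/

/-- Puiseux series in `ȳ = 1/y` with complex coefficients. -/
abbrev FieldY : Type := Puiseux ℂ

/-- Puiseux series in `x̄ = 1/x` with coefficients in `FieldY`. -/
abbrev FieldXY : Type := Puiseux FieldY

/-- Puiseux series in `t` with coefficients in `FieldY`. -/
abbrev FieldTY : Type := Puiseux FieldY

/-- Puiseux series in `t` with coefficients in `FieldXY`. Computing a quotient in this field means
expanding it first in `t`, then in `x̄`, and finally in `ȳ`. -/
abbrev FieldTXY : Type := Puiseux FieldXY

/-- The indeterminate `y` in `FieldY`. -/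
def yY : FieldY := (gen ℂ)⁻¹

/-- The indeterminate `x` in `FieldXY`. -/
def xXY : FieldXY := (gen FieldY)⁻¹

/-- The indeterminate `y` in `FieldXY`. -/
def yXY : FieldXY := const FieldY yY

/-- The indeterminate `t` in `FieldTY`. -/
def tTY : FieldTY := gen FieldY

/-- The indeterminate `y` in `FieldTY`. -/
def yTY : FieldTY := const FieldY yY

/-- The indeterminate `t` in `FieldTXY`. -/
def tTXY : FieldTXY := gen FieldXY

/-- The indeterminate `x` in `FieldTXY`. -/
def xTXY : FieldTXY := const FieldXY xXY

/-- The indeterminate `y` in `FieldTXY`. -/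
def yTXY : FieldTXY := const FieldXY yXY

/-- The inclusion of `FieldTY` in `FieldTXY`, which sends `∑ c_q t^q` to `∑ c_q t^q`, the
coefficients being seen as constants with respect to `x`. -/
def embTY (f : FieldTY) : FieldTXY := mapCoeff (const FieldY : ZeroHom FieldY FieldXY) f

/-- The inclusion of `FieldY` in `FieldTXY`. -/
def embY : FieldY →+* FieldTXY := (const FieldXY).comp (const FieldY)

/-- The field `ℚ(y)`, as a subfield of `FieldY`. -/
def ratFunY : Subfield FieldY := Subfield.closure {yY}

/-- The operator `[x^≥]`, applied to each coefficient of a series in `t`. -/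
def nonnegX : ZeroHom FieldTXY FieldTXY := mapCoeff (nonnegPart FieldY)

/-- The operator `[y^≥]`, applied to each coefficient of a series in `t` and `x̄`. -/
def nonnegY : ZeroHom FieldTXY FieldTXY := mapCoeff (mapCoeff (nonnegPart ℂ))

/-- The operator `[x^≥ y^≥]`. -/
def nonnegXY (f : FieldTXY) : FieldTXY := nonnegY (nonnegX f)

/-! ### Step sets and quadrant walks -/

/-- The step polynomial `∑_{(i,j) ∈ 𝒮} x^i y^j`, as a Laurent polynomial in two variables. -/
def stepPolynomial (𝒮 : Finset (ℤ × ℤ)) : AddMonoidAlgebra ℂ (ℤ × ℤ) :=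
  ∑ s ∈ 𝒮, AddMonoidAlgebra.single s 1

/-- The Laurent polynomial `P(x)`, seen as a Laurent polynomial in `x` and `y`. -/
def inX (P : ℂ[T;T⁻¹]) : AddMonoidAlgebra ℂ (ℤ × ℤ) :=
  AddMonoidAlgebra.mapDomain (fun i : ℤ => (i, (0 : ℤ))) P

/-- The Laurent polynomial `P(y)`, seen as a Laurent polynomial in `x` and `y`. -/
def inY (P : ℂ[T;T⁻¹]) : AddMonoidAlgebra ℂ (ℤ × ℤ) :=
  AddMonoidAlgebra.mapDomain (fun j : ℤ => ((0 : ℤ), j)) P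

/-- The model `𝒮` is Hadamard, with `S(x,y) = U(x) + V(x) T(y)`. -/
def IsHadamard (𝒮 : Finset (ℤ × ℤ)) (U V T : ℂ[T;T⁻¹]) : Prop :=
  stepPolynomial 𝒮 = inX U + inX V * inY T

section Evaluation

variable {L : Type} [Field L]

/-- The value `S(a,b)` of the step polynomial at (non-zero) elements of a field. -/
def stepEval (𝒮 : Finset (ℤ × ℤ)) (a b : L) : L := ∑ s ∈ 𝒮, a ^ s.1 * b ^ s.2

/-- The value `S_x(a,b)` of the derivative of the step polynomial with respect to `x`. -/
def stepEvalDx (𝒮 : Finset (ℤ × ℤ)) (a b : L) : L := ∑ s ∈ 𝒮, (s.1 : L) * a ^ (s.1 - 1) * b ^ s.2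

/-- The value at `b` of the coefficient `B_k(y)` of `x^k` in `S(x,y)`. -/
def stepCoeffX (𝒮 : Finset (ℤ × ℤ)) (k : ℤ) (b : L) : L := ∑ s ∈ 𝒮 with s.1 = k, b ^ s.2

/-- The value at `b` of a Laurent polynomial; `ι` embeds the complex numbers in the field. -/
def laurentEval (ι : ℂ →+* L) (P : ℂ[T;T⁻¹]) (b : L) : L :=
  P.coeff.sum fun k c => ι c * b ^ k

/-- The value at `b` of the derivative of a Laurent polynomial. -/
def laurentEvalDeriv (ι : ℂ →+* L) (P : ℂ[T;T⁻¹]) (b : L) : L :=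
  P.coeff.sum fun k c => ι c * (k : L) * b ^ (k - 1)

/-- Two pairs of non-zero elements are adjacent if they are distinct, give the same value to the
step polynomial, and differ by one coordinate only. -/
def Adjacent (𝒮 : Finset (ℤ × ℤ)) (u v : L × L) : Prop :=
  u.1 ≠ 0 ∧ u.2 ≠ 0 ∧ v.1 ≠ 0 ∧ v.2 ≠ 0 ∧ u ≠ v ∧
    stepEval 𝒮 u.1 u.2 = stepEval 𝒮 v.1 v.2 ∧ (u.2 = v.2 ∨ u.1 = v.1)

/-- The orbit of `u`: its class for the reflexive and transitive closure of adjacency. -/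
def orbit (𝒮 : Finset (ℤ × ℤ)) (u : L × L) : Set (L × L) :=
  {v | Relation.ReflTransGen (Adjacent 𝒮) u v}

end Evaluation

/-- The position after `k` steps of the walk that starts from the origin and has successive
steps `w 0, w 1, …`. -/
def walkPos {𝒮 : Finset (ℤ × ℤ)} {n : ℕ} (w : Fin n → 𝒮) (k : ℕ) : ℤ × ℤ :=
  ∑ l : Fin n with l.1 < k, (w l : ℤ × ℤ)

/-- The walks of length `n` with steps in `𝒮` that start from the origin and stay in the
quadrant `ℕ × ℕ`. -/
def quadrantWalks (𝒮 : Finset (ℤ × ℤ)) (n : ℕ) : Finset (Fin n → 𝒮) :=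
  {w | ∀ k ≤ n, 0 ≤ (walkPos w k).1 ∧ 0 ≤ (walkPos w k).2}

/-- The generating function `Q(x,y;t) = ∑_n t^n ∑_w x^{i(w)} y^{j(w)}`, where `w` runs over the
quadrant walks of length `n`, and `(i(w), j(w))` is the endpoint of `w`. -/
def quadrantGF (𝒮 : Finset (ℤ × ℤ)) : FieldTXY :=
  Puiseux.ofPowerSeries FieldXY <| PowerSeries.mk fun n =>
    ∑ w ∈ quadrantWalks 𝒮 n, xXY ^ (walkPos w n).1 * yXY ^ (walkPos w n).2

/-- The kernel `K(x,y) = 1 - t S(x,y)`. -/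
def kernel (𝒮 : Finset (ℤ × ℤ)) : FieldTXY := 1 - tTXY * stepEval 𝒮 xTXY yTXY

/-- The embedding of the complex numbers in `FieldXY`. -/
def complexXY : ℂ →+* FieldXY := (const FieldY).comp (const ℂ)

/-- The embedding of the complex numbers in `FieldTXY`. -/
def complexTXY : ℂ →+* FieldTXY := (const FieldXY).comp complexXY

end

open scoped LaurentPolynomial

noncomputable section

open Puiseux

namespace Puiseux

/-! ### Coefficients, monomials and the valuation ring of Puiseux series -/

section Coefficients

variable {K : Type} [Field K]

/-! Everything rests on a weighted problem in dimension one. Let f(u) = ∑ b_k u^k with -m ≤ k ≤ M,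
and let h_n(u) count the walks of length n on ℕ with step weights b_k (`halfLine`). Discarding the
steps that leave ℕ gives u^m h_{n+1} = u^m f h_n - e_n with deg e_n < m.

First solution (`nonnegPart_prod_mul_pow`). Let s = f(x), let a_1, …, a_m be the solutions of f(a) =
s without positive powers of x, and D(u) = ∏ (u - a_i). The recursion R_0 = u^m - D, R_{n+1} = s R_n
- e_n keeps the degree below m, and R_n(u) = u^m h_n(u) - s^n D(u) wherever f(u) = s. Taking u = a_i
shows that R_n is the remainder of u^m h_n modulo D, so its coefficients have no positive power of
x. Taking u = x gives ∏ (1 - x̄ a_i) f(x)^n = h_n(x) - x^{-m} R_n(x), where the last term has only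
negative powers of x. Hence [x^≥] of the left-hand side is h_n(x).

Second solution (`prod_sub_eq_kernel_mul`), by the kernel method. For H = ∑ t^n h_n, the recursion
sums to u^m (1 - t f(u)) H(u) = u^m - ∑_{j<m} E_j(t) u^j. The right-hand side is monic of degree m
in u and vanishes at the m roots X_i of the kernel that are finite at t = 0, so it equals ∏ (u -
X_i).

The Hadamard form gives access to the second coordinate. The step polynomial S and the polynomial
H_n of walks confined to x ≥ 0 only are polynomials in T(y) over ℂ[x, x̄], and S has degree at most
one in T. With N = ∏ (1 - ȳ y_j), the first solution in the variable y says that [y^≥] N T^k is a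
half-line polynomial, whence [y^≥] T [y^≥] N T^k = [y^≥] N T^{k+1}. By linearity, a step may be
added before or after the extraction, and induction gives Q_n = [y^≥] N H_n
(`quadrantPolynomial_eq`). Expressing H_n by the first or the second solution in x gives the
formulas for Q; factoring the kernel over all its roots gives the last form of the second one.

The solutions of f(u) = s, for s with a pole of order e at the origin, come from Hensel's lemma
after setting u = Z z^{-e/M}, where z is the variable (`exists_largeRoot`), and from u ↦ 1/u for
those finite at the origin. Their number is the degree m + M of u^m (f(u) - s), so none is missing.
Only n-th roots of coefficients are extracted, so the construction works inside the algebraic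
closure of ℚ(y) in `FieldY`, which proves algebraicity (`exists_roots_isAlgebraic`).

For the orbit, S(a,b) = S(a,b') is equivalent to T(b) = T(b') once V(a) ≠ 0; the non-zero zeros of V
are complex numbers, and no solution of S(a,y) = S(x,y) is one. When M = 1, differentiating u^m
(f(u) - f(x)) = b_1 (u - x) ∏ (u - a_i) at u = x gives the derivative formulas. -/

lemma ext_coeff {f g : Puiseux K} (h : ∀ q, f.coeff q = g.coeff q) : f = g :=
  Subtype.ext (HahnSeries.ext (funext h))

@[simp] lemma coeff_zero (q : ℚ) : (0 : Puiseux K).coeff q = 0 := rfl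

lemma coeff_add (f g : Puiseux K) (q : ℚ) : (f + g).coeff q = f.coeff q + g.coeff q := rfl

lemma coeff_neg (f : Puiseux K) (q : ℚ) : (-f).coeff q = -f.coeff q := rfl

lemma coeff_sub (f g : Puiseux K) (q : ℚ) : (f - g).coeff q = f.coeff q - g.coeff q := rfl

/-- The `q`-th coefficient, as an additive map. -/
def coeffHom (q : ℚ) : Puiseux K →+ K where
  toFun f := f.coeff q
  map_zero' := rfl
  map_add' _ _ := rfl

lemma coeff_sum {ι : Type*} (s : Finset ι) (f : ι → Puiseux K) (q : ℚ) :
    (∑ i ∈ s, f i).coeff q = ∑ i ∈ s, (f i).coeff q :=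
  map_sum (coeffHom q) f s

/-- The power `z^q` of the variable `z`. -/
def mono (K : Type) [Field K] (q : ℚ) : Puiseux K :=
  ⟨HahnSeries.single q 1, q.den, q.den_pos, fun p hp =>
    ⟨q.num, by
      rw [Set.mem_singleton_iff.mp (HahnSeries.support_single_subset hp)]
      exact Rat.den_mul_eq_num q⟩⟩

lemma mono_add (p q : ℚ) : mono K (p + q) = mono K p * mono K q :=
  Subtype.ext (by simp [mono, HahnSeries.single_mul_single])

@[simp] lemma mono_zero : mono K 0 = 1 := rfl

lemma mono_one : mono K 1 = gen K := rfl

lemma mono_ne_zero (q : ℚ) : mono K q ≠ 0 := by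
  intro h
  have := mono_add (K := K) q (-q)
  rw [h, zero_mul, add_neg_cancel, mono_zero] at this
  exact one_ne_zero this

lemma mono_neg (q : ℚ) : mono K (-q) = (mono K q)⁻¹ := by
  refine eq_inv_of_mul_eq_one_left ?_
  rw [← mono_add, neg_add_cancel, mono_zero]

lemma mono_pow (q : ℚ) (n : ℕ) : mono K q ^ n = mono K (n * q) := by
  induction n with
  | zero => simp
  | succ n ih => rw [pow_succ, ih, ← mono_add]; congr 1; push_cast; ring

lemma mono_zpow (q : ℚ) (n : ℤ) : mono K q ^ n = mono K (n * q) := by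
  obtain ⟨n, rfl | rfl⟩ := n.eq_nat_or_neg
  · simp [mono_pow]
  · rw [zpow_neg, zpow_natCast, mono_pow, ← mono_neg]; congr 1; push_cast; ring

lemma gen_ne_zero : gen K ≠ 0 := mono_ne_zero 1

lemma gen_zpow (n : ℤ) : gen K ^ n = mono K n := by
  rw [← mono_one, mono_zpow, mul_one]

lemma gen_pow (n : ℕ) : gen K ^ n = mono K n := by
  rw [← mono_one, mono_pow, mul_one]

lemma coeff_mono_mul (p : ℚ) (f : Puiseux K) (q : ℚ) :
    (mono K p * f).coeff q = f.coeff (q - p) := by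
  have := HahnSeries.coeff_single_mul_add (r := (1 : K)) (x := f.1) (a := q - p) (b := p)
  rw [sub_add_cancel, one_mul] at this
  exact this

lemma coeff_const_mul (c : K) (f : Puiseux K) (q : ℚ) :
    (const K c * f).coeff q = c * f.coeff q := by
  have := HahnSeries.coeff_single_zero_mul (r := c) (x := f.1) (a := q)
  exact this

lemma coeff_one (q : ℚ) : (1 : Puiseux K).coeff q = if q = 0 then 1 else 0 := by
  have : (1 : Puiseux K).coeff q = _ := HahnSeries.coeff_one (Γ := ℚ) (R := K) (a := q)
  rw [this]
  congr

lemma coeff_const (c : K) (q : ℚ) : (const K c).coeff q = if q = 0 then c else 0 := by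
  have := coeff_const_mul c 1 q
  rw [mul_one, coeff_one] at this
  simpa using this

lemma coeff_mono (p q : ℚ) : (mono K p).coeff q = if q = p then 1 else 0 := by
  have := coeff_mono_mul p (1 : Puiseux K) q
  rw [mul_one, coeff_one] at this
  simpa [sub_eq_zero] using this

lemma const_injective : Function.Injective (const K) := (const K).injective

lemma noNegativePower_const (c : K) : (const K c).NoNegativePower := fun q hq => by
  rw [coeff_const, if_neg hq.ne]

lemma noNegativePower_mono {p : ℚ} (hp : 0 ≤ p) : (mono K p).NoNegativePower := fun q hq => by
  rw [coeff_mono, if_neg (hq.trans_le hp).ne]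

lemma NoNegativePower.mul {f g : Puiseux K} (hf : f.NoNegativePower) (hg : g.NoNegativePower) :
    (f * g).NoNegativePower := by
  intro q hq
  by_contra h
  obtain ⟨i, hi, j, hj, hij⟩ := Set.mem_add.mp (HahnSeries.support_mul_subset (x := f.1) (y := g.1)
    (show q ∈ (f.1 * g.1).support from h))
  have hi' : 0 ≤ i := not_lt.mp fun h0 => hi (hf i h0)
  have hj' : 0 ≤ j := not_lt.mp fun h0 => hj (hg j h0)
  linarith

/-- The ring of series without negative power. -/
def intRing (K : Type) [Field K] : Subring (Puiseux K) where
  carrier := {f | f.NoNegativePower}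
  mul_mem' := NoNegativePower.mul
  one_mem' := noNegativePower_mono le_rfl
  add_mem' hf hg q hq := by rw [coeff_add, hf q hq, hg q hq, add_zero]
  zero_mem' _ _ := rfl
  neg_mem' hf q hq := by rw [coeff_neg, hf q hq, neg_zero]

/-- A series divisible by all powers of the variable is zero. -/
lemma eq_zero_of_forall_mono {f : Puiseux K}
    (h : ∀ n : ℕ, ∃ g ∈ intRing K, f = gen K ^ n * g) : f = 0 := by
  refine ext_coeff fun q => ?_
  obtain ⟨n, hn⟩ := exists_nat_gt q
  obtain ⟨g, hg, rfl⟩ := h n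
  rw [gen_pow, coeff_mono_mul, hg _ (by linarith), coeff_zero]

end Coefficients

/-! ### Extraction of the non-negative powers -/

section NonnegPart

variable {K : Type} [Field K]

lemma coeff_nonnegPart (f : Puiseux K) (q : ℚ) :
    (nonnegPart K f).coeff q = if q ≤ 0 then f.coeff q else 0 := rfl

lemma nonnegPart_add (f g : Puiseux K) :
    nonnegPart K (f + g) = nonnegPart K f + nonnegPart K g := by
  refine ext_coeff fun q => ?_
  simp only [coeff_add, coeff_nonnegPart]
  split_ifs <;> simp

lemma nonnegPart_const_mul (c : K) (f : Puiseux K) :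
    nonnegPart K (const K c * f) = const K c * nonnegPart K f := by
  refine ext_coeff fun q => ?_
  simp only [coeff_const_mul, coeff_nonnegPart]
  split_ifs <;> simp

/-- `nonnegPart` as an additive map. -/
def nonnegPartHom (K : Type) [Field K] : Puiseux K →+ Puiseux K where
  toFun := nonnegPart K
  map_zero' := map_zero _
  map_add' := nonnegPart_add

lemma nonnegPart_sum {ι : Type*} (s : Finset ι) (f : ι → Puiseux K) :
    nonnegPart K (∑ i ∈ s, f i) = ∑ i ∈ s, nonnegPart K (f i) :=
  map_sum (nonnegPartHom K) f s

lemma nonnegPart_sub (f g : Puiseux K) :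
    nonnegPart K (f - g) = nonnegPart K f - nonnegPart K g :=
  map_sub (nonnegPartHom K) f g

lemma nonnegPart_mono_mul_eq_zero {p : ℚ} (hp : 0 < p) {f : Puiseux K} (hf : f.NoNegativePower) :
    nonnegPart K (mono K p * f) = 0 := by
  refine ext_coeff fun q => ?_
  rw [coeff_nonnegPart, coeff_zero, coeff_mono_mul]
  split_ifs with h
  · exact hf _ (by linarith)
  · rfl

lemma nonnegPart_const_mul_mono (c : K) (p : ℚ) :
    nonnegPart K (const K c * mono K p) = if p ≤ 0 then const K c * mono K p else 0 := by
  refine ext_coeff fun q => ?_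
  rw [nonnegPart_const_mul, coeff_const_mul, coeff_nonnegPart, coeff_mono]
  by_cases hp : p ≤ 0
  · rw [if_pos hp, coeff_const_mul, coeff_mono]
    by_cases hq : q = p
    · subst hq; rw [if_pos hp]
    · simp [hq]
  · rw [if_neg hp, coeff_zero]
    by_cases hq : q = p
    · subst hq; rw [if_neg hp, mul_zero]
    · simp [hq]

lemma nonnegPart_nonnegPart (f : Puiseux K) :
    nonnegPart K (nonnegPart K f) = nonnegPart K f := by
  refine ext_coeff fun q => ?_
  simp only [coeff_nonnegPart]
  split_ifs <;> rfl

end NonnegPart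

/-! ### Change of coefficient field -/

section MapCoeff

variable {K L : Type} [Field K] [Field L]

lemma coeff_mapCoeff (φ : ZeroHom K L) (f : Puiseux K) (q : ℚ) :
    (mapCoeff φ f).coeff q = φ (f.coeff q) := rfl

/-- Apply a field homomorphism to each coefficient. -/
def mapRing (φ : K →+* L) : Puiseux K →+* Puiseux L where
  toFun := mapCoeff (φ : ZeroHom K L)
  map_one' := ext_coeff fun q => by
    rw [coeff_mapCoeff, coeff_one, coeff_one]; split_ifs <;> simp
  map_mul' f g := Subtype.ext (HahnSeries.map_mul (φ : K →ₙ+* L) (x := f.1) (y := g.1))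
  map_zero' := map_zero _
  map_add' f g := ext_coeff fun q => by
    simp only [coeff_mapCoeff, coeff_add]; exact map_add φ _ _

lemma coeff_mapRing (φ : K →+* L) (f : Puiseux K) (q : ℚ) :
    (mapRing φ f).coeff q = φ (f.coeff q) := rfl

@[simp] lemma mapRing_mono (φ : K →+* L) (q : ℚ) : mapRing φ (mono K q) = mono L q :=
  ext_coeff fun p => by rw [coeff_mapRing, coeff_mono, coeff_mono]; split_ifs <;> simp

@[simp] lemma mapRing_gen (φ : K →+* L) : mapRing φ (gen K) = gen L := mapRing_mono φ 1

@[simp] lemma mapRing_const (φ : K →+* L) (c : K) : mapRing φ (const K c) = const L (φ c) :=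
  ext_coeff fun p => by rw [coeff_mapRing, coeff_const, coeff_const]; split_ifs <;> simp

lemma noNegativePower_mapRing (φ : K →+* L) (f : Puiseux K) :
    (mapRing φ f).NoNegativePower ↔ f.NoNegativePower := by
  simp [NoNegativePower, coeff_mapRing]

end MapCoeff

/-! ### Power series in the variable and in its roots -/

section PowerSeries

variable {K L : Type} [Field K] [Field L]

lemma coeff_ofPowerSeries (f : PowerSeries K) (n : ℕ) :
    (ofPowerSeries K f).coeff n = PowerSeries.coeff n f :=
  HahnSeries.ofPowerSeries_apply_coeff f n

lemma coeff_ofPowerSeries_eq_zero (f : PowerSeries K) {q : ℚ} (hq : ∀ n : ℕ, (n : ℚ) ≠ q) :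
    (ofPowerSeries K f).coeff q = 0 := by
  refine HahnSeries.embDomain_of_notMem_range ?_
  rintro ⟨n, hn⟩
  exact hq n hn

lemma noNegativePower_ofPowerSeries (f : PowerSeries K) :
    (ofPowerSeries K f).NoNegativePower := fun q hq =>
  coeff_ofPowerSeries_eq_zero f fun n hn => by
    rw [← hn] at hq; exact absurd hq (not_lt.mpr n.cast_nonneg)

lemma ofPowerSeries_X : ofPowerSeries K PowerSeries.X = gen K :=
  Subtype.ext HahnSeries.ofPowerSeries_X

lemma ofPowerSeries_C (c : K) : ofPowerSeries K (PowerSeries.C c) = const K c :=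
  Subtype.ext (HahnSeries.ofPowerSeries_C c)

lemma mapCoeff_ofPowerSeries (φ : ZeroHom K L) (f : PowerSeries K) :
    mapCoeff φ (ofPowerSeries K f) =
      ofPowerSeries L (PowerSeries.mk fun n => φ (PowerSeries.coeff n f)) := by
  refine ext_coeff fun q => ?_
  rw [coeff_mapCoeff]
  by_cases h : ∃ n : ℕ, (n : ℚ) = q
  · obtain ⟨n, rfl⟩ := h
    rw [coeff_ofPowerSeries, coeff_ofPowerSeries, PowerSeries.coeff_mk]
  · rw [not_exists] at h
    rw [coeff_ofPowerSeries_eq_zero f h, coeff_ofPowerSeries_eq_zero _ h, map_zero]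

/-- Substitute `z^(1/n)` for the variable of a power series. -/
def ramified (K : Type) [Field K] (n : ℕ) (hn : 0 < n) : PowerSeries K →+* Puiseux K :=
  RingHom.codRestrict ((scaleExponents K n hn).comp (HahnSeries.ofPowerSeries ℤ K))
    (puiseuxSubfield K) fun _ => hasBoundedDenominators_scaleExponents n hn _

lemma scaleExponents_single (n : ℕ) (hn : 0 < n) (k : ℤ) (c : K) :
    scaleExponents K n hn (HahnSeries.single k c) = HahnSeries.single ((n : ℚ)⁻¹ * k) c :=
  HahnSeries.embDomain_single

lemma ramified_X (n : ℕ) (hn : 0 < n) : ramified K n hn PowerSeries.X = mono K ((n : ℚ)⁻¹) := by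
  refine Subtype.ext ?_
  show scaleExponents K n hn (HahnSeries.ofPowerSeries ℤ K PowerSeries.X) = _
  rw [HahnSeries.ofPowerSeries_X, scaleExponents_single, Int.cast_one, mul_one]
  rfl

lemma ramified_C (n : ℕ) (hn : 0 < n) (c : K) :
    ramified K n hn (PowerSeries.C c) = const K c := by
  refine Subtype.ext ?_
  show scaleExponents K n hn (HahnSeries.ofPowerSeries ℤ K (PowerSeries.C c)) = _
  rw [HahnSeries.ofPowerSeries_C]
  show scaleExponents K n hn (HahnSeries.single 0 c) = _
  rw [scaleExponents_single, Int.cast_zero, mul_zero]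
  rfl

lemma coeff_ramified_zero (n : ℕ) (hn : 0 < n) (f : PowerSeries K) :
    (ramified K n hn f).coeff 0 = PowerSeries.constantCoeff f := by
  have h : (ramified K n hn f).coeff ((n : ℚ)⁻¹ * ((0 : ℤ) : ℚ)) =
      (HahnSeries.ofPowerSeries ℤ K f).coeff 0 := HahnSeries.embDomain_coeff (a := (0 : ℤ))
  rw [Int.cast_zero, mul_zero] at h
  rw [h, ← PowerSeries.coeff_zero_eq_constantCoeff_apply]
  exact_mod_cast HahnSeries.ofPowerSeries_apply_coeff (Γ := ℤ) f 0

lemma noNegativePower_ramified (n : ℕ) (hn : 0 < n) (f : PowerSeries K) :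
    (ramified K n hn f).NoNegativePower := by
  intro q hq
  by_contra h
  obtain ⟨k, hk, rfl⟩ := HahnSeries.support_embDomain_subset
    (show q ∈ (ramified K n hn f).1.support from h)
  obtain ⟨l, -, rfl⟩ := HahnSeries.support_embDomain_subset hk
  have : (0 : ℚ) ≤ (n : ℚ)⁻¹ * ((l : ℤ) : ℚ) := by positivity
  exact absurd hq (not_lt.mpr this)

end PowerSeries

end Puiseux

/-! ### Laurent polynomials in one variable -/

section LaurentValue

variable {K L : Type} [Field K] [Field L]

/-- The value at `u` of the Laurent polynomial `∑_{-m ≤ k ≤ M} b_k u^k`; `ι` embeds the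
coefficients. -/
def laurentValue (ι : K →+* L) (b : ℤ → K) (m M : ℕ) (u : L) : L :=
  ∑ k ∈ Finset.Icc (-(m : ℤ)) M, ι (b k) * u ^ k

/-- The polynomial `u^m ∑_{-m ≤ k ≤ M} b_k u^k`. -/
def laurentNumerator (b : ℤ → K) (m M : ℕ) : Polynomial K :=
  ∑ j ∈ Finset.range (m + M + 1), Polynomial.C (b (j - m)) * Polynomial.X ^ j

/-- Inversion exchanges the two ends of the exponent range; this reduces the solutions finite at the
origin to the infinite ones. -/
lemma laurentValue_inv (ι : K →+* L) (b : ℤ → K) (m M : ℕ) (u : L) :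
    laurentValue ι (fun k => b (-k)) M m u = laurentValue ι b m M u⁻¹ := by
  unfold laurentValue
  refine Finset.sum_bij' (fun k _ => -k) (fun k _ => -k) ?_ ?_ ?_ ?_ ?_ <;>
    simp only [Finset.mem_Icc, neg_neg, inv_zpow', implies_true]
  all_goals intros; constructor <;> omega

lemma laurentValue_map {L' : Type} [Field L'] (ι : K →+* L) (φ : L →+* L') (b : ℤ → K) (m M : ℕ)
    (u : L) : φ (laurentValue ι b m M u) = laurentValue (φ.comp ι) b m M (φ u) := by
  simp [laurentValue, map_sum]

lemma sum_Icc_eq_sum_range {A : Type*} [AddCommMonoid A] (m M : ℕ) (g : ℤ → A) :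
    ∑ k ∈ Finset.Icc (-(m : ℤ)) M, g k = ∑ j ∈ Finset.range (m + M + 1), g (j - m) := by
  refine Finset.sum_bij' (fun k _ => (k + m).toNat) (fun j _ => (j : ℤ) - m) ?_ ?_ ?_ ?_ ?_
  · intro k hk; simp only [Finset.mem_Icc, Finset.mem_range] at *; omega
  · intro k hk; simp only [Finset.mem_Icc, Finset.mem_range] at *; omega
  · intro k hk; simp only [Finset.mem_Icc] at *; omega
  · intro k hk; simp only [Finset.mem_range] at *; omega
  · intro k hk; simp only [Finset.mem_Icc] at *; congr 1; omega

lemma eval₂_laurentNumerator (ι : K →+* L) (b : ℤ → K) (m M : ℕ) {u : L} (hu : u ≠ 0) :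
    (laurentNumerator b m M).eval₂ ι u = u ^ m * laurentValue ι b m M u := by
  rw [laurentNumerator, laurentValue, sum_Icc_eq_sum_range, Polynomial.eval₂_finsetSum,
    Finset.mul_sum]
  refine Finset.sum_congr rfl fun j _ => ?_
  rw [Polynomial.eval₂_mul, Polynomial.eval₂_C, Polynomial.eval₂_X_pow, zpow_sub₀ hu,
    zpow_natCast, zpow_natCast]
  field_simp

lemma coeff_laurentNumerator (b : ℤ → K) (m M j : ℕ) (hj : j ≤ m + M) :
    (laurentNumerator b m M).coeff j = b (j - m) := by
  rw [laurentNumerator, Polynomial.finsetSum_coeff]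
  simp only [Polynomial.coeff_C_mul, Polynomial.coeff_X_pow]
  rw [Finset.sum_eq_single j]
  · simp
  · intro i _ hij; simp [hij.symm]
  · intro h; exact absurd (Finset.mem_range.mpr (by omega)) h

lemma natDegree_laurentNumerator_le (b : ℤ → K) (m M : ℕ) :
    (laurentNumerator b m M).natDegree ≤ m + M := by
  refine Polynomial.natDegree_sum_le_of_forall_le _ _ fun j hj => ?_
  refine (Polynomial.natDegree_C_mul_X_pow_le _ _).trans ?_
  have := Finset.mem_range.mp hj
  omega

/-- The polynomial `u^m (f(u) - s)`, for `f` a Laurent polynomial. -/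
def levelPolynomial (ι : K →+* L) (b : ℤ → K) (m M : ℕ) (s : L) : Polynomial L :=
  (laurentNumerator b m M).map ι - Polynomial.C s * Polynomial.X ^ m

lemma eval_levelPolynomial (ι : K →+* L) (b : ℤ → K) (m M : ℕ) (s : L) {u : L} (hu : u ≠ 0) :
    (levelPolynomial ι b m M s).eval u = u ^ m * (laurentValue ι b m M u - s) := by
  rw [levelPolynomial, Polynomial.eval_sub, Polynomial.eval_map, eval₂_laurentNumerator ι b m M hu]
  simp
  ring

/-- Since `0 < M`, the subtracted term `s u^m` does not reach the top degree. -/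
lemma coeff_levelPolynomial (ι : K →+* L) (b : ℤ → K) (m M : ℕ) (hM : 0 < M) (s : L) :
    (levelPolynomial ι b m M s).coeff (m + M) = ι (b M) := by
  rw [levelPolynomial, Polynomial.coeff_sub, Polynomial.coeff_map,
    coeff_laurentNumerator _ _ _ _ le_rfl, Polynomial.coeff_C_mul, Polynomial.coeff_X_pow,
    if_neg (by omega), mul_zero, sub_zero]
  congr 2
  push_cast
  ring

lemma natDegree_levelPolynomial (ι : K →+* L) {b : ℤ → K} (m : ℕ) {M : ℕ} (hM : 0 < M)
    (hb : b M ≠ 0) (s : L) : (levelPolynomial ι b m M s).natDegree = m + M := by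
  refine Polynomial.natDegree_eq_of_le_of_coeff_ne_zero ?_ ?_
  · refine (Polynomial.natDegree_sub_le _ _).trans (max_le ?_ ?_)
    · exact Polynomial.natDegree_map_le.trans (natDegree_laurentNumerator_le b m M)
    · exact (Polynomial.natDegree_C_mul_X_pow_le _ _).trans (by omega)
  · rw [coeff_levelPolynomial ι b m M hM]
    exact (map_ne_zero ι).mpr hb

/-- A set of `m + M` solutions of `f(u) = s` contains all of them, and gives the factorization
of `f(u) - s`. -/
lemma levelPolynomial_eq_prod (ι : K →+* L) {b : ℤ → K} {m M : ℕ} (hM : 0 < M) (hb : b M ≠ 0)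
    (s : L) (R : Finset L) (hcard : R.card = m + M)
    (hR : ∀ u ∈ R, u ≠ 0 ∧ laurentValue ι b m M u = s) :
    levelPolynomial ι b m M s =
      Polynomial.C (ι (b M)) * ∏ r ∈ R, (Polynomial.X - Polynomial.C r) := by
  have hdeg := natDegree_levelPolynomial ι m hM hb s
  have hlead : (levelPolynomial ι b m M s).leadingCoeff = ι (b M) := by
    rw [Polynomial.leadingCoeff, hdeg, coeff_levelPolynomial ι b m M hM]
  have h0 : levelPolynomial ι b m M s ≠ 0 := by
    rw [← Polynomial.leadingCoeff_ne_zero, hlead]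
    exact (map_ne_zero ι).mpr hb
  have hle : R.val ≤ (levelPolynomial ι b m M s).roots := by
    refine (Multiset.le_iff_subset R.nodup).mpr fun u hu => ?_
    rw [Polynomial.mem_roots h0, Polynomial.IsRoot, eval_levelPolynomial _ _ _ _ _ (hR u hu).1,
      (hR u hu).2, sub_self, mul_zero]
  have heq : R.val = (levelPolynomial ι b m M s).roots := by
    refine Multiset.eq_of_le_of_card_le hle ?_
    refine (Polynomial.card_roots' _).trans ?_
    rw [hdeg, Finset.card_val, hcard]
  have := Polynomial.C_leadingCoeff_mul_prod_multiset_X_sub_C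
    (p := levelPolynomial ι b m M s) (by rw [← heq, hdeg, Finset.card_val, hcard])
  rw [← this, hlead, ← heq]
  rfl

lemma mem_iff_of_card_eq (ι : K →+* L) {b : ℤ → K} {m M : ℕ} (hM : 0 < M) (hb : b M ≠ 0)
    (s : L) (R : Finset L) (hcard : R.card = m + M)
    (hR : ∀ u ∈ R, u ≠ 0 ∧ laurentValue ι b m M u = s) (u : L) :
    u ∈ R ↔ u ≠ 0 ∧ laurentValue ι b m M u = s := by
  refine ⟨hR u, fun ⟨hu, h⟩ => ?_⟩
  have := eval_levelPolynomial ι b m M s hu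
  rw [h, sub_self, mul_zero, levelPolynomial_eq_prod ι hM hb s R hcard hR, Polynomial.eval_mul,
    Polynomial.eval_C, Polynomial.eval_prod, mul_eq_zero, Finset.prod_eq_zero_iff] at this
  obtain h | ⟨r, hr, h⟩ := this
  · exact absurd h ((map_ne_zero ι).mpr hb)
  · rw [Polynomial.eval_sub, Polynomial.eval_X, Polynomial.eval_C, sub_eq_zero] at h
    rwa [h]

/-- The Laurent polynomial `f(u) - s` in factored form. -/
lemma laurentValue_sub_eq_prod (ι : K →+* L) {b : ℤ → K} {m M : ℕ} (hM : 0 < M) (hb : b M ≠ 0)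
    (s : L) (R : Finset L) (hcard : R.card = m + M)
    (hR : ∀ u ∈ R, u ≠ 0 ∧ laurentValue ι b m M u = s) {L' : Type} [Field L'] (φ : L →+* L')
    {u : L'} (hu : u ≠ 0) :
    u ^ m * (laurentValue (φ.comp ι) b m M u - φ s) = φ (ι (b M)) * ∏ r ∈ R, (u - φ r) := by
  have h := congrArg (Polynomial.eval₂ φ u) (levelPolynomial_eq_prod ι hM hb s R hcard hR)
  rw [levelPolynomial, Polynomial.eval₂_sub, Polynomial.eval₂_map,
    eval₂_laurentNumerator _ b m M hu, Polynomial.eval₂_mul, Polynomial.eval₂_mul,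
    Polynomial.eval₂_C, Polynomial.eval₂_C, Polynomial.eval₂_X_pow, Polynomial.eval₂_finsetProd]
    at h
  simp only [Polynomial.eval₂_sub, Polynomial.eval₂_X, Polynomial.eval₂_C] at h
  rw [← h]
  ring

end LaurentValue

/-! ### Puiseux expansions of the solutions of `f(u) = s` -/

/-- Hensel's lemma for power series over a field. -/
lemma PowerSeries.exists_root_of_simple_root {K : Type} [Field K]
    (G : Polynomial (PowerSeries K)) (hG : G.Monic) (z : K)
    (hz : (G.map PowerSeries.constantCoeff).eval z = 0)
    (hz' : (G.map PowerSeries.constantCoeff).derivative.eval z ≠ 0) :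
    ∃ Z : PowerSeries K, G.eval Z = 0 ∧ PowerSeries.constantCoeff Z = z := by
  have key : ∀ H : Polynomial (PowerSeries K),
      PowerSeries.constantCoeff (H.eval (PowerSeries.C z)) =
        (H.map PowerSeries.constantCoeff).eval z := by
    intro H
    rw [Polynomial.eval_map, ← Polynomial.eval₂_hom, PowerSeries.constantCoeff_C]
  -- Power series are Henselian along `(X)`; the approximate root is the constant series `z`.
  obtain ⟨Z, hZ, hZ'⟩ := HenselianRing.is_henselian (I := Ideal.span {(PowerSeries.X : PowerSeries K)})
    G hG (PowerSeries.C z)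
    (by rw [Ideal.mem_span_singleton, PowerSeries.X_dvd_iff, key, hz])
    (by
      refine IsUnit.map _ ?_
      rw [PowerSeries.isUnit_iff_constantCoeff, key, ← Polynomial.derivative_map]
      exact isUnit_iff_ne_zero.mpr hz')
  refine ⟨Z, hZ, ?_⟩
  rw [Ideal.mem_span_singleton, PowerSeries.X_dvd_iff, map_sub, PowerSeries.constantCoeff_C,
    sub_eq_zero] at hZ'
  exact hZ'

/-- Every non-zero element has `n` distinct `n`-th roots, for all `n > 0`. -/
def HasAllRoots (K : Type) [Field K] : Prop :=
  ∀ n : ℕ, 0 < n → ∀ a : K, a ≠ 0 → ∃ R : Finset K, R.card = n ∧ ∀ z ∈ R, z ^ n = a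

section Roots

variable {K : Type} [Field K]

/-- The polynomial satisfied by the leading factor `Z` of a large solution `Z τ^(-e)` of
`f(u) = w τ^(-eM)`. -/
def largeRootPolynomial (b : ℤ → K) (m M e : ℕ) (w : PowerSeries K) :
    Polynomial (PowerSeries K) :=
  Polynomial.X ^ (m + M) + (∑ j ∈ Finset.range (m + M),
    Polynomial.C (PowerSeries.C (b (j - m) / b M) * PowerSeries.X ^ (e * (m + M - j))) *
      Polynomial.X ^ j - Polynomial.C (PowerSeries.C (b M)⁻¹ * w) * Polynomial.X ^ m)

lemma monic_largeRootPolynomial (b : ℤ → K) (m : ℕ) {M : ℕ} (hM : 0 < M) (e : ℕ)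
    (w : PowerSeries K) : (largeRootPolynomial b m M e w).Monic := by
  refine Polynomial.monic_X_pow_add ?_
  refine (Polynomial.degree_sub_le _ _).trans_lt (max_lt ?_ ?_)
  · refine (Polynomial.degree_sum_le _ _).trans_lt ?_
    refine (Finset.sup_lt_iff (WithBot.bot_lt_coe (m + M))).mpr fun j hj => ?_
    exact (Polynomial.degree_C_mul_X_pow_le _ _).trans_lt
      (Nat.cast_lt.mpr (Finset.mem_range.mp hj))
  · exact (Polynomial.degree_C_mul_X_pow_le _ _).trans_lt (Nat.cast_lt.mpr (by omega))

/-- Every term of the sum over `j < m + M` carries a positive power of the variable, so only the two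
dominant terms of `f(u) = s` survive. The non-zero roots of the reduction are the `M`-th roots of
`w(0) / b_M`. -/
lemma map_largeRootPolynomial (b : ℤ → K) (m M : ℕ) {e : ℕ} (he : 0 < e)
    (w : PowerSeries K) : (largeRootPolynomial b m M e w).map PowerSeries.constantCoeff =
      Polynomial.X ^ (m + M) -
        Polynomial.C (PowerSeries.constantCoeff w / b M) * Polynomial.X ^ m := by
  rw [largeRootPolynomial, Polynomial.map_add, Polynomial.map_sub, Polynomial.map_sum,
    Finset.sum_eq_zero]
  · simp [div_eq_inv_mul, sub_eq_add_neg]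
  · intro j hj
    have : e * (m + M - j) ≠ 0 := by
      have := Finset.mem_range.mp hj
      exact (Nat.mul_pos he (by omega)).ne'
    simp [this]

/-- With `τ` the `M`-th root of the variable, the ansatz `X = Z τ^(-e)` balances `b_M X^M` against
the pole of `s`, and Hensel's lemma lifts the simple root `z` to `Z`. The coefficient of the leading
term is recorded because it distinguishes the solutions obtained from different `z`. -/
lemma exists_largeRoot [CharZero K] (b : ℤ → K) (m : ℕ) {M : ℕ} (hM : 0 < M) (hb : b M ≠ 0)
    {e : ℕ} (he : 0 < e) (w : Polynomial K) (hw : w.coeff 0 ≠ 0) (s : Puiseux K)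
    (hs : s * gen K ^ e = w.eval₂ (const K) (gen K)) (z : K) (hz : z ^ M = w.coeff 0 / b M) :
    ∃ X : Puiseux K, X ≠ 0 ∧ laurentValue (const K) b m M X = s ∧ X⁻¹.NoNegativePower ∧
      X.coeff (-((M : ℚ)⁻¹ * e)) = z := by
  -- The variable of these power series stands for `τ`, so the original variable becomes `X ^ M`.
  set W : PowerSeries K := w.eval₂ PowerSeries.C (PowerSeries.X ^ M) with hW
  have hW0 : PowerSeries.constantCoeff W = w.coeff 0 := by
    rw [hW, Polynomial.hom_eval₂, map_pow, PowerSeries.constantCoeff_X, zero_pow hM.ne',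
      show PowerSeries.constantCoeff.comp PowerSeries.C = RingHom.id K from
        RingHom.ext fun c => PowerSeries.constantCoeff_C c]
    rw [Polynomial.eval₂_at_zero]; rfl
  have hz0 : z ≠ 0 := by
    rintro rfl
    rw [zero_pow hM.ne'] at hz
    exact div_ne_zero hw hb hz.symm
  obtain ⟨Z, hZ, hZ0⟩ := PowerSeries.exists_root_of_simple_root (largeRootPolynomial b m M e W)
    (monic_largeRootPolynomial b m hM e W) z
    (by
      rw [map_largeRootPolynomial b m M he, hW0, ← hz]
      simp [pow_add, mul_comm])
    (by
      rw [map_largeRootPolynomial b m M he, hW0, ← hz]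
      intro h
      -- Multiplied by `z`, the derivative at `z` becomes `M z^(m+M)`, which is non-zero in
      -- characteristic zero; this also avoids the exponent `m - 1` when `m = 0`.
      have h2 := congrArg (· * z) h
      simp only [Polynomial.derivative_sub, Polynomial.derivative_X_pow, Polynomial.derivative_C_mul,
        Polynomial.eval_sub, Polynomial.eval_mul, Polynomial.eval_pow, Polynomial.eval_X,
        Polynomial.eval_C, zero_mul, Polynomial.eval_natCast, map_natCast] at h2
      have h3 : (m : K) * z ^ (m - 1) * z = m * z ^ m := by
        rcases Nat.eq_zero_or_pos m with rfl | hm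
        · simp
        · rw [mul_assoc, ← pow_succ, Nat.sub_add_cancel hm]
      have h4 : z ^ (m + M - 1) * z = z ^ (m + M) := by
        rw [← pow_succ, Nat.sub_add_cancel (by omega)]
      have h5 : (M : K) * (z ^ M * z ^ m) = 0 := by
        rw [sub_mul, mul_assoc, h4, mul_assoc (z ^ M), h3, pow_add] at h2
        push_cast at h2
        linear_combination h2
      simp [hz0, hM.ne'] at h5)
  set ρ := ramified K M hM with hρ
  set τ := mono K ((M : ℚ)⁻¹) with hτ
  have hτ0 : τ ≠ 0 := mono_ne_zero _
  have hρX : ρ PowerSeries.X = τ := ramified_X M hM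
  have hτM : τ ^ M = gen K := by
    rw [hτ, mono_pow, mul_inv_cancel₀ (by exact_mod_cast hM.ne'), mono_one]
  have hρW : ρ W = s * gen K ^ e := by
    rw [hs, hW, Polynomial.hom_eval₂, map_pow, hρX, hτM]
    congr 1
    exact RingHom.ext fun c => ramified_C M hM c
  have hZne : Z ≠ 0 := by
    rintro rfl
    exact hz0 (by rw [← hZ0, map_zero])
  have hZinv : Z * Z⁻¹ = 1 := PowerSeries.mul_inv_cancel Z (by rwa [hZ0])
  have hρZ : ρ Z * ρ Z⁻¹ = 1 := by rw [← map_mul, hZinv, map_one]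
  have hρZ0 : ρ Z ≠ 0 := left_ne_zero_of_mul_eq_one hρZ
  refine ⟨ρ Z * (τ ^ e)⁻¹, mul_ne_zero hρZ0 (inv_ne_zero (pow_ne_zero _ hτ0)), ?_, ?_, ?_⟩
  · set X := ρ Z * (τ ^ e)⁻¹ with hX
    have hX0 : X ≠ 0 := mul_ne_zero hρZ0 (inv_ne_zero (pow_ne_zero _ hτ0))
    have hZX : ρ Z = X * τ ^ e := by rw [hX]; field_simp
    have h1 := congrArg ρ hZ
    have h2 : ∑ j ∈ Finset.range (m + M + 1), const K (b (j - m)) * X ^ j = s * X ^ m := by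
      have hb' : const K (b M) ≠ 0 := (map_ne_zero _).mpr hb
      have hne : τ ^ (e * (m + M)) ≠ 0 := pow_ne_zero _ hτ0
      -- Scaling by `τ^(e(m+M)) / b_M` turns the equation for `X` into the monic equation satisfied
      -- by `Z`.
      refine mul_left_cancel₀ (mul_ne_zero (inv_ne_zero hb') hne) ?_
      rw [largeRootPolynomial, Polynomial.eval_add, Polynomial.eval_sub, Polynomial.eval_finsetSum]
        at h1
      simp only [Polynomial.eval_mul, Polynomial.eval_pow, Polynomial.eval_X, Polynomial.eval_C,
        map_add, map_sub, map_sum, map_mul, map_pow, map_zero, hρX, hρW, hZX] at h1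
      have hC : ∀ c : K, ρ (PowerSeries.C c) = const K c := ramified_C M hM
      simp only [hC, map_div₀, map_inv₀] at h1
      rw [Finset.sum_range_succ, show (((m + M : ℕ) : ℤ) - m) = M by push_cast; ring, mul_add,
        Finset.mul_sum]
      have h3 : ∀ j ∈ Finset.range (m + M),
          const K (b (j - m)) / const K (b M) * τ ^ (e * (m + M - j)) * (X * τ ^ e) ^ j =
          (const K (b M))⁻¹ * τ ^ (e * (m + M)) * (const K (b (j - m)) * X ^ j) := by
        intro j hj
        have hj' := Finset.mem_range.mp hj
        have : e * (m + M) = e * (m + M - j) + e * j := by rw [← mul_add]; congr 1; omega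
        rw [this, pow_add, mul_pow, ← pow_mul]
        field_simp
      rw [Finset.sum_congr rfl h3] at h1
      have h4 : (const K (b M))⁻¹ * τ ^ (e * (m + M)) * (const K (b M) * X ^ (m + M)) =
          (X * τ ^ e) ^ (m + M) := by
        rw [mul_pow X, ← pow_mul]
        field_simp
      have h5 : (const K (b M))⁻¹ * (s * gen K ^ e) * (X * τ ^ e) ^ m =
          (const K (b M))⁻¹ * τ ^ (e * (m + M)) * (s * X ^ m) := by
        rw [← hτM]
        ring
      rw [h4, ← h5]
      linear_combination h1
    have h3 := eval₂_laurentNumerator (const K) b m M hX0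
    rw [laurentNumerator, Polynomial.eval₂_finsetSum] at h3
    simp only [Polynomial.eval₂_mul, Polynomial.eval₂_C, Polynomial.eval₂_X_pow] at h3
    rw [h2, mul_comm] at h3
    exact (mul_left_cancel₀ (pow_ne_zero _ hX0) h3).symm
  · have : (ρ Z * (τ ^ e)⁻¹)⁻¹ = ρ Z⁻¹ * τ ^ e := by
      rw [mul_inv, inv_inv, ← eq_inv_of_mul_eq_one_right hρZ]
    rw [this, hτ, mono_pow]
    exact (noNegativePower_ramified M hM _).mul (noNegativePower_mono (by positivity))
  · rw [mul_comm, hτ, mono_pow, ← mono_neg, coeff_mono_mul]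
    rw [show -((M : ℚ)⁻¹ * e) - -((e : ℚ) * (M : ℚ)⁻¹) = 0 by ring, coeff_ramified_zero, hZ0]

/-- The solutions of `f(u) = s` that are infinite at the origin. -/
lemma exists_largeRoots [CharZero K] (hK : HasAllRoots K) (b : ℤ → K) (m : ℕ) {M : ℕ}
    (hM : 0 < M) (hb : b M ≠ 0) {e : ℕ} (he : 0 < e) (w : Polynomial K) (hw : w.coeff 0 ≠ 0)
    (s : Puiseux K) (hs : s * gen K ^ e = w.eval₂ (const K) (gen K)) :
    ∃ R : Finset (Puiseux K), R.card = M ∧ ∀ X ∈ R, X ≠ 0 ∧ laurentValue (const K) b m M X = s ∧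
      X⁻¹.NoNegativePower ∧ ¬ X.NoNegativePower := by
  classical
  obtain ⟨R, hR, hRz⟩ := hK M hM (w.coeff 0 / b M) (div_ne_zero hw hb)
  choose! X hX using fun z hz => exists_largeRoot b m hM hb he w hw s hs z (hRz z hz)
  refine ⟨R.image X, ?_, ?_⟩
  · rw [Finset.card_image_of_injOn, hR]
    intro z hz z' hz' h
    rw [← (hX z hz).2.2.2, ← (hX z' hz').2.2.2]
    exact congrArg (fun Y : Puiseux K => Y.coeff (-((M : ℚ)⁻¹ * e))) h
  · simp only [Finset.forall_mem_image]
    intro z hz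
    obtain ⟨h1, h2, h3, h4⟩ := hX z hz
    refine ⟨h1, h2, h3, fun h => ?_⟩
    have hz0 : z ≠ 0 := by
      rintro rfl
      have := hRz 0 hz
      rw [zero_pow hM.ne'] at this
      exact div_ne_zero hw hb this.symm
    apply hz0
    rw [← h4]
    refine h _ (neg_neg_of_pos ?_)
    have : (0 : ℚ) < M := by exact_mod_cast hM
    have : (0 : ℚ) < e := by exact_mod_cast he
    positivity

/-- The solutions of `f(u) = s`, for a series `s` with a pole at the origin: `m` of them are
finite at the origin, and `M` are infinite. -/
theorem exists_roots [CharZero K] (hK : HasAllRoots K) (b : ℤ → K) (m : ℕ) {M : ℕ}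
    (hM : 0 < M) (hb : b M ≠ 0) (hb' : m = 0 ∨ b (-m) ≠ 0) {e : ℕ} (he : 0 < e)
    (w : Polynomial K) (hw : w.coeff 0 ≠ 0)
    (s : Puiseux K) (hs : s * gen K ^ e = w.eval₂ (const K) (gen K)) :
    ∃ A B : Finset (Puiseux K), A.card = m ∧ B.card = M ∧
      (∀ X ∈ A, X ≠ 0 ∧ laurentValue (const K) b m M X = s ∧ X.NoNegativePower) ∧
      (∀ X ∈ B, X ≠ 0 ∧ laurentValue (const K) b m M X = s ∧ ¬ X.NoNegativePower) := by
  classical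
  obtain ⟨B, hB, hBX⟩ := exists_largeRoots hK b m hM hb he w hw s hs
  have hA : ∃ A : Finset (Puiseux K), A.card = m ∧
      ∀ X ∈ A, X ≠ 0 ∧ laurentValue (const K) b m M X = s ∧ X.NoNegativePower := by
    rcases Nat.eq_zero_or_pos m with rfl | hm
    · exact ⟨∅, rfl, by simp⟩
    -- Infinite solutions of `f(1/u) = s`, for which `b_{-m}` is now the leading coefficient; their
    -- inverses are the finite solutions sought.
    · obtain ⟨A, hA, hAX⟩ := exists_largeRoots hK (fun k => b (-k)) M hm
        (hb'.resolve_left hm.ne') he w hw s hs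
      refine ⟨A.image (·⁻¹), ?_, ?_⟩
      · rw [Finset.card_image_of_injective _ inv_injective, hA]
      · simp only [Finset.forall_mem_image]
        intro X hX
        obtain ⟨h1, h2, h3, -⟩ := hAX X hX
        exact ⟨inv_ne_zero h1, by rw [← laurentValue_inv, h2], h3⟩
  obtain ⟨A, hA, hAX⟩ := hA
  exact ⟨A, B, hA, hB, hAX, fun X hX => ⟨(hBX X hX).1, (hBX X hX).2.1, (hBX X hX).2.2.2⟩⟩

end Roots

/-! ### Fields with all roots, and algebraic coefficients -/

lemma hasAllRoots_of_isPrimitiveRoot {K : Type} [Field K]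
    (hζ : ∀ n : ℕ, 0 < n → ∃ ζ : K, IsPrimitiveRoot ζ n)
    (hroot : ∀ n : ℕ, 0 < n → ∀ a : K, a ≠ 0 → ∃ z, z ^ n = a) : HasAllRoots K := by
  classical
  intro n hn a ha
  obtain ⟨ζ, hζ⟩ := hζ n hn
  obtain ⟨z, hz⟩ := hroot n hn a ha
  have hz0 : z ≠ 0 := by
    rintro rfl
    exact ha (by rw [← hz, zero_pow hn.ne'])
  refine ⟨(Finset.range n).image fun i => z * ζ ^ i, ?_, ?_⟩
  · rw [Finset.card_image_of_injOn, Finset.card_range]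
    intro i hi j hj h
    exact hζ.pow_inj (by simpa using hi) (by simpa using hj) (mul_left_cancel₀ hz0 h)
  · simp only [Finset.forall_mem_image]
    intro i _
    rw [mul_pow, hz, ← pow_mul, mul_comm i, pow_mul, hζ.pow_eq_one, one_pow, mul_one]

lemma hasAllRoots_complex : HasAllRoots ℂ :=
  hasAllRoots_of_isPrimitiveRoot
    (fun n hn => ⟨_, Complex.isPrimitiveRoot_exp n hn.ne'⟩)
    (fun _ hn a _ => IsAlgClosed.exists_pow_nat_eq a hn)

lemma PowerSeries.exists_pow_eq {K : Type} [Field K] [CharZero K] {n : ℕ} (hn : 0 < n)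
    (w : PowerSeries K) (z : K) (hz0 : z ≠ 0) (hz : z ^ n = PowerSeries.constantCoeff w) :
    ∃ Z : PowerSeries K, Z ^ n = w := by
  obtain ⟨Z, hZ, -⟩ := PowerSeries.exists_root_of_simple_root
    (Polynomial.X ^ n - Polynomial.C w) (Polynomial.monic_X_pow_sub_C w hn.ne') z
    (by simp [hz]) (by simp [Polynomial.derivative_X_pow, hz0, hn.ne'])
  refine ⟨Z, ?_⟩
  simpa [sub_eq_zero] using hZ

/-- A non-zero series is a monomial times a ramified power series with non-zero constant term. The
monomial has an `n`-th root because exponents are rational, the other factor by Hensel's lemma. -/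
lemma Puiseux.exists_pow_eq {K : Type} [Field K] [CharZero K]
    (hroot : ∀ n : ℕ, 0 < n → ∀ a : K, a ≠ 0 → ∃ z, z ^ n = a) {n : ℕ} (hn : 0 < n)
    (a : Puiseux K) (ha : a ≠ 0) : ∃ z, z ^ n = a := by
  obtain ⟨N, hN, hf⟩ := a.2
  obtain ⟨g, hg⟩ := exists_scaleExponents a.1 N hN hf
  have hg0 : g ≠ 0 := by
    rintro rfl
    exact ha (Subtype.ext (by rw [← hg, map_zero]; rfl))
  have hdec : a = mono K ((N : ℚ)⁻¹ * g.order) * ramified K N hN (LaurentSeries.powerSeriesPart g) := by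
    refine Subtype.ext ?_
    rw [← hg]
    conv_lhs => rw [← LaurentSeries.single_order_mul_powerSeriesPart g, map_mul,
      scaleExponents_single]
    rfl
  have hw0 : PowerSeries.constantCoeff (LaurentSeries.powerSeriesPart g) ≠ 0 := by
    rw [← PowerSeries.coeff_zero_eq_constantCoeff_apply, LaurentSeries.powerSeriesPart_coeff]
    simpa using HahnSeries.coeff_order_eq_zero.not.mpr hg0
  obtain ⟨z, hz⟩ := hroot n hn _ hw0
  obtain ⟨Z, hZ⟩ := PowerSeries.exists_pow_eq hn _ z
    (by rintro rfl; rw [zero_pow hn.ne'] at hz; exact hw0 hz.symm) hz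
  refine ⟨mono K ((n : ℚ)⁻¹ * ((N : ℚ)⁻¹ * g.order)) * ramified K N hN Z, ?_⟩
  rw [mul_pow, mono_pow, mul_inv_cancel_left₀ (by exact_mod_cast hn.ne'), ← map_pow, hZ, ← hdec]

lemma hasAllRoots_puiseux_complex : HasAllRoots (Puiseux ℂ) :=
  hasAllRoots_of_isPrimitiveRoot
    (fun n hn => ⟨_, (Complex.isPrimitiveRoot_exp n hn.ne').map_of_injective (f := const ℂ)
      const_injective⟩)
    (fun _ hn a ha => Puiseux.exists_pow_eq
      (fun _ hn a _ => IsAlgClosed.exists_pow_nat_eq a hn) hn a ha)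

instance {K : Type} [Field K] [CharZero K] : CharZero (Puiseux K) :=
  charZero_of_injective_ringHom (const_injective (K := K))

section Algebraic

variable {K : Type} [Field K] (F : Subfield K)

/-- A root of an algebraic element is algebraic. Hence the whole construction of the solutions can
be run over the relative algebraic closure. -/
lemma hasAllRoots_algebraicClosure (hK : HasAllRoots K) : HasAllRoots (algebraicClosure F K) := by
  classical
  intro n hn a ha
  obtain ⟨R, hR, hRa⟩ := hK n hn a (by simpa using ha)
  have halg : ∀ z ∈ R, z ∈ algebraicClosure F K := fun z hz => by
    rw [mem_algebraicClosure_iff]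
    refine IsAlgebraic.of_pow hn ?_
    rw [hRa z hz]
    exact mem_algebraicClosure_iff.mp a.2
  refine ⟨R.attach.image fun z => ⟨z.1, halg z.1 z.2⟩, ?_, ?_⟩
  · rw [Finset.card_image_of_injective, Finset.card_attach, hR]
    intro z z' h
    exact Subtype.ext (congrArg (fun y : algebraicClosure F K => (y : K)) h)
  · simp only [Finset.forall_mem_image]
    intro z _
    exact Subtype.ext (hRa z.1 z.2)

/-- The solutions of `f(u) = s` have algebraic coefficients over a field that contains the
coefficients of `f` and `s`. -/
theorem exists_roots_isAlgebraic [CharZero K] (hK : HasAllRoots K) (b : ℤ → K)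
    (hbF : ∀ k, b k ∈ F) (m : ℕ) {M : ℕ}
    (hM : 0 < M) (hb : b M ≠ 0) (hb' : m = 0 ∨ b (-m) ≠ 0) {e : ℕ} (he : 0 < e)
    (w : Polynomial K) (hwF : ∀ k, w.coeff k ∈ F) (hw : w.coeff 0 ≠ 0)
    (s : Puiseux K) (hs : s * gen K ^ e = w.eval₂ (const K) (gen K)) :
    ∃ A B : Finset (Puiseux K), A.card = m ∧ B.card = M ∧
      (∀ X ∈ A, X ≠ 0 ∧ laurentValue (const K) b m M X = s ∧ X.NoNegativePower) ∧
      (∀ X ∈ B, X ≠ 0 ∧ laurentValue (const K) b m M X = s ∧ ¬ X.NoNegativePower) ∧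
      ∀ X, X ∈ A ∨ X ∈ B → ∀ q, IsAlgebraic F (X.coeff q) := by
  classical
  set F' := algebraicClosure F K
  set φ : F' →+* K := algebraMap F' K
  set ψ := mapRing φ with hψ
  have hmem : ∀ c ∈ F, c ∈ F' := fun c hc =>
    mem_algebraicClosure_iff.mpr (isAlgebraic_algebraMap (⟨c, hc⟩ : F))
  set b₀ : ℤ → F' := fun k => ⟨b k, hmem _ (hbF k)⟩
  have hw' : w ∈ Polynomial.lifts φ := by
    rw [Polynomial.lifts_iff_coeff_lifts]
    exact fun k => ⟨⟨w.coeff k, hmem _ (hwF k)⟩, rfl⟩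
  obtain ⟨w₀, rfl⟩ := hw'
  have hcomp : ψ.comp (const F') = (const K).comp φ := RingHom.ext fun c => mapRing_const φ c
  have hgen : ψ (gen F') = gen K := mapRing_gen φ
  -- The right-hand side `s` is rebuilt from its numerator `w`, whose coefficients are already known
  -- to lie in `F'`.
  set s₀ : Puiseux F' := w₀.eval₂ (const F') (gen F') / gen F' ^ e with hs₀
  have hψs : ψ s₀ = s := by
    rw [hs₀, map_div₀, map_pow, hgen, Polynomial.hom_eval₂, hcomp, hgen]
    rw [Polynomial.coe_mapRingHom, Polynomial.eval₂_map] at hs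
    rw [← hs, mul_div_cancel_right₀ _ (pow_ne_zero _ gen_ne_zero)]
  have hval : ∀ X, laurentValue (const K) b m M (ψ X) = ψ (laurentValue (const F') b₀ m M X) := by
    intro X
    rw [laurentValue_map, hcomp]
    rfl
  have hne : ∀ c : F', φ c ≠ 0 → c ≠ 0 := fun c hc h => hc (by rw [h, map_zero])
  obtain ⟨A, B, hA, hB, hAX, hBX⟩ := exists_roots (hasAllRoots_algebraicClosure F hK) b₀ m hM
    (hne _ hb) (hb'.imp_right fun h => hne _ h) he w₀
    (hne _ (by rwa [Polynomial.coe_mapRingHom, Polynomial.coeff_map] at hw)) s₀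
    (div_mul_cancel₀ _ (pow_ne_zero _ gen_ne_zero))
  have hinj : Function.Injective ψ := ψ.injective
  refine ⟨A.image ψ, B.image ψ, by rw [Finset.card_image_of_injective _ hinj, hA],
    by rw [Finset.card_image_of_injective _ hinj, hB], ?_, ?_, ?_⟩
  · simp only [Finset.forall_mem_image]
    intro X hX
    obtain ⟨h1, h2, h3⟩ := hAX X hX
    exact ⟨(map_ne_zero ψ).mpr h1, by rw [hval, h2, hψs], (noNegativePower_mapRing φ X).mpr h3⟩
  · simp only [Finset.forall_mem_image]
    intro X hX
    obtain ⟨h1, h2, h3⟩ := hBX X hX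
    exact ⟨(map_ne_zero ψ).mpr h1, by rw [hval, h2, hψs], mt (noNegativePower_mapRing φ X).mp h3⟩
  · intro Y hY q
    obtain ⟨X, -, rfl⟩ : ∃ X, True ∧ ψ X = Y := by
      simp only [Finset.mem_image] at hY
      rcases hY with ⟨X, -, h⟩ | ⟨X, -, h⟩ <;> exact ⟨X, trivial, h⟩
    exact mem_algebraicClosure_iff.mp (X.coeff q).2

end Algebraic

/-! ### Weighted walks on a half-line -/

section HalfLine

variable {K : Type} [Field K]

/-- The generating polynomial of the walks of length `n` on `ℕ` that start at `0` and take the step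
`k` with weight `b k`, for `-m ≤ k ≤ M`. -/
def halfLine (b : ℤ → K) (m M : ℕ) : ℕ → Polynomial K
  | 0 => 1
  | n + 1 => (laurentNumerator b m M * halfLine b m M n) /ₘ (Polynomial.X ^ m)

/-- `u^m` times the weighted walks of length `n + 1` whose first point outside `ℕ` is the last. -/
def halfLineExit (b : ℤ → K) (m M n : ℕ) : Polynomial K :=
  (laurentNumerator b m M * halfLine b m M n) %ₘ (Polynomial.X ^ m)

lemma degree_halfLineExit_lt (b : ℤ → K) (m M n : ℕ) : (halfLineExit b m M n).degree < m := by
  have := Polynomial.degree_modByMonic_lt (laurentNumerator b m M * halfLine b m M n)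
    (Polynomial.monic_X_pow (R := K) m)
  rwa [Polynomial.degree_X_pow] at this

/-- Dividing by `u^m` sorts the extended walks by endpoint: the quotient keeps those still in `ℕ`,
the remainder those that have just left it. -/
lemma eval₂_halfLine_succ {L : Type} [Field L] (ι : K →+* L) (b : ℤ → K) (m M n : ℕ) {u : L}
    (hu : u ≠ 0) : u ^ m * (halfLine b m M (n + 1)).eval₂ ι u =
      u ^ m * laurentValue ι b m M u * (halfLine b m M n).eval₂ ι u -
        (halfLineExit b m M n).eval₂ ι u := by
  have h := congrArg (Polynomial.eval₂ ι u) (Polynomial.modByMonic_add_div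
    (laurentNumerator b m M * halfLine b m M n) (Polynomial.X ^ m : Polynomial K))
  rw [Polynomial.eval₂_add, Polynomial.eval₂_mul, Polynomial.eval₂_mul, Polynomial.eval₂_X_pow,
    eval₂_laurentNumerator ι b m M hu] at h
  rw [← h, halfLineExit, halfLine]
  ring

lemma gen_inv_pow (n : ℕ) : (gen K)⁻¹ ^ n = mono K (-n) := by
  rw [inv_pow, gen_pow, mono_neg]

lemma gen_inv_ne_zero : (gen K)⁻¹ ≠ 0 := inv_ne_zero gen_ne_zero

/-- `x^(-m) R(x)` has only negative powers of `x` if `R` has degree less than `m`, with coefficients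
that do not involve positive powers of `x`. -/
lemma nonnegPart_gen_pow_mul_eval {m : ℕ} {R : Polynomial (Puiseux K)} (hR : R.degree < m)
    (hint : ∀ i, (R.coeff i).NoNegativePower) :
    nonnegPart K (gen K ^ m * R.eval (gen K)⁻¹) = 0 := by
  rcases Nat.eq_zero_or_pos m with rfl | hm
  · rw [Nat.cast_zero, Nat.WithBot.lt_zero_iff, Polynomial.degree_eq_bot] at hR
    simp [hR]
  have hdeg : R.natDegree < m := by
    by_cases h0 : R = 0
    · simp [h0, hm]
    · exact (Polynomial.natDegree_lt_iff_degree_lt h0).mpr hR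
  rw [Polynomial.eval_eq_sum_range' hdeg, Finset.mul_sum, nonnegPart_sum]
  refine Finset.sum_eq_zero fun i hi => ?_
  have hi' : (i : ℚ) < m := by exact_mod_cast Finset.mem_range.mp hi
  rw [gen_inv_pow, gen_pow, mul_left_comm, ← mono_add, mul_comm]
  exact nonnegPart_mono_mul_eq_zero (by linarith) (hint i)

lemma nonnegPart_eval₂_const (p : Polynomial K) :
    nonnegPart K (p.eval₂ (const K) (gen K)⁻¹) = p.eval₂ (const K) (gen K)⁻¹ := by
  rw [Polynomial.eval₂_eq_sum_range, nonnegPart_sum]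
  refine Finset.sum_congr rfl fun i _ => ?_
  rw [gen_inv_pow, nonnegPart_const_mul_mono, if_pos (by simp)]

lemma nonnegPart_gen_pow_mul_eval₂_const {m : ℕ} {p : Polynomial K} (hp : p.degree < m) :
    nonnegPart K (gen K ^ m * p.eval₂ (const K) (gen K)⁻¹) = 0 := by
  rw [← Polynomial.eval_map]
  refine nonnegPart_gen_pow_mul_eval ?_ fun i => ?_
  · rwa [Polynomial.degree_map]
  · rw [Polynomial.coeff_map]
    exact noNegativePower_const _

/-- Half-line walks grow by one step, restricted to `ℕ`. -/
lemma nonnegPart_laurentValue_mul_halfLine (b : ℤ → K) (m M n : ℕ) :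
    nonnegPart K (laurentValue (const K) b m M (gen K)⁻¹ *
      (halfLine b m M n).eval₂ (const K) (gen K)⁻¹) =
        (halfLine b m M (n + 1)).eval₂ (const K) (gen K)⁻¹ := by
  have h := eval₂_halfLine_succ (const K) b m M n gen_inv_ne_zero
  have hg : (gen K ^ m) * (gen K)⁻¹ ^ m = 1 := by
    rw [← mul_pow, mul_inv_cancel₀ gen_ne_zero, one_pow]
  have h2 : laurentValue (const K) b m M (gen K)⁻¹ *
      (halfLine b m M n).eval₂ (const K) (gen K)⁻¹ =
      (halfLine b m M (n + 1)).eval₂ (const K) (gen K)⁻¹ +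
        gen K ^ m * (halfLineExit b m M n).eval₂ (const K) (gen K)⁻¹ := by
    linear_combination (-(gen K ^ m)) * h + ((halfLine b m M (n + 1)).eval₂ (const K) (gen K)⁻¹ -
      laurentValue (const K) b m M (gen K)⁻¹ *
      (halfLine b m M n).eval₂ (const K) (gen K)⁻¹) * hg
  rw [h2, nonnegPart_add, nonnegPart_eval₂_const,
    nonnegPart_gen_pow_mul_eval₂_const (degree_halfLineExit_lt b m M n), add_zero]

/-- The remainder of `u^m h_n(u)` in the division by `D(u)`, when `f` takes the value `s` at the
roots of `D`. -/
def halfLineRemainder (b : ℤ → K) (m M : ℕ) (D : Polynomial (Puiseux K)) (s : Puiseux K) :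
    ℕ → Polynomial (Puiseux K)
  | 0 => Polynomial.X ^ m - D
  | n + 1 => Polynomial.C s * halfLineRemainder b m M D s n -
      (halfLineExit b m M n).map (const K)

lemma degree_halfLineRemainder_lt (b : ℤ → K) (m M : ℕ) {D : Polynomial (Puiseux K)}
    (hD : D.Monic) (hm : D.natDegree = m) (s : Puiseux K) (n : ℕ) :
    (halfLineRemainder b m M D s n).degree < m := by
  induction n with
  | zero =>
    rw [halfLineRemainder]
    refine (Polynomial.degree_sub_lt_left ?_ (Polynomial.monic_X_pow m).ne_zero ?_).trans_eq
      (Polynomial.degree_X_pow m)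
    · rw [Polynomial.degree_X_pow, Polynomial.degree_eq_natDegree hD.ne_zero, hm]
    · rw [hD.leadingCoeff, (Polynomial.monic_X_pow m).leadingCoeff]
  | succ n ih =>
    rw [halfLineRemainder]
    refine (Polynomial.degree_sub_le _ _).trans_lt (max_lt ?_ ?_)
    · rw [← Polynomial.smul_eq_C_mul]
      exact (Polynomial.degree_smul_le _ _).trans_lt ih
    · rw [Polynomial.degree_map]
      exact degree_halfLineExit_lt b m M n

/-- The point `u` need not be a root of `D`: the identity serves both at the roots of `D` and at `u
= x`, where `D(u)` does not vanish. -/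
lemma eval_halfLineRemainder (b : ℤ → K) (m M : ℕ) (D : Polynomial (Puiseux K)) (s : Puiseux K)
    (n : ℕ) {u : Puiseux K} (hu : u ≠ 0) (hs : laurentValue (const K) b m M u = s) :
    (halfLineRemainder b m M D s n).eval u =
      u ^ m * (halfLine b m M n).eval₂ (const K) u - D.eval u * s ^ n := by
  induction n with
  | zero => simp [halfLineRemainder, halfLine]
  | succ n ih =>
    have h := eval₂_halfLine_succ (const K) b m M n hu
    rw [hs] at h
    rw [halfLineRemainder, Polynomial.eval_sub, Polynomial.eval_mul, Polynomial.eval_C, ih,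
      Polynomial.eval_map]
    linear_combination -h

/-- Both sides have degree below `m` and agree at the `m` roots of `D`, where the term `D(u) s^n`
disappears. The point is to eliminate `s`, which has positive powers of `x` and hides the
integrality of the coefficients. -/
lemma halfLineRemainder_eq_modByMonic (b : ℤ → K) {m : ℕ} (M : ℕ) (A : Finset (Puiseux K))
    (hA : A.card = m) (s : Puiseux K)
    (hAs : ∀ u ∈ A, u ≠ 0 ∧ laurentValue (const K) b m M u = s) (n : ℕ) :
    halfLineRemainder b m M (∏ a ∈ A, (Polynomial.X - Polynomial.C a)) s n =
      (Polynomial.X ^ m * (halfLine b m M n).map (const K)) %ₘ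
        ∏ a ∈ A, (Polynomial.X - Polynomial.C a) := by
  have hD := Polynomial.monic_prod_X_sub_C (fun a : Puiseux K => a) A
  have hDdeg : (∏ a ∈ A, (Polynomial.X - Polynomial.C a)).natDegree = m := by
    rw [Polynomial.natDegree_finsetProd_X_sub_C_eq_card, hA]
  refine Polynomial.eq_of_degrees_lt_of_eval_finset_eq A ?_ ?_ fun u hu => ?_
  · rw [hA]
    exact degree_halfLineRemainder_lt b m M hD hDdeg s n
  · refine (Polynomial.degree_modByMonic_lt _ hD).trans_eq ?_
    rw [Polynomial.degree_eq_natDegree hD.ne_zero, hDdeg, hA]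
  · have hroot : (∏ a ∈ A, (Polynomial.X - Polynomial.C a)).IsRoot u := by
      rw [Polynomial.IsRoot, Polynomial.eval_prod]
      exact Finset.prod_eq_zero hu (by simp)
    rw [eval_halfLineRemainder b m M _ s n (hAs u hu).1 (hAs u hu).2, hroot, zero_mul, sub_zero,
      show Polynomial.eval u (_ %ₘ _) = Polynomial.eval u _ from
        Polynomial.eval₂_modByMonic_eq_self_of_root hroot]
    simp [Polynomial.eval_map]

/-- The divisor is monic, so the division takes place over `intRing K`, which contains the constants
and the elements of `A`. -/
lemma noNegativePower_coeff_modByMonic (p : Polynomial K) (m : ℕ) (A : Finset (Puiseux K))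
    (hA : ∀ a ∈ A, a.NoNegativePower) (i : ℕ) :
    (((Polynomial.X ^ m * p.map (const K)) %ₘ
      ∏ a ∈ A, (Polynomial.X - Polynomial.C a)).coeff i).NoNegativePower := by
  set ι := (intRing K).subtype with hι
  set c : K →+* intRing K := (const K).codRestrict (intRing K) noNegativePower_const with hc
  have h1 : ι.comp c = const K := RingHom.ext fun _ => rfl
  have h2 : (∏ a ∈ A, (Polynomial.X - Polynomial.C a)) =
      (∏ a ∈ A.attach, (Polynomial.X - Polynomial.C
        (⟨a.1, hA a.1 a.2⟩ : intRing K))).map ι := by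
    rw [Polynomial.map_prod, ← Finset.prod_attach]
    simp [hι]
  have h3 : Polynomial.X ^ m * p.map (const K) = (Polynomial.X ^ m * p.map c).map ι := by
    rw [Polynomial.map_mul, Polynomial.map_map, h1, Polynomial.map_pow, Polynomial.map_X]
  rw [h2, h3, ← Polynomial.map_modByMonic ι (Polynomial.monic_prod_X_sub_C _ _),
    Polynomial.coeff_map]
  exact Subtype.prop _

/-- Half-line walks, by extraction of the non-negative powers. -/
theorem nonnegPart_prod_mul_pow (b : ℤ → K) {m : ℕ} (M : ℕ) (A : Finset (Puiseux K))
    (hA : A.card = m)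
    (hAs : ∀ u ∈ A, u ≠ 0 ∧
      laurentValue (const K) b m M u = laurentValue (const K) b m M (gen K)⁻¹)
    (hint : ∀ u ∈ A, u.NoNegativePower) (n : ℕ) :
    nonnegPart K ((∏ a ∈ A, (1 - gen K * a)) * laurentValue (const K) b m M (gen K)⁻¹ ^ n) =
      (halfLine b m M n).eval₂ (const K) (gen K)⁻¹ := by
  set s := laurentValue (const K) b m M (gen K)⁻¹ with hs
  set D := ∏ a ∈ A, (Polynomial.X - Polynomial.C a) with hD
  -- Here `gen K` is `x̄`, and `u = x` solves `f(u) = s` by the choice of `s`.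
  have h := eval_halfLineRemainder b m M D s n gen_inv_ne_zero rfl
  have hprod : ∏ a ∈ A, (1 - gen K * a) = gen K ^ m * D.eval (gen K)⁻¹ := by
    rw [hD, Polynomial.eval_prod, ← hA, ← Finset.prod_const, ← Finset.prod_mul_distrib]
    refine Finset.prod_congr rfl fun a _ => ?_
    rw [Polynomial.eval_sub, Polynomial.eval_X, Polynomial.eval_C, mul_sub,
      mul_inv_cancel₀ gen_ne_zero]
  have hg : (gen K ^ m) * (gen K)⁻¹ ^ m = 1 := by
    rw [← mul_pow, mul_inv_cancel₀ gen_ne_zero, one_pow]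
  have h2 : (∏ a ∈ A, (1 - gen K * a)) * s ^ n =
      (halfLine b m M n).eval₂ (const K) (gen K)⁻¹ -
        gen K ^ m * (halfLineRemainder b m M D s n).eval (gen K)⁻¹ := by
    rw [hprod]
    linear_combination (gen K ^ m) * h + (halfLine b m M n).eval₂ (const K) (gen K)⁻¹ * hg
  have hdeg : (halfLineRemainder b m M D s n).degree < m :=
    degree_halfLineRemainder_lt b m M (Polynomial.monic_prod_X_sub_C _ A)
      (by rw [Polynomial.natDegree_finsetProd_X_sub_C_eq_card, hA]) s n
  have hrem := nonnegPart_gen_pow_mul_eval hdeg fun i => by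
    rw [halfLineRemainder_eq_modByMonic b M A hA s hAs n]
    exact noNegativePower_coeff_modByMonic _ m A hint i
  rw [h2, nonnegPart_sub, nonnegPart_eval₂_const, hrem, sub_zero]

end HalfLine

/-! ### The kernel method on a half-line -/

section KernelMethod

variable {K : Type} [Field K]

/-- The generating function, multiplied by `t`, of the exiting walks that end at `j - m`, the first
`N` lengths being skipped. -/
def exitSeries (b : ℤ → K) (m M N j : ℕ) : PowerSeries K :=
  PowerSeries.X * PowerSeries.mk fun n => (halfLineExit b m M (n + N)).coeff j

/-- Separates the exits at length `N + 1` from the later ones, at the price of one factor `t`. -/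
lemma exitSeries_eq (b : ℤ → K) (m M N j : ℕ) :
    exitSeries b m M N j =
      PowerSeries.X * (PowerSeries.C ((halfLineExit b m M N).coeff j) +
        exitSeries b m M (N + 1) j) := by
  rw [exitSeries, exitSeries]
  congr 1
  ext n
  rcases n with _ | n
  · simp
  · simp [PowerSeries.coeff_succ_X_mul, Nat.add_right_comm, ← add_assoc]

lemma eval₂_halfLineExit {L : Type} [Field L] (ι : K →+* L) (b : ℤ → K) (m M n : ℕ) (u : L) :
    (halfLineExit b m M n).eval₂ ι u =
      ∑ j ∈ Finset.range m, ι ((halfLineExit b m M n).coeff j) * u ^ j := by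
  rcases Nat.eq_zero_or_pos m with rfl | hm
  · have := degree_halfLineExit_lt b 0 M n
    rw [Nat.cast_zero, Nat.WithBot.lt_zero_iff, Polynomial.degree_eq_bot] at this
    simp [this]
  · refine Polynomial.eval₂_eq_sum_range' ι ?_ u
    by_cases h0 : halfLineExit b m M n = 0
    · simpa [h0] using hm
    · exact (Polynomial.natDegree_lt_iff_degree_lt h0).mpr (degree_halfLineExit_lt b m M n)

/-- The numerator `u^m K(u) H(u)` of the kernel equation. -/
def kernelNumerator (b : ℤ → K) (m M : ℕ) : Polynomial (PowerSeries K) :=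
  Polynomial.X ^ m - ∑ j ∈ Finset.range m, Polynomial.C (exitSeries b m M 0 j) * Polynomial.X ^ j

lemma eval₂_kernelNumerator {L : Type} [Field L] (φ : PowerSeries K →+* L) (b : ℤ → K) (m M : ℕ)
    (u : L) : (kernelNumerator b m M).eval₂ φ u =
      u ^ m - ∑ j ∈ Finset.range m, φ (exitSeries b m M 0 j) * u ^ j := by
  simp [kernelNumerator, Polynomial.eval₂_finsetSum]

lemma degree_kernelNumerator_sub_lt (b : ℤ → K) (m M : ℕ) :
    (∑ j ∈ Finset.range m, Polynomial.C (exitSeries b m M 0 j) * Polynomial.X ^ j).degree <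
      (m : WithBot ℕ) := by
  refine (Polynomial.degree_sum_le _ _).trans_lt ?_
  refine (Finset.sup_lt_iff (WithBot.bot_lt_coe m)).mpr fun j hj => ?_
  exact (Polynomial.degree_C_mul_X_pow_le _ _).trans_lt
    (Nat.cast_lt.mpr (Finset.mem_range.mp hj))

/-- Instead of substituting `u` into the infinite series `∑ t^n h_n`, the recursion for `h_n` is
unrolled `N` times. Since `t f(u) = 1`, the walks of length `n` and `n + 1` cancel up to exits, and
what remains is a multiple of `t^N`. -/
lemma eval₂_kernelNumerator_eq_pow_mul (b : ℤ → K) (m M : ℕ) {u : Puiseux K} (hu : u ≠ 0)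
    (hs : laurentValue (const K) b m M u = (gen K)⁻¹) (N : ℕ) :
    (kernelNumerator b m M).eval₂ (ofPowerSeries K) u =
      gen K ^ N * (u ^ m * (halfLine b m M N).eval₂ (const K) u -
        ∑ j ∈ Finset.range m, ofPowerSeries K (exitSeries b m M N j) * u ^ j) := by
  induction N with
  | zero => simp [eval₂_kernelNumerator, halfLine]
  | succ N ih =>
    have h := eval₂_halfLine_succ (const K) b m M N hu
    rw [hs, eval₂_halfLineExit] at h
    have hsum : ∑ j ∈ Finset.range m, ofPowerSeries K (exitSeries b m M N j) * u ^ j =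
        gen K * (∑ j ∈ Finset.range m, const K ((halfLineExit b m M N).coeff j) * u ^ j +
          ∑ j ∈ Finset.range m, ofPowerSeries K (exitSeries b m M (N + 1) j) * u ^ j) := by
      rw [← Finset.sum_add_distrib, Finset.mul_sum]
      refine Finset.sum_congr rfl fun j _ => ?_
      rw [exitSeries_eq, map_mul, map_add, ofPowerSeries_X, ofPowerSeries_C]
      ring
    have hg : gen K * (gen K)⁻¹ = 1 := mul_inv_cancel₀ gen_ne_zero
    rw [ih, hsum]
    linear_combination (-(gen K) ^ (N + 1)) * h -
      (gen K ^ N * u ^ m * (halfLine b m M N).eval₂ (const K) u) * hg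

lemma eval₂_mem_intRing (p : Polynomial K) {u : Puiseux K} (hu : u ∈ intRing K) :
    p.eval₂ (const K) u ∈ intRing K := by
  rw [Polynomial.eval₂_eq_sum_range]
  exact sum_mem fun i _ => mul_mem (noNegativePower_const _) (pow_mem hu i)

/-- If `u` is finite at `t = 0`, so is the cofactor of `t^N` in the unrolled equation. The value is
therefore divisible by every power of `t`. -/
lemma eval₂_kernelNumerator_eq_zero (b : ℤ → K) (m M : ℕ) {u : Puiseux K} (hu : u ≠ 0)
    (hs : laurentValue (const K) b m M u = (gen K)⁻¹) (hint : u.NoNegativePower) :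
    (kernelNumerator b m M).eval₂ (ofPowerSeries K) u = 0 := by
  refine eq_zero_of_forall_mono fun N =>
    ⟨_, ?_, eval₂_kernelNumerator_eq_pow_mul b m M hu hs N⟩
  have hu' : u ∈ intRing K := hint
  exact sub_mem (mul_mem (pow_mem hu' m) (eval₂_mem_intRing _ hu'))
    (sum_mem fun j _ => mul_mem (noNegativePower_ofPowerSeries _) (pow_mem hu' j))

/-- Two monic polynomials of degree `m` that vanish at the same `m` distinct points coincide. -/
lemma map_kernelNumerator_eq_prod (b : ℤ → K) {m : ℕ} (M : ℕ) (A : Finset (Puiseux K))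
    (hA : A.card = m)
    (hAs : ∀ u ∈ A, u ≠ 0 ∧ laurentValue (const K) b m M u = (gen K)⁻¹ ∧ u.NoNegativePower) :
    (kernelNumerator b m M).map (ofPowerSeries K) = ∏ a ∈ A, (Polynomial.X - Polynomial.C a) := by
  have hD := Polynomial.monic_prod_X_sub_C (fun a : Puiseux K => a) A
  have hDdeg : (∏ a ∈ A, (Polynomial.X - Polynomial.C a)).degree = (m : WithBot ℕ) := by
    rw [Polynomial.degree_eq_natDegree hD.ne_zero,
      Polynomial.natDegree_finsetProd_X_sub_C_eq_card, hA]
  refine Polynomial.eq_of_degree_sub_lt_of_eval_finset_eq A ?_ fun u hu => ?_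
  · rw [kernelNumerator, Polynomial.map_sub, Polynomial.map_pow, Polynomial.map_X, sub_right_comm,
      hA]
    refine (Polynomial.degree_sub_le _ _).trans_lt (max_lt ?_ ?_)
    · refine (Polynomial.degree_sub_lt_left ?_ (Polynomial.monic_X_pow m).ne_zero ?_).trans_eq
        (Polynomial.degree_X_pow m)
      · rw [hDdeg, Polynomial.degree_X_pow]
      · rw [hD.leadingCoeff, (Polynomial.monic_X_pow m).leadingCoeff]
    · exact Polynomial.degree_map_le.trans_lt (degree_kernelNumerator_sub_lt b m M)
  · rw [Polynomial.eval_map, eval₂_kernelNumerator_eq_zero b m M (hAs u hu).1 (hAs u hu).2.1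
      (hAs u hu).2.2, Polynomial.eval_prod]
    exact (Finset.prod_eq_zero hu (by simp)).symm

/-- The kernel equation of half-line walks, in terms of the small roots of the kernel. -/
theorem prod_sub_eq_kernel_mul (b : ℤ → K) {m : ℕ} (M : ℕ) (A : Finset (Puiseux K))
    (hA : A.card = m)
    (hAs : ∀ u ∈ A, u ≠ 0 ∧ laurentValue (const K) b m M u = (gen K)⁻¹ ∧ u.NoNegativePower)
    {L : Type} [Field L] (ι : K →+* L) {x : L} (hx : x ≠ 0) :
    ∏ a ∈ A, (const L x - mapRing ι a) =
      const L x ^ m * ((1 - gen L * const L (laurentValue ι b m M x)) *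
        ofPowerSeries L (PowerSeries.mk fun n => (halfLine b m M n).eval₂ ι x)) := by
  have h := congrArg (Polynomial.eval₂ (mapRing ι) (const L x))
    (map_kernelNumerator_eq_prod b M A hA hAs)
  rw [Polynomial.eval₂_map, eval₂_kernelNumerator, Polynomial.eval₂_finsetProd] at h
  simp only [Polynomial.eval₂_sub, Polynomial.eval₂_X, Polynomial.eval₂_C, RingHom.comp_apply] at h
  rw [← h]
  have hmap : ∀ f : PowerSeries K, mapRing ι (ofPowerSeries K f) =
      ofPowerSeries L (f.map ι) := fun f =>
    (mapCoeff_ofPowerSeries (ι : ZeroHom K L) f).trans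
      (congrArg _ (PowerSeries.ext fun n => PowerSeries.coeff_mk n _))
  simp only [hmap, ← ofPowerSeries_C, ← ofPowerSeries_X]
  simp only [← map_pow, ← map_mul, ← map_sum, ← map_sub, ← map_one (ofPowerSeries L)]
  congr 1
  -- Both sides are now power series in `t`: the constant terms agree because `h_0 = 1`, and the
  -- coefficient of `t^(n+1)` is the recursion for half-line walks.
  ext n
  rcases n with _ | n
  · simp [exitSeries, halfLine, sub_mul, mul_assoc]
  · have h2 := eval₂_halfLine_succ ι b m M n hx
    rw [eval₂_halfLineExit] at h2
    simp only [map_sub, map_sum, PowerSeries.coeff_C_mul, PowerSeries.coeff_mul_C, sub_mul, one_mul,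
      mul_assoc, PowerSeries.coeff_succ_X_mul, PowerSeries.coeff_mk, PowerSeries.coeff_map,
      exitSeries, add_zero, PowerSeries.coeff_C, Nat.succ_ne_zero, if_false, zero_sub]
    linear_combination -h2

end KernelMethod

/-! ### Hadamard step sets -/

section Hadamard

variable {L : Type} [Field L]

lemma laurentEval_add (ι : ℂ →+* L) (P Q : ℂ[T;T⁻¹]) (b : L) :
    laurentEval ι (P + Q) b = laurentEval ι P b + laurentEval ι Q b :=
  Finsupp.sum_add_index' (by simp) (by intros; rw [map_add, add_mul])

lemma laurentEval_single (ι : ℂ →+* L) (k : ℤ) (c : ℂ) (b : L) :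
    laurentEval ι (AddMonoidAlgebra.single k c) b = ι c * b ^ k :=
  Finsupp.sum_single_index (by simp)

lemma laurentEval_zero (ι : ℂ →+* L) (b : L) : laurentEval ι 0 b = 0 := Finsupp.sum_zero_index

lemma map_laurentEval {L' : Type} [Field L'] (φ : L →+* L') (ι : ℂ →+* L) (P : ℂ[T;T⁻¹]) (b : L) :
    φ (laurentEval ι P b) = laurentEval (φ.comp ι) P (φ b) := by
  simp [laurentEval, Finsupp.sum, map_sum]

/-- The value of a Laurent polynomial in two variables. -/
def pairEval (ι : ℂ →+* L) (a b : L) : AddMonoidAlgebra ℂ (ℤ × ℤ) →+ L :=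
  AddMonoidAlgebra.liftNC (ι : ℂ →+ L)
    fun s => a ^ (Multiplicative.toAdd s).1 * b ^ (Multiplicative.toAdd s).2

lemma pairEval_single (ι : ℂ →+* L) (a b : L) (s : ℤ × ℤ) (c : ℂ) :
    pairEval ι a b (AddMonoidAlgebra.single s c) = ι c * (a ^ s.1 * b ^ s.2) :=
  AddMonoidAlgebra.liftNC_single _ _ _ _

lemma inX_add (P Q : ℂ[T;T⁻¹]) : inX (P + Q) = inX P + inX Q :=
  AddMonoidAlgebra.mapDomain_add _ _ _

lemma inY_add (P Q : ℂ[T;T⁻¹]) : inY (P + Q) = inY P + inY Q :=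
  AddMonoidAlgebra.mapDomain_add _ _ _

lemma inX_single (k : ℤ) (c : ℂ) :
    inX (AddMonoidAlgebra.single k c) = AddMonoidAlgebra.single (k, 0) c :=
  AddMonoidAlgebra.mapDomain_single

lemma inY_single (k : ℤ) (c : ℂ) :
    inY (AddMonoidAlgebra.single k c) = AddMonoidAlgebra.single (0, k) c :=
  AddMonoidAlgebra.mapDomain_single

lemma inX_zero : inX 0 = 0 := AddMonoidAlgebra.mapDomain_zero _

lemma inY_zero : inY 0 = 0 := AddMonoidAlgebra.mapDomain_zero _

lemma pairEval_inX (ι : ℂ →+* L) (a b : L) (P : ℂ[T;T⁻¹]) :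
    pairEval ι a b (inX P) = laurentEval ι P a := by
  induction P using AddMonoidAlgebra.induction_linear with
  | zero => rw [inX_zero, map_zero, laurentEval_zero]
  | add P Q hP hQ => rw [inX_add, map_add, hP, hQ, laurentEval_add]
  | single k c => rw [inX_single, pairEval_single, laurentEval_single]; simp

/-- Valid even at `a = 0` or `b = 0`, where `zpow` is not additive in the exponent: in `(k,0) +
(0,l)` each coordinate has a zero summand. -/
lemma pairEval_inX_mul_inY (ι : ℂ →+* L) (a b : L) (P Q : ℂ[T;T⁻¹]) :
    pairEval ι a b (inX P * inY Q) = laurentEval ι P a * laurentEval ι Q b := by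
  induction P using AddMonoidAlgebra.induction_linear with
  | zero => rw [inX_zero, zero_mul, map_zero, laurentEval_zero, zero_mul]
  | add P P' hP hP' => rw [inX_add, add_mul, map_add, hP, hP', laurentEval_add, add_mul]
  | single k c =>
    induction Q using AddMonoidAlgebra.induction_linear with
    | zero => rw [inY_zero, mul_zero, map_zero, laurentEval_zero, mul_zero]
    | add Q Q' hQ hQ' => rw [inY_add, mul_add, map_add, hQ, hQ', laurentEval_add, mul_add]
    | single l d =>
      rw [inX_single, inY_single, AddMonoidAlgebra.single_mul_single, pairEval_single,
        laurentEval_single, laurentEval_single]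
      simp
      ring

lemma pairEval_stepPolynomial (ι : ℂ →+* L) (a b : L) (𝒮 : Finset (ℤ × ℤ)) :
    pairEval ι a b (stepPolynomial 𝒮) = stepEval 𝒮 a b := by
  simp [stepPolynomial, stepEval, pairEval_single]

lemma coeff_inX_of_ne (P : ℂ[T;T⁻¹]) (i : ℤ) {j : ℤ} (hj : j ≠ 0) : (inX P).coeff (i, j) = 0 := by
  induction P using AddMonoidAlgebra.induction_linear with
  | zero => rw [inX_zero]; rfl
  | add P Q hP hQ => rw [inX_add, AddMonoidAlgebra.coeff_add, Finsupp.add_apply, hP, hQ, add_zero]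
  | single k c =>
    rw [inX_single, AddMonoidAlgebra.coeff_single, Finsupp.single_eq_of_ne]
    simp [hj]

lemma coeff_inX_mul_inY (P Q : ℂ[T;T⁻¹]) (i j : ℤ) :
    (inX P * inY Q).coeff (i, j) = P.coeff i * Q.coeff j := by
  induction P using AddMonoidAlgebra.induction_linear with
  | zero => rw [inX_zero, zero_mul]; simp
  | add P P' hP hP' =>
    rw [inX_add, add_mul, AddMonoidAlgebra.coeff_add, AddMonoidAlgebra.coeff_add,
      Finsupp.add_apply, Finsupp.add_apply, hP, hP', add_mul]
  | single k c =>
    induction Q using AddMonoidAlgebra.induction_linear with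
    | zero => rw [inY_zero, mul_zero]; simp
    | add Q Q' hQ hQ' =>
      rw [inY_add, mul_add, AddMonoidAlgebra.coeff_add, AddMonoidAlgebra.coeff_add,
        Finsupp.add_apply, Finsupp.add_apply, hQ, hQ', mul_add]
    | single l d =>
      rw [inX_single, inY_single, AddMonoidAlgebra.single_mul_single]
      simp only [AddMonoidAlgebra.coeff_single, Finsupp.single_apply, Prod.mk_add_mk, add_zero,
        zero_add, Prod.mk.injEq]
      by_cases h : k = i <;> by_cases h' : l = j <;> simp [h, h']

lemma coeff_stepPolynomial (𝒮 : Finset (ℤ × ℤ)) (s : ℤ × ℤ) :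
    (stepPolynomial 𝒮).coeff s = if s ∈ 𝒮 then 1 else 0 := by
  rw [stepPolynomial, AddMonoidAlgebra.coeff_sum, Finsupp.finsetSum_apply]
  simp [Finsupp.single_apply]

variable {𝒮 : Finset (ℤ × ℤ)} {U V T : ℂ[T;T⁻¹]}

lemma IsHadamard.stepEval_eq (hS : IsHadamard 𝒮 U V T) (ι : ℂ →+* L) (a b : L) :
    stepEval 𝒮 a b = laurentEval ι U a + laurentEval ι V a * laurentEval ι T b := by
  rw [← pairEval_stepPolynomial ι, hS, map_add, pairEval_inX, pairEval_inX_mul_inY]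

/-- The summand `U(x)` only affects the row `j = 0`; on every other row the coefficients of `S`
factor. This is how the extreme coefficients of `T` are read off the step set. -/
lemma IsHadamard.coeff_mul_coeff (hS : IsHadamard 𝒮 U V T) (i : ℤ) {j : ℤ} (hj : j ≠ 0) :
    V.coeff i * T.coeff j = if (i, j) ∈ 𝒮 then 1 else 0 := by
  rw [← coeff_stepPolynomial, hS, AddMonoidAlgebra.coeff_add, Finsupp.add_apply,
    coeff_inX_of_ne U i hj, coeff_inX_mul_inY, zero_add]

lemma IsHadamard.coeff_ne_zero (hS : IsHadamard 𝒮 U V T) {i j : ℤ} (hj : j ≠ 0)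
    (hij : (i, j) ∈ 𝒮) : V.coeff i ≠ 0 ∧ T.coeff j ≠ 0 := by
  have h := hS.coeff_mul_coeff i hj
  rw [if_pos hij] at h
  exact ⟨left_ne_zero_of_mul_eq_one h, right_ne_zero_of_mul_eq_one h⟩

lemma IsHadamard.exists_mem (hS : IsHadamard 𝒮 U V T) {i j : ℤ} (hi : V.coeff i ≠ 0)
    (hj : j ≠ 0) (hT : T.coeff j ≠ 0) : (i, j) ∈ 𝒮 := by
  have h := hS.coeff_mul_coeff i hj
  by_contra h'
  rw [if_neg h'] at h
  exact mul_ne_zero hi hT h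

lemma laurentEval_eq_laurentValue (ι : ℂ →+* L) (P : ℂ[T;T⁻¹]) (m M : ℕ)
    (hP : ∀ k, P.coeff k ≠ 0 → -(m : ℤ) ≤ k ∧ k ≤ M) (b : L) :
    laurentEval ι P b = laurentValue ι P.coeff m M b := by
  rw [laurentEval, laurentValue]
  refine Finsupp.sum_of_support_subset _ (fun k hk => ?_) _ (by simp)
  exact Finset.mem_Icc.mpr (hP k (Finsupp.mem_support_iff.mp hk))

lemma stepEval_eq_laurentValue {K : Type} [Field K] (ι : K →+* L) (m M : ℕ)
    (h𝒮 : ∀ s ∈ 𝒮, -(m : ℤ) ≤ s.1 ∧ s.1 ≤ M) (a : L) (b : K) :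
    stepEval 𝒮 a (ι b) = laurentValue ι (fun k => stepCoeffX 𝒮 k b) m M a := by
  rw [stepEval, laurentValue,
    ← Finset.sum_fiberwise_of_maps_to (t := Finset.Icc (-(m : ℤ)) M) (g := Prod.fst)
      (fun s hs => Finset.mem_Icc.mpr (h𝒮 s hs))]
  refine Finset.sum_congr rfl fun k _ => ?_
  rw [stepCoeffX, map_sum, Finset.sum_mul]
  refine Finset.sum_congr rfl fun s hs => ?_
  rw [(Finset.mem_filter.mp hs).2, map_zpow₀, mul_comm]

lemma map_stepEval {L' : Type} [Field L'] (φ : L →+* L') (a b : L) :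
    φ (stepEval 𝒮 a b) = stepEval 𝒮 (φ a) (φ b) := by
  simp [stepEval]

lemma map_stepCoeffX {L' : Type} [Field L'] (φ : L →+* L') (k : ℤ) (b : L) :
    φ (stepCoeffX 𝒮 k b) = stepCoeffX 𝒮 k (φ b) := by
  simp [stepCoeffX]

end Hadamard

/-! ### Quadrant walks, step by step -/

/-- The operator `[y^≥]` on series in `x̄` and `ȳ`, as an additive map. -/
def nonnegYCoeff : FieldXY →+ FieldXY where
  toFun := mapCoeff (nonnegPart ℂ)
  map_zero' := map_zero _
  map_add' f g := ext_coeff fun q => nonnegPart_add (f.coeff q) (g.coeff q)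

/-- The operator `[x^≥]` on series in `x̄` and `ȳ`, as an additive map. -/
def nonnegXCoeff : FieldXY →+ FieldXY := nonnegPartHom FieldY

lemma coeff_nonnegYCoeff (f : FieldXY) (q : ℚ) :
    (nonnegYCoeff f).coeff q = nonnegPart ℂ (f.coeff q) := rfl

lemma coeff_nonnegXCoeff (f : FieldXY) (q : ℚ) :
    (nonnegXCoeff f).coeff q = if q ≤ 0 then f.coeff q else 0 := rfl

lemma nonnegXCoeff_nonnegYCoeff (f : FieldXY) :
    nonnegXCoeff (nonnegYCoeff f) = nonnegYCoeff (nonnegXCoeff f) := by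
  refine ext_coeff fun q => ?_
  rw [coeff_nonnegXCoeff, coeff_nonnegYCoeff, coeff_nonnegYCoeff, coeff_nonnegXCoeff]
  split_ifs
  · rfl
  · exact (map_zero _).symm

lemma nonnegXCoeff_const_mul (c : FieldY) (f : FieldXY) :
    nonnegXCoeff (const FieldY c * f) = const FieldY c * nonnegXCoeff f :=
  nonnegPart_const_mul c f

lemma nonnegXCoeff_const_mul_mono (c : FieldY) (p : ℚ) :
    nonnegXCoeff (const FieldY c * mono FieldY p) =
      if p ≤ 0 then const FieldY c * mono FieldY p else 0 :=
  nonnegPart_const_mul_mono c p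

lemma nonnegYCoeff_const_mul_mono (c : FieldY) (p : ℚ) :
    nonnegYCoeff (const FieldY c * mono FieldY p) =
      const FieldY (nonnegPart ℂ c) * mono FieldY p := by
  refine ext_coeff fun q => ?_
  rw [coeff_nonnegYCoeff, coeff_const_mul, coeff_const_mul, coeff_mono]
  split_ifs
  · rw [mul_one, mul_one]
  · rw [mul_zero, mul_zero, map_zero]

lemma nonnegPart_yY_zpow (j : ℤ) : nonnegPart ℂ (yY ^ j) = if 0 ≤ j then yY ^ j else 0 := by
  have h : yY ^ j = const ℂ 1 * mono ℂ (-j) := by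
    rw [yY, inv_zpow, gen_zpow, mono_neg, map_one, one_mul]
  rw [h, nonnegPart_const_mul_mono]
  simp

lemma xXY_zpow (i : ℤ) : xXY ^ i = mono FieldY (-i) := by
  rw [xXY, inv_zpow, gen_zpow, mono_neg]

/-- The operators `[x^≥]` and `[y^≥]` select the monomials of the quadrant. -/
lemma nonneg_monomial (i j : ℤ) : nonnegYCoeff (nonnegXCoeff (xXY ^ i * yXY ^ j)) =
    if 0 ≤ i ∧ 0 ≤ j then xXY ^ i * yXY ^ j else 0 := by
  have h : xXY ^ i * yXY ^ j = const FieldY (yY ^ j) * mono FieldY (-i) := by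
    rw [xXY_zpow, yXY, map_zpow₀, mul_comm]
  rw [h, nonnegXCoeff_const_mul_mono]
  by_cases hi : 0 ≤ i
  · rw [if_pos (by simpa using hi), nonnegYCoeff_const_mul_mono, nonnegPart_yY_zpow]
    by_cases hj : 0 ≤ j
    · rw [if_pos hj, if_pos ⟨hi, hj⟩]
    · rw [if_neg hj, if_neg fun h => hj h.2, map_zero, zero_mul]
  · rw [if_neg (by simpa using hi), if_neg fun h => hi h.1, map_zero]

section Walks

variable {𝒮 : Finset (ℤ × ℤ)}

lemma walkPos_eq {n : ℕ} (w : Fin n → 𝒮) (k : ℕ) :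
    walkPos w k = ∑ l : Fin n, if l.1 < k then (w l : ℤ × ℤ) else 0 :=
  Finset.sum_filter _ _

lemma walkPos_snoc_of_le {n : ℕ} (w : Fin n → 𝒮) (s : 𝒮) {k : ℕ} (hk : k ≤ n) :
    walkPos (Fin.snoc (α := fun _ => 𝒮) w s) k = walkPos w k := by
  rw [walkPos_eq, walkPos_eq, Fin.sum_univ_castSucc]
  simp [hk]

lemma walkPos_snoc_last {n : ℕ} (w : Fin n → 𝒮) (s : 𝒮) :
    walkPos (Fin.snoc (α := fun _ => 𝒮) w s) (n + 1) = walkPos w n + s := by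
  rw [walkPos_eq, walkPos_eq, Fin.sum_univ_castSucc]
  have h : ∀ l : Fin n, l.1 < n + 1 := fun l => l.2.trans (Nat.lt_succ_self n)
  simp [h]

lemma snoc_mem_quadrantWalks {n : ℕ} (w : Fin n → 𝒮) (s : 𝒮) :
    Fin.snoc (α := fun _ => 𝒮) w s ∈ quadrantWalks 𝒮 (n + 1) ↔
      w ∈ quadrantWalks 𝒮 n ∧ 0 ≤ (walkPos w n + s).1 ∧ 0 ≤ (walkPos w n + s).2 := by
  simp only [quadrantWalks, Finset.mem_filter, Finset.mem_univ, true_and]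
  constructor
  · intro h
    refine ⟨fun k hk => ?_, ?_⟩
    · have := h k (hk.trans (Nat.le_succ n))
      rwa [walkPos_snoc_of_le w s hk] at this
    · have := h (n + 1) le_rfl
      rwa [walkPos_snoc_last] at this
  · rintro ⟨h, h'⟩ k hk
    rcases Nat.le_succ_iff.mp hk with hk | rfl
    · rw [walkPos_snoc_of_le w s hk]
      exact h k hk
    · rwa [walkPos_snoc_last]

/-- The generating polynomial of the quadrant walks of length `n`. -/
def quadrantPolynomial (𝒮 : Finset (ℤ × ℤ)) (n : ℕ) : FieldXY :=
  ∑ w ∈ quadrantWalks 𝒮 n, xXY ^ (walkPos w n).1 * yXY ^ (walkPos w n).2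

lemma xXY_ne_zero : xXY ≠ 0 := inv_ne_zero gen_ne_zero

lemma yY_ne_zero : yY ≠ 0 := inv_ne_zero gen_ne_zero

lemma yXY_ne_zero : yXY ≠ 0 := (map_ne_zero _).mpr yY_ne_zero

lemma quadrantPolynomial_zero : quadrantPolynomial 𝒮 0 = 1 := by
  have h : quadrantWalks 𝒮 0 = Finset.univ := by
    refine Finset.filter_true_of_mem fun w _ k _ => ?_
    simp [walkPos_eq]
  rw [quadrantPolynomial, h]
  simp [walkPos_eq]

/-- The last step is arbitrary, and the two extractions discard exactly the endpoints that it brings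
outside the quadrant. -/
lemma quadrantPolynomial_succ (n : ℕ) : quadrantPolynomial 𝒮 (n + 1) =
    nonnegYCoeff (nonnegXCoeff (stepEval 𝒮 xXY yXY * quadrantPolynomial 𝒮 n)) := by
  have hprod : stepEval 𝒮 xXY yXY * quadrantPolynomial 𝒮 n =
      ∑ w ∈ quadrantWalks 𝒮 n, ∑ s : 𝒮,
        xXY ^ (walkPos w n + s).1 * yXY ^ (walkPos w n + s).2 := by
    rw [stepEval, quadrantPolynomial, mul_comm, Finset.sum_mul]
    refine Finset.sum_congr rfl fun w _ => ?_
    rw [← Finset.sum_coe_sort 𝒮, Finset.mul_sum]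
    refine Finset.sum_congr rfl fun s _ => ?_
    rw [Prod.fst_add, Prod.snd_add, zpow_add₀ xXY_ne_zero, zpow_add₀ yXY_ne_zero]
    ring
  rw [hprod]
  simp only [map_sum, nonneg_monomial]
  -- Sums over quadrant walks become sums over all step sequences, so that the last step can be
  -- split off by `Fin.snocEquiv`.
  have hlhs : ∀ (N : ℕ) (g : (Fin N → 𝒮) → FieldXY), ∑ w ∈ quadrantWalks 𝒮 N, g w =
      ∑ w, if w ∈ quadrantWalks 𝒮 N then g w else 0 := fun N g => by
    rw [← Finset.sum_filter, Finset.filter_mem_eq_inter, Finset.univ_inter]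
  rw [quadrantPolynomial, hlhs, hlhs, ← (Fin.snocEquiv fun _ => (𝒮 : Type)).sum_comp,
    Fintype.sum_prod_type, Finset.sum_comm]
  refine Finset.sum_congr rfl fun w _ => ?_
  split_ifs with hw
  · refine Finset.sum_congr rfl fun s _ => ?_
    have := snoc_mem_quadrantWalks w s
    simp only [Fin.snocEquiv, Equiv.coe_fn_mk, this, hw, true_and, walkPos_snoc_last]
  · refine Finset.sum_eq_zero fun s _ => if_neg ?_
    exact fun h => hw ((snoc_mem_quadrantWalks w s).mp h).1

end Walks

/-! ### The `y`-extraction for Hadamard walks -/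

section Extraction

/-- The monomial `c x^(-p) T^k`, where `T` belongs to `FieldY`. -/
def hadamardMonomial (T : FieldY) (c : ℂ) (p : ℚ) (k : ℕ) : FieldXY :=
  const FieldY (const ℂ c * T ^ k) * mono FieldY p

/-- The polynomials in `T` of degree at most one with coefficients in `ℂ[x, x̄]`. -/
def hadamardSteps (T : FieldY) : AddSubgroup FieldXY :=
  AddSubgroup.closure {f | ∃ c p, ∃ k ≤ 1, f = hadamardMonomial T c p k}

/-- The polynomials in `T` with coefficients in `ℂ[x, x̄]`. -/
def hadamardPolynomials (T : FieldY) : AddSubgroup FieldXY :=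
  AddSubgroup.closure {f | ∃ c p k, f = hadamardMonomial T c p k}

lemma hadamardMonomial_mul (T : FieldY) (c d : ℂ) (p q : ℚ) (k l : ℕ) :
    hadamardMonomial T c p k * hadamardMonomial T d q l =
      hadamardMonomial T (c * d) (p + q) (k + l) := by
  simp only [hadamardMonomial, mono_add, map_mul, pow_add]
  ring

lemma mul_mem_hadamardPolynomials {T : FieldY} {s g : FieldXY} (hs : s ∈ hadamardSteps T)
    (hg : g ∈ hadamardPolynomials T) : s * g ∈ hadamardPolynomials T := by
  induction hs using AddSubgroup.closure_induction with
  | zero => rw [zero_mul]; exact zero_mem _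
  | add s s' _ _ h h' => rw [add_mul]; exact add_mem h h'
  | neg s _ h => rw [neg_mul]; exact neg_mem h
  | mem s hs =>
    obtain ⟨c, p, k, -, rfl⟩ := hs
    induction hg using AddSubgroup.closure_induction with
    | zero => rw [mul_zero]; exact zero_mem _
    | add s s' _ _ h h' => rw [mul_add]; exact add_mem h h'
    | neg s _ h => rw [mul_neg]; exact neg_mem h
    | mem g hg =>
      obtain ⟨d, q, l, rfl⟩ := hg
      rw [hadamardMonomial_mul]
      exact AddSubgroup.subset_closure ⟨_, _, _, rfl⟩

/-- On a monomial in `x` and `T(y)`, `[x^≥]` only tests the exponent of `x`; hence confinement to `x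
≥ 0` does not destroy the polynomial dependence on `T`. -/
lemma nonnegXCoeff_mem_hadamardPolynomials {T : FieldY} {g : FieldXY}
    (hg : g ∈ hadamardPolynomials T) : nonnegXCoeff g ∈ hadamardPolynomials T := by
  induction hg using AddSubgroup.closure_induction with
  | zero => rw [map_zero]; exact zero_mem _
  | add s s' _ _ h h' => rw [map_add]; exact add_mem h h'
  | neg s _ h => rw [map_neg]; exact neg_mem h
  | mem g hg =>
    obtain ⟨c, p, k, rfl⟩ := hg
    rw [hadamardMonomial, nonnegXCoeff_const_mul_mono]
    split_ifs
    · exact AddSubgroup.subset_closure ⟨_, _, _, rfl⟩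
    · exact zero_mem _

/-- If `h_n = [y^≥] N T^n` counts half-line walks, then extracting the non-negative powers of `y`
before or after a step gives the same result. -/
lemma nonnegYCoeff_step {T N : FieldY}
    (hT : ∀ k, nonnegPart ℂ (T * nonnegPart ℂ (N * T ^ k)) = nonnegPart ℂ (N * T ^ (k + 1)))
    {s g : FieldXY} (hs : s ∈ hadamardSteps T) (hg : g ∈ hadamardPolynomials T) :
    nonnegYCoeff (s * nonnegYCoeff (const FieldY N * g)) =
      nonnegYCoeff (const FieldY N * (s * g)) := by
  induction hs using AddSubgroup.closure_induction with
  | zero => simp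
  | add s s' _ _ h h' => rw [add_mul, map_add, h, h', add_mul, mul_add, map_add]
  | neg s _ h => rw [neg_mul, map_neg, h, neg_mul, mul_neg, map_neg]
  | mem s hs =>
    obtain ⟨c, p, k, hk, rfl⟩ := hs
    induction hg using AddSubgroup.closure_induction with
    | zero => simp
    | add s s' _ _ h h' => rw [mul_add, map_add, mul_add, map_add, h, h', mul_add, mul_add, map_add]
    | neg s _ h => rw [mul_neg, map_neg, mul_neg, map_neg, h, mul_neg, mul_neg, map_neg]
    | mem g hg =>
      obtain ⟨d, q, l, rfl⟩ := hg
      have h1 : const FieldY N * hadamardMonomial T d q l =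
          const FieldY (const ℂ d * (N * T ^ l)) * mono FieldY q := by
        simp only [hadamardMonomial, map_mul]; ring
      have h2 : const FieldY N * hadamardMonomial T (c * d) (p + q) (k + l) =
          const FieldY (const ℂ (c * d) * (N * T ^ (k + l))) * mono FieldY (p + q) := by
        simp only [hadamardMonomial, map_mul]; ring
      have h3 : ∀ a : FieldY, hadamardMonomial T c p k * (const FieldY a * mono FieldY q) =
          const FieldY (const ℂ c * (T ^ k * a)) * mono FieldY (p + q) := by
        intro a
        simp only [hadamardMonomial, map_mul, mono_add]; ring
      rw [hadamardMonomial_mul, h1, h2, nonnegYCoeff_const_mul_mono, nonnegYCoeff_const_mul_mono,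
        nonnegPart_const_mul, nonnegPart_const_mul, h3, nonnegYCoeff_const_mul_mono,
        nonnegPart_const_mul, mul_left_comm (T ^ k), nonnegPart_const_mul, ← mul_assoc (const ℂ c),
        ← map_mul]
      congr 3
      -- The Hadamard form enters here: a step has degree 0 or 1 in `T`. Degree 0 is the idempotence
      -- of `[y^≥]`, degree 1 is `hT`.
      interval_cases k
      · rw [pow_zero, one_mul, nonnegPart_nonnegPart, zero_add]
      · rw [pow_one, hT, add_comm 1]

lemma laurentEval_xXY_mul_mem {T : FieldY} (P : ℂ[T;T⁻¹]) {k : ℕ} (hk : k ≤ 1) :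
    laurentEval complexXY P xXY * const FieldY (T ^ k) ∈ hadamardSteps T := by
  rw [laurentEval, Finsupp.sum, Finset.sum_mul]
  refine sum_mem fun i _ => AddSubgroup.subset_closure ⟨P.coeff i, -i, k, hk, ?_⟩
  rw [hadamardMonomial, xXY_zpow, map_mul]
  show const FieldY (const ℂ _) * _ * _ = _
  ring

end Extraction

/-- Quadrant walks are obtained from half-plane walks by extraction of the non-negative powers
of `y`. -/
theorem quadrantPolynomial_eq {𝒮 : Finset (ℤ × ℤ)} {U V T : ℂ[T;T⁻¹]} (hS : IsHadamard 𝒮 U V T)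
    {m M m' M' : ℕ} (h𝒮 : ∀ s ∈ 𝒮, -(m : ℤ) ≤ s.1 ∧ s.1 ≤ M)
    (hT : ∀ k, T.coeff k ≠ 0 → -(m' : ℤ) ≤ k ∧ k ≤ M')
    (A : Finset FieldY) (hA : A.card = m')
    (hAs : ∀ u ∈ A, u ≠ 0 ∧ laurentEval (const ℂ) T u = laurentEval (const ℂ) T yY)
    (hint : ∀ u ∈ A, u.NoNegativePower) (n : ℕ) :
    quadrantPolynomial 𝒮 n = nonnegYCoeff (const FieldY (∏ a ∈ A, (1 - gen ℂ * a)) *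
      (halfLine (fun k => stepCoeffX 𝒮 k yY) m M n).eval₂ (const FieldY) xXY) := by
  set N : FieldY := ∏ a ∈ A, (1 - gen ℂ * a)
  set t := laurentEval (const ℂ) T yY with ht
  have hval := laurentEval_eq_laurentValue (const ℂ) T m' M' hT
  have hN : ∀ k, nonnegPart ℂ (N * t ^ k) =
      (halfLine T.coeff m' M' k).eval₂ (const ℂ) (gen ℂ)⁻¹ := by
    intro k
    rw [ht, hval]
    exact nonnegPart_prod_mul_pow T.coeff M' A hA
      (fun u hu => ⟨(hAs u hu).1, by rw [← hval, ← hval]; exact (hAs u hu).2⟩) hint k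
  -- The inner extraction is the half-line polynomial of length `k`, weighted by the coefficients of
  -- `T`; multiplying by `T` and extracting again adds one step to it.
  have hstep : ∀ k, nonnegPart ℂ (t * nonnegPart ℂ (N * t ^ k)) =
      nonnegPart ℂ (N * t ^ (k + 1)) := by
    intro k
    rw [hN, hN, ht, hval]
    exact nonnegPart_laurentValue_mul_halfLine T.coeff m' M' k
  have hSval : stepEval 𝒮 xXY yXY =
      laurentValue (const FieldY) (fun k => stepCoeffX 𝒮 k yY) m M (gen FieldY)⁻¹ :=
    stepEval_eq_laurentValue (const FieldY) m M h𝒮 _ _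
  have hH : ∀ k, nonnegXCoeff (stepEval 𝒮 xXY yXY *
      (halfLine (fun k => stepCoeffX 𝒮 k yY) m M k).eval₂ (const FieldY) xXY) =
        (halfLine (fun k => stepCoeffX 𝒮 k yY) m M (k + 1)).eval₂ (const FieldY) xXY := by
    intro k
    rw [hSval]
    exact nonnegPart_laurentValue_mul_halfLine _ m M k
  have hSmem : stepEval 𝒮 xXY yXY ∈ hadamardSteps t := by
    rw [hS.stepEval_eq complexXY]
    refine add_mem ?_ ?_
    · simpa using laurentEval_xXY_mul_mem (T := t) U zero_le_one
    · have h : laurentEval complexXY T yXY = const FieldY (t ^ 1) := by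
        rw [pow_one, ht, map_laurentEval]; rfl
      rw [h]
      exact laurentEval_xXY_mul_mem (T := t) V le_rfl
  have hHmem : ∀ k, (halfLine (fun k => stepCoeffX 𝒮 k yY) m M k).eval₂ (const FieldY) xXY ∈
      hadamardPolynomials t := by
    intro k
    induction k with
    | zero =>
      refine AddSubgroup.subset_closure ⟨1, 0, 0, ?_⟩
      simp [halfLine, hadamardMonomial]
    | succ k ih =>
      rw [← hH]
      exact nonnegXCoeff_mem_hadamardPolynomials (mul_mem_hadamardPolynomials hSmem ih)
  induction n with
  | zero =>
    have h := nonnegYCoeff_const_mul_mono N 0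
    have h0 := hN 0
    rw [pow_zero, mul_one] at h0
    rw [mono_zero, mul_one, mul_one, h0] at h
    rw [quadrantPolynomial_zero]
    simp only [halfLine, Polynomial.eval₂_one, mul_one] at h ⊢
    rw [h, map_one]
  | succ n ih =>
    -- The two extractions are swapped so that the step can be moved inside `[y^≥]`, then swapped
    -- back: `[x^≥]` commutes with the factor `N` and completes a half-plane step.
    rw [quadrantPolynomial_succ, ih, ← nonnegXCoeff_nonnegYCoeff,
      nonnegYCoeff_step hstep hSmem (hHmem n), nonnegXCoeff_nonnegYCoeff, nonnegXCoeff_const_mul,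
      hH]

/-! ### Enumerations -/

lemma Finset.exists_enumeration {α : Type*} [Inhabited α] [DecidableEq α] (s : Finset α) (a : ℕ) :
    ∃ f : ℕ → α, (Finset.Icc (a + 1) (a + s.card)).image f = s := by
  refine ⟨fun i => if h : i - (a + 1) < s.card then s.equivFin.symm ⟨i - (a + 1), h⟩ else default,
    ?_⟩
  ext x
  simp only [Finset.mem_image, Finset.mem_Icc]
  constructor
  · rintro ⟨i, hi, rfl⟩
    rw [dif_pos (by omega)]
    exact Subtype.prop _
  · intro hx
    have h := (s.equivFin ⟨x, hx⟩).2
    refine ⟨(s.equivFin ⟨x, hx⟩) + (a + 1), by omega, ?_⟩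
    simp

/-- Enumerate two finite sets one after the other. -/
lemma Finset.exists_enumeration_pair {α : Type*} [Inhabited α] [DecidableEq α] (A B : Finset α) :
    ∃ f : ℕ → α, (Finset.Icc 1 A.card).image f = A ∧
      (Finset.Icc (A.card + 1) (A.card + B.card)).image f = B := by
  obtain ⟨f, hf⟩ := A.exists_enumeration 0
  obtain ⟨g, hg⟩ := B.exists_enumeration A.card
  rw [zero_add, zero_add] at hf
  refine ⟨fun i => if i ≤ A.card then f i else g i, ?_, ?_⟩
  · refine (Finset.image_congr fun i hi => ?_).trans hf
    rw [Finset.coe_Icc] at hi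
    exact if_pos hi.2
  · refine (Finset.image_congr fun i hi => ?_).trans hg
    rw [Finset.coe_Icc] at hi
    exact if_neg (by have := hi.1; omega)

lemma Finset.prod_eq_of_image_eq {α β : Type*} [DecidableEq α] [CommMonoid β] {s : Finset ℕ}
    {A : Finset α} {f : ℕ → α} (h : s.image f = A) (hcard : A.card = s.card) (g : α → β) :
    ∏ i ∈ s, g (f i) = ∏ a ∈ A, g a := by
  subst h
  exact (Finset.prod_image (Finset.card_image_iff.mp hcard)).symm

/-- Enumerate the elements of `A` and `B` from `1`, those of `A` coming first. -/
lemma exists_enumeration_from_one {α : Type*} [Inhabited α] [DecidableEq α] {P : α → Prop}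
    {A B : Finset α} {m M : ℕ} (hA : A.card = m) (hB : B.card = M) (hAP : ∀ a ∈ A, P a)
    (hBP : ∀ b ∈ B, ¬ P b) :
    ∃ f : ℕ → α, (Finset.Icc 1 m).image f = A ∧ (Finset.Icc (m + 1) (m + M)).image f = B ∧
      Set.BijOn f (Set.Icc 1 (m + M)) (A ∪ B : Finset α) ∧
      ∀ i ∈ Set.Icc 1 (m + M), P (f i) ↔ i ≤ m := by
  obtain ⟨f, hfA, hfB⟩ := A.exists_enumeration_pair B
  rw [hA] at hfA
  rw [hA, hB] at hfB
  have hsplit : Finset.Icc 1 (m + M) = Finset.Icc 1 m ∪ Finset.Icc (m + 1) (m + M) := by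
    ext i; simp only [Finset.mem_union, Finset.mem_Icc]; omega
  have himg : (Finset.Icc 1 (m + M)).image f = A ∪ B := by
    rw [hsplit, Finset.image_union, hfA, hfB]
  have hdisj : Disjoint A B := Finset.disjoint_left.mpr fun a ha hb => hBP a hb (hAP a ha)
  have hinj : Set.InjOn f (Finset.Icc 1 (m + M) : Finset ℕ) := by
    rw [← Finset.card_image_iff, himg, Finset.card_union_of_disjoint hdisj, hA, hB]
    simp
  refine ⟨f, hfA, hfB, ⟨?_, ?_, ?_⟩, ?_⟩
  · intro i hi
    rw [← himg]
    exact Finset.mem_image_of_mem f (Finset.mem_Icc.mpr hi)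
  · rwa [Finset.coe_Icc] at hinj
  · rw [← himg, Finset.coe_image, Finset.coe_Icc]
    exact Set.surjOn_image _ _
  · intro i hi
    constructor
    · intro h
      by_contra h'
      refine hBP (f i) ?_ h
      rw [← hfB]
      exact Finset.mem_image_of_mem f (Finset.mem_Icc.mpr ⟨by omega, hi.2⟩)
    · intro h
      refine hAP (f i) ?_
      rw [← hfA]
      exact Finset.mem_image_of_mem f (Finset.mem_Icc.mpr ⟨hi.1, h⟩)

/-- Enumerate the elements of `A` and `B` from `0`, starting with `x ∈ B`, then those of `A`. -/
lemma exists_enumeration_from_zero {α : Type*} [DecidableEq α] {P : α → Prop}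
    {A B : Finset α} {m M : ℕ} (hA : A.card = m) (hB : B.card = M) (hAP : ∀ a ∈ A, P a)
    (hBP : ∀ b ∈ B, ¬ P b) {x : α} (hx : x ∈ B) :
    ∃ f : ℕ → α, (Finset.Icc 1 m).image f = A ∧ f 0 = x ∧
      Set.BijOn f (Set.Iio (m + M)) (A ∪ B : Finset α) ∧
      ∀ i < m + M, P (f i) ↔ i ∈ Set.Icc 1 m := by
  have hM : 0 < M := hB ▸ Finset.card_pos.mpr ⟨x, hx⟩
  have : Inhabited α := ⟨x⟩
  have hB' : (B.erase x).card = M - 1 := by rw [Finset.card_erase_of_mem hx, hB]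
  -- The distinguished element `x` is removed from `B`, the other elements are numbered from 1, and
  -- the free index 0 is then given to `x`.
  obtain ⟨f, hfA, hfB, hbij, hP⟩ := exists_enumeration_from_one hA hB' hAP
    fun b hb => hBP b (Finset.mem_of_mem_erase hb)
  have hxA : x ∉ A := fun h => hBP x hx (hAP x h)
  have hxAB : x ∉ (A ∪ B.erase x : Finset α) := by simp [hxA]
  have hset : Set.Iio (m + M) = insert 0 (Set.Icc 1 (m + (M - 1))) := by
    ext i; simp only [Set.mem_Iio, Set.mem_insert_iff, Set.mem_Icc]; omega
  have hU : ((A ∪ B : Finset α) : Set α) = insert x ((A ∪ B.erase x : Finset α) : Set α) := by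
    rw [← Finset.coe_insert, ← Finset.union_insert, Finset.insert_erase hx]
  have hne : ∀ i : ℕ, i ≠ 0 → Function.update f 0 x i = f i := fun i hi =>
    Function.update_of_ne hi _ _
  refine ⟨Function.update f 0 x, ?_, Function.update_self _ _ _, ?_, ?_⟩
  · rw [← hfA]
    refine Finset.image_congr fun i hi => hne i ?_
    rw [Finset.coe_Icc] at hi
    exact Nat.one_le_iff_ne_zero.mp hi.1
  · rw [hset, hU]
    have hbij' : Set.BijOn (Function.update f 0 x) (Set.Icc 1 (m + (M - 1)))
        (A ∪ B.erase x : Finset α) :=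
      hbij.congr fun i hi => (hne i (Nat.one_le_iff_ne_zero.mp hi.1)).symm
    have := hbij'.insert (a := 0) (by rwa [Function.update_self])
    rwa [Function.update_self] at this
  · intro i hi
    rcases Nat.eq_zero_or_pos i with rfl | hi0
    · rw [Function.update_self]
      simp [hBP x hx]
    · rw [hne i hi0.ne', hP i ⟨hi0, by omega⟩]
      simp only [Set.mem_Icc]
      omega

/-! ### Derivatives -/

section Derivative

variable {K L : Type} [Field K] [Field L]

/-- The value at `u` of the derivative of `∑_{-m ≤ k ≤ M} b_k u^k`. -/
def laurentValueDeriv (ι : K →+* L) (b : ℤ → K) (m M : ℕ) (u : L) : L :=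
  ∑ k ∈ Finset.Icc (-(m : ℤ)) M, (k : L) * ι (b k) * u ^ (k - 1)

/-- By the product rule for `u^m (f(u) - s)`: the derivative of `u^m` is multiplied by `f(u) - s`,
which is zero for this choice of `s`. -/
lemma eval_derivative_levelPolynomial (ι : K →+* L) (b : ℤ → K) (m M : ℕ) {u : L} (hu : u ≠ 0) :
    (levelPolynomial ι b m M (laurentValue ι b m M u)).derivative.eval u =
      u ^ m * laurentValueDeriv ι b m M u := by
  have hpow : ∀ j : ℕ, u * ((j : L) * u ^ (j - 1)) = j * u ^ j := by
    intro j
    rcases j with _ | j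
    · simp
    · rw [Nat.add_sub_cancel, pow_succ]; ring
  -- Multiplication by `u` restores the exponent `j` from `j - 1`, including at `j = 0`, where the
  -- subtraction is truncated.
  refine mul_left_cancel₀ hu ?_
  rw [levelPolynomial, laurentNumerator, Polynomial.map_sum, Polynomial.derivative_sub,
    Polynomial.derivative_sum, Polynomial.eval_sub, Polynomial.eval_finsetSum]
  simp only [Polynomial.map_mul, Polynomial.map_C, Polynomial.map_pow, Polynomial.map_X,
    Polynomial.derivative_C_mul, Polynomial.derivative_X_pow, Polynomial.eval_mul,
    Polynomial.eval_C, Polynomial.eval_pow, Polynomial.eval_X, mul_sub]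
  rw [mul_left_comm u, hpow, laurentValue, laurentValueDeriv, sum_Icc_eq_sum_range,
    sum_Icc_eq_sum_range, Finset.mul_sum, Finset.mul_sum, Finset.mul_sum, Finset.sum_mul,
    ← Finset.sum_sub_distrib]
  refine Finset.sum_congr rfl fun j _ => ?_
  rw [mul_left_comm u, hpow]
  simp only [zpow_sub₀ hu, zpow_natCast, zpow_one]
  push_cast
  field_simp

/-- If `M = 1`, the derivative of `f` at `u` is a product over the other points with the same
value. -/
lemma laurentValueDeriv_eq_prod (ι : K →+* L) {b : ℤ → K} {m : ℕ} (hb : b 1 ≠ 0)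
    {u : L} (hu : u ≠ 0) (A : Finset L) (hA : A.card = m) (huA : u ∉ A)
    (hAs : ∀ v ∈ A, v ≠ 0 ∧ laurentValue ι b m 1 v = laurentValue ι b m 1 u) :
    laurentValueDeriv ι b m 1 u = ι (b 1) * ∏ a ∈ A, (1 - u⁻¹ * a) := by
  classical
  have h := levelPolynomial_eq_prod ι (M := 1) one_pos (by exact_mod_cast hb)
    (laurentValue ι b m 1 u) (insert u A) (by rw [Finset.card_insert_of_notMem huA, hA])
    (by
      intro v hv
      rcases Finset.mem_insert.mp hv with rfl | hv
      · exact ⟨hu, rfl⟩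
      · exact hAs v hv)
  have h2 := eval_derivative_levelPolynomial ι b m 1 hu
  -- At the root `u`, only the derivative of the factor `X - u` contributes.
  rw [h, Finset.prod_insert huA, Polynomial.derivative_C_mul, Polynomial.derivative_mul] at h2
  simp only [Polynomial.derivative_sub, Polynomial.derivative_X, Polynomial.derivative_C, sub_zero,
    one_mul, Polynomial.eval_mul, Polynomial.eval_C, Polynomial.eval_add, Polynomial.eval_sub,
    Polynomial.eval_X, sub_self, zero_mul, add_zero, Polynomial.eval_prod] at h2
  refine mul_left_cancel₀ (pow_ne_zero m hu) ?_
  rw [← h2, mul_left_comm, ← hA, ← Finset.prod_const, ← Finset.prod_mul_distrib]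
  simp only [mul_sub, mul_one, mul_inv_cancel_left₀ hu, Nat.cast_one]

lemma stepEvalDx_eq_laurentValueDeriv {𝒮 : Finset (ℤ × ℤ)} (ι : K →+* L) (m M : ℕ)
    (h𝒮 : ∀ s ∈ 𝒮, -(m : ℤ) ≤ s.1 ∧ s.1 ≤ M) (a : L) (b : K) :
    stepEvalDx 𝒮 a (ι b) = laurentValueDeriv ι (fun k => stepCoeffX 𝒮 k b) m M a := by
  rw [stepEvalDx, laurentValueDeriv,
    ← Finset.sum_fiberwise_of_maps_to (t := Finset.Icc (-(m : ℤ)) M) (g := Prod.fst)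
      (fun s hs => Finset.mem_Icc.mpr (h𝒮 s hs))]
  refine Finset.sum_congr rfl fun k _ => ?_
  rw [stepCoeffX, map_sum, Finset.mul_sum, Finset.sum_mul]
  refine Finset.sum_congr rfl fun s hs => ?_
  rw [(Finset.mem_filter.mp hs).2, map_zpow₀]
  ring

lemma laurentEvalDeriv_eq_laurentValueDeriv (ι : ℂ →+* L) (P : ℂ[T;T⁻¹]) (m M : ℕ)
    (hP : ∀ k, P.coeff k ≠ 0 → -(m : ℤ) ≤ k ∧ k ≤ M) (b : L) :
    laurentEvalDeriv ι P b = laurentValueDeriv ι P.coeff m M b := by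
  have h : laurentEvalDeriv ι P b =
      P.coeff.sum fun k c => (k : L) * ι c * b ^ (k - 1) := by
    rw [laurentEvalDeriv]
    congr 1
    ext k c
    ring
  rw [h, laurentValueDeriv]
  refine Finsupp.sum_of_support_subset _ (fun k hk => ?_) _ (by simp)
  exact Finset.mem_Icc.mpr (hP k (Finsupp.mem_support_iff.mp hk))

lemma map_stepEvalDx {𝒮 : Finset (ℤ × ℤ)} {L' : Type} [Field L'] (φ : L →+* L') (a b : L) :
    φ (stepEvalDx 𝒮 a b) = stepEvalDx 𝒮 (φ a) (φ b) := by
  simp [stepEvalDx]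

lemma map_laurentEvalDeriv {L' : Type} [Field L'] (φ : L →+* L') (ι : ℂ →+* L) (P : ℂ[T;T⁻¹])
    (b : L) : φ (laurentEvalDeriv ι P b) = laurentEvalDeriv (φ.comp ι) P (φ b) := by
  simp [laurentEvalDeriv, Finsupp.sum, map_sum]

end Derivative

/-! ### Expansions in `t` -/

section Expansion

variable (𝒮 : Finset (ℤ × ℤ))

lemma kernel_eq : kernel 𝒮 = 1 - gen FieldXY * const FieldXY (stepEval 𝒮 xXY yXY) := by
  rw [kernel, map_stepEval]
  rfl

lemma kernel_ne_zero : kernel 𝒮 ≠ 0 := by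
  intro h
  have h0 := congrArg (fun f : FieldTXY => f.coeff 0) h
  simp only [kernel_eq] at h0
  rw [coeff_sub, coeff_one, if_pos rfl, ← mono_one, coeff_mono_mul, coeff_const,
    if_neg (by norm_num), sub_zero, coeff_zero] at h0
  exact one_ne_zero h0

lemma kernel_mul_ofPowerSeries :
    kernel 𝒮 * ofPowerSeries FieldXY (PowerSeries.mk fun n => stepEval 𝒮 xXY yXY ^ n) = 1 := by
  rw [kernel_eq, ← ofPowerSeries_X, ← ofPowerSeries_C, ← map_mul, ← map_one (ofPowerSeries FieldXY),
    ← map_sub, ← map_mul]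
  congr 1
  ext n
  rcases n with _ | n
  · simp [sub_mul, mul_assoc]
  · simp [sub_mul, mul_assoc, PowerSeries.coeff_succ_X_mul, pow_succ', PowerSeries.coeff_one]

lemma const_mul_ofPowerSeries (c : FieldXY) (a : ℕ → FieldXY) :
    const FieldXY c * ofPowerSeries FieldXY (PowerSeries.mk a) =
      ofPowerSeries FieldXY (PowerSeries.mk fun n => c * a n) := by
  rw [← ofPowerSeries_C, ← map_mul]
  congr 1
  ext n
  simp

lemma const_div_kernel (c : FieldXY) : const FieldXY c / kernel 𝒮 =
    ofPowerSeries FieldXY (PowerSeries.mk fun n => c * stepEval 𝒮 xXY yXY ^ n) := by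
  rw [div_eq_iff (kernel_ne_zero 𝒮), ← const_mul_ofPowerSeries, mul_assoc, mul_comm _ (kernel 𝒮),
    kernel_mul_ofPowerSeries, mul_one]

lemma nonnegY_ofPowerSeries (a : ℕ → FieldXY) :
    nonnegY (ofPowerSeries FieldXY (PowerSeries.mk a)) =
      ofPowerSeries FieldXY (PowerSeries.mk fun n => nonnegYCoeff (a n)) := by
  rw [nonnegY, mapCoeff_ofPowerSeries]
  simp only [PowerSeries.coeff_mk]
  rfl

lemma nonnegX_ofPowerSeries (a : ℕ → FieldXY) :
    nonnegX (ofPowerSeries FieldXY (PowerSeries.mk a)) =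
      ofPowerSeries FieldXY (PowerSeries.mk fun n => nonnegXCoeff (a n)) := by
  rw [nonnegX, mapCoeff_ofPowerSeries]
  simp only [PowerSeries.coeff_mk]
  rfl

lemma nonnegY_neg (f : FieldTXY) : nonnegY (-f) = -nonnegY f :=
  ext_coeff fun q => map_neg nonnegYCoeff (f.coeff q)

lemma quadrantGF_eq :
    quadrantGF 𝒮 = ofPowerSeries FieldXY (PowerSeries.mk (quadrantPolynomial 𝒮)) := rfl

end Expansion

/-! ### The points with the same value, and the orbit -/

section Conjugates

variable {K : Type} [Field K]

lemma not_noNegativePower_gen_inv : ¬ ((gen K)⁻¹).NoNegativePower := by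
  intro h
  have h1 := h (-1) (by norm_num)
  rw [← mono_one, ← mono_neg, coeff_mono, if_pos rfl] at h1
  exact one_ne_zero h1

/-- All the solutions of `f(u) = s`, for a series `s` with a pole at the origin. -/
lemma exists_all_roots [CharZero K] (F : Subfield K) (hK : HasAllRoots K) (b : ℤ → K)
    (hbF : ∀ k, b k ∈ F) (m : ℕ) {M : ℕ}
    (hM : 0 < M) (hb : b M ≠ 0) (hb' : m = 0 ∨ b (-m) ≠ 0) {e : ℕ} (he : 0 < e)
    (w : Polynomial K) (hwF : ∀ k, w.coeff k ∈ F) (hw : w.coeff 0 ≠ 0)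
    (s : Puiseux K) (hs : s * gen K ^ e = w.eval₂ (const K) (gen K)) :
    ∃ A B : Finset (Puiseux K), A.card = m ∧ B.card = M ∧
      (∀ X ∈ A, X.NoNegativePower) ∧ (∀ X ∈ B, ¬ X.NoNegativePower) ∧
      (∀ X, X ∈ A ∨ X ∈ B ↔ X ≠ 0 ∧ laurentValue (const K) b m M X = s) ∧
      ∀ X, X ∈ A ∨ X ∈ B → ∀ q, IsAlgebraic F (X.coeff q) := by
  classical
  obtain ⟨A, B, hA, hB, hAX, hBX, halg⟩ :=
    exists_roots_isAlgebraic F hK b hbF m hM hb hb' he w hwF hw s hs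
  refine ⟨A, B, hA, hB, fun X hX => (hAX X hX).2.2, fun X hX => (hBX X hX).2.2, ?_, halg⟩
  have hdisj : Disjoint A B :=
    Finset.disjoint_left.mpr fun X hX hX' => (hBX X hX').2.2 (hAX X hX).2.2
  intro X
  rw [← Finset.mem_union]
  refine mem_iff_of_card_eq (const K) hM hb s (A ∪ B)
    (by rw [Finset.card_union_of_disjoint hdisj, hA, hB]) (fun X hX => ?_) X
  rcases Finset.mem_union.mp hX with hX | hX
  · exact ⟨(hAX X hX).1, (hAX X hX).2.1⟩
  · exact ⟨(hBX X hX).1, (hBX X hX).2.1⟩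

/-- All the solutions of `f(u) = f(x)`. -/
lemma exists_all_conjugates [CharZero K] (F : Subfield K) (hK : HasAllRoots K) (b : ℤ → K)
    (hbF : ∀ k, b k ∈ F) (m : ℕ) {M : ℕ}
    (hM : 0 < M) (hb : b M ≠ 0) (hb' : m = 0 ∨ b (-m) ≠ 0) :
    ∃ A B : Finset (Puiseux K), A.card = m ∧ B.card = M ∧
      (∀ X ∈ A, X.NoNegativePower) ∧ (∀ X ∈ B, ¬ X.NoNegativePower) ∧
      (∀ X, X ∈ A ∨ X ∈ B ↔ X ≠ 0 ∧
        laurentValue (const K) b m M X = laurentValue (const K) b m M (gen K)⁻¹) ∧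
      (gen K)⁻¹ ∈ B ∧ ∀ X, X ∈ A ∨ X ∈ B → ∀ q, IsAlgebraic F (X.coeff q) := by
  have hcoeff := coeff_laurentNumerator (fun k => b (-k)) M m
  -- In terms of `x̄`, the value `f(x)` is `x̄^(-M)` times a polynomial in `x̄` with constant term
  -- `b_M`: the pole order is `e = M`, and `w` is the numerator with reversed coefficients.
  obtain ⟨A, B, hA, hB, hAX, hBX, hAB, halg⟩ := exists_all_roots F hK b hbF m hM hb hb' hM
    (laurentNumerator (fun k => b (-k)) M m)
    (fun k => by
      rcases le_or_gt k (M + m) with hk | hk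
      · rw [hcoeff k hk]; exact hbF _
      · rw [Polynomial.coeff_eq_zero_of_natDegree_lt
          ((natDegree_laurentNumerator_le _ _ _).trans_lt hk)]
        exact zero_mem _)
    (by rw [hcoeff 0 (Nat.zero_le _)]; simpa using hb)
    (laurentValue (const K) b m M (gen K)⁻¹)
    (by rw [eval₂_laurentNumerator _ _ _ _ gen_ne_zero, laurentValue_inv, mul_comm])
  refine ⟨A, B, hA, hB, hAX, hBX, hAB, ?_, halg⟩
  refine ((hAB _).mpr ⟨gen_inv_ne_zero, rfl⟩).resolve_left fun h => ?_
  exact not_noNegativePower_gen_inv (hAX _ h)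

end Conjugates

/-- The numerator of `V` splits over `ℂ`, so its roots in any extension field are complex numbers.
-/
lemma laurentEval_ne_zero {L : Type} [Field L] (ι : ℂ →+* L) {V : ℂ[T;T⁻¹]} (hV : V ≠ 0) {a : L}
    (ha : a ≠ 0) (haι : a ∉ ι.range) : laurentEval ι V a ≠ 0 := by
  obtain ⟨k, hk⟩ : ∃ k, V.coeff k ≠ 0 := by
    by_contra! h
    exact hV (AddMonoidAlgebra.ext (Finsupp.ext h))
  set N := V.coeff.support.sup Int.natAbs with hN
  have hbound : ∀ k, V.coeff k ≠ 0 → -(N : ℤ) ≤ k ∧ k ≤ N := by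
    intro k hk
    have h : Int.natAbs k ≤ N := Finset.le_sup (f := Int.natAbs) (Finsupp.mem_support_iff.mpr hk)
    omega
  intro h
  rw [laurentEval_eq_laurentValue ι V N N hbound] at h
  refine haι ((IsAlgClosed.splits (laurentNumerator V.coeff N N)).mem_range_of_isRoot ?_ ?_)
  · intro h0
    have h1 := coeff_laurentNumerator V.coeff N N (k + N).toNat (by have := hbound k hk; omega)
    rw [h0, Polynomial.coeff_zero, Int.toNat_of_nonneg (by have := hbound k hk; omega),
      add_sub_cancel_right] at h1
    exact hk h1.symm
  · rw [Polynomial.IsRoot, Polynomial.eval_map, eval₂_laurentNumerator ι _ _ _ ha, h, mul_zero]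

section Steps

variable {𝒮 : Finset (ℤ × ℤ)}

/-- Steps with the same abscissa have distinct ordinates, so their monomials in `y` cannot cancel.
-/
lemma stepCoeffX_yY_ne_zero {s : ℤ × ℤ} (hs : s ∈ 𝒮) : stepCoeffX 𝒮 s.1 yY ≠ 0 := by
  intro h
  have h1 := congrArg (fun f : FieldY => f.coeff (-s.2)) h
  have hy : ∀ j : ℤ, yY ^ j = mono ℂ (-j) := fun j => by
    rw [yY, inv_zpow, gen_zpow, mono_neg]
  simp only [stepCoeffX, coeff_sum, hy, coeff_mono, coeff_zero] at h1
  rw [Finset.sum_eq_single s] at h1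
  · simp at h1
  · intro s' hs' hne
    refine if_neg fun h2 => hne ?_
    have h3 : (s.2 : ℚ) = s'.2 := neg_injective h2
    exact Prod.ext (Finset.mem_filter.mp hs').2 (by exact_mod_cast h3.symm)
  · intro h2
    exact (h2 (Finset.mem_filter.mpr ⟨hs, rfl⟩)).elim

lemma stepCoeffX_yY_mem_ratFunY (k : ℤ) : stepCoeffX 𝒮 k yY ∈ ratFunY := by
  have hy : yY ∈ ratFunY := Subfield.subset_closure (Set.mem_singleton yY)
  exact Subfield.sum_mem _ fun s _ => Subfield.zpow_mem _ hy s.2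

/-- For a complex number `a`, the value `S(a,y)` would not involve `x`, whereas `S(x,y)` contains
the non-zero term `B_M(y) x^M` with `M > 0`. -/
lemma notMem_range_of_stepEval_eq {m M : ℕ} (h𝒮 : ∀ s ∈ 𝒮, -(m : ℤ) ≤ s.1 ∧ s.1 ≤ M)
    (hM : 0 < M) (hb : stepCoeffX 𝒮 M yY ≠ 0) {a : FieldXY}
    (ha : stepEval 𝒮 a yXY = stepEval 𝒮 xXY yXY) : a ∉ complexXY.range := by
  rintro ⟨c, rfl⟩
  have h1 : stepEval 𝒮 (complexXY c) yXY = const FieldY (stepEval 𝒮 (const ℂ c) yY) := by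
    rw [map_stepEval]; rfl
  rw [h1, yXY, stepEval_eq_laurentValue (const FieldY) m M h𝒮, laurentValue] at ha
  have h2 := congrArg (fun f : FieldXY => f.coeff (-M)) ha
  have hM' : (-(M : ℚ)) ≠ 0 := by
    rw [neg_ne_zero]; exact_mod_cast hM.ne'
  simp only [xXY_zpow, coeff_sum, coeff_const_mul, coeff_mono, coeff_const, if_neg hM'] at h2
  rw [Finset.sum_eq_single (M : ℤ)] at h2
  · simp at h2
    exact hb h2.symm
  · intro k _ hk
    rw [if_neg, mul_zero]
    intro h3
    have h4 : (M : ℚ) = k := neg_injective h3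
    exact hk (by exact_mod_cast h4.symm)
  · intro h3
    exact absurd (Finset.mem_Icc.mpr ⟨by omega, le_rfl⟩) h3

variable {L : Type} [Field L]

/-- If `S(a,b)` and `S(a,b')` coincide exactly when `T(b) = T(b')`, the orbit of `(x,y)` is a
product. -/
lemma orbit_eq_prod {U V T : ℂ[T;T⁻¹]} (hS : IsHadamard 𝒮 U V T) (ι : ℂ →+* L) {x y : L}
    (hx : x ≠ 0) (hy : y ≠ 0)
    (hV : ∀ a, a ≠ 0 → stepEval 𝒮 a y = stepEval 𝒮 x y → laurentEval ι V a ≠ 0) :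
    orbit 𝒮 (x, y) = {a | a ≠ 0 ∧ stepEval 𝒮 a y = stepEval 𝒮 x y} ×ˢ
      {b | b ≠ 0 ∧ laurentEval ι T b = laurentEval ι T y} := by
  have hT : ∀ {a b b' : L}, laurentEval ι T b = laurentEval ι T b' →
      stepEval 𝒮 a b = stepEval 𝒮 a b' := fun h => by
    rw [hS.stepEval_eq ι, hS.stepEval_eq ι, h]
  refine Set.Subset.antisymm (fun v hv => ?_) ?_
  · induction (show Relation.ReflTransGen (Adjacent 𝒮) (x, y) v from hv) with
    | refl => exact ⟨⟨hx, rfl⟩, hy, rfl⟩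
    | @tail u v hu huv ih =>
      obtain ⟨⟨hu1, hu⟩, hu2, hu'⟩ := ih hu
      obtain ⟨-, -, hv1, hv2, -, heq, h | h⟩ := huv
      · rw [← h] at heq
        refine ⟨⟨hv1, ?_⟩, hv2, show laurentEval ι T v.2 = _ from h ▸ hu'⟩
        rw [← hu, ← hT hu', ← hT hu', heq]
      · rw [← h] at heq
        refine ⟨⟨hv1, show stepEval 𝒮 v.1 y = _ from h ▸ hu⟩, hv2, ?_⟩
        rw [hS.stepEval_eq ι, hS.stepEval_eq ι] at heq
        rw [← hu']
        -- In `U(a) + V(a) T(b) = U(a) + V(a) T(b')`, the factor `V(a)` cancels because the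
        -- induction keeps `a` among the solutions of `S(a,y) = S(x,y)`.
        exact (mul_left_cancel₀ (hV _ hu1 hu) (add_left_cancel heq)).symm
  · rintro ⟨a, b⟩ ⟨⟨ha, hax⟩, hb, hby⟩
    -- The path goes through `(a, y)`. A move that changes nothing is omitted, as adjacent pairs
    -- must be distinct.
    have h1 : Relation.ReflTransGen (Adjacent 𝒮) (x, y) (a, y) := by
      by_cases h : a = x
      · rw [h]
      · exact .single ⟨hx, hy, ha, hy, fun h' => h (Prod.ext_iff.mp h').1.symm, hax.symm, .inl rfl⟩
    refine h1.trans ?_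
    by_cases h : b = y
    · rw [h]
    · exact .single ⟨ha, hy, ha, hb, fun h' => h (Prod.ext_iff.mp h').2.symm, (hT hby).symm,
        .inr rfl⟩

end Steps

/-! ### The generating function of quadrant walks -/

section GeneratingFunction

variable {𝒮 : Finset (ℤ × ℤ)} {m M : ℕ}

lemma const_prod_one_sub_inv_mul (A : Finset FieldXY) :
    const FieldXY (∏ a ∈ A, (1 - xXY⁻¹ * a)) =
      ∏ a ∈ A, (1 - xTXY⁻¹ * const FieldXY a) := by
  simp [map_prod, xTXY]

lemma embY_prod_one_sub_inv_mul (A : Finset FieldY) :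
    embY (∏ a ∈ A, (1 - yY⁻¹ * a)) = ∏ a ∈ A, (1 - yTXY⁻¹ * embY a) := by
  simp [map_prod, yTXY, yXY, embY]

/-- Quadrant walks, by extraction from a series of half-plane walks. -/
lemma quadrantGF_eq_nonnegY {N : FieldY} {H : ℕ → FieldXY}
    (h : ∀ n, quadrantPolynomial 𝒮 n = nonnegYCoeff (const FieldY N * H n)) :
    quadrantGF 𝒮 = nonnegY (embY N * ofPowerSeries FieldXY (PowerSeries.mk H)) := by
  show _ = nonnegY (const FieldXY (const FieldY N) * _)
  rw [const_mul_ofPowerSeries, nonnegY_ofPowerSeries, quadrantGF_eq]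
  congr 3
  exact funext h

/-- The extraction of the non-negative powers of `x`. -/
lemma nonnegXY_div_kernel {N : FieldY} {P : FieldXY} {H : ℕ → FieldXY}
    (hH : ∀ n, nonnegXCoeff (P * stepEval 𝒮 xXY yXY ^ n) = H n) :
    nonnegXY (const FieldXY P * embY N / kernel 𝒮) =
      nonnegY (embY N * ofPowerSeries FieldXY (PowerSeries.mk H)) := by
  have h1 : const FieldXY P * embY N / kernel 𝒮 =
      const FieldXY (const FieldY N * P) / kernel 𝒮 := by
    rw [map_mul, mul_comm]; rfl
  have h2 : embY N * ofPowerSeries FieldXY (PowerSeries.mk H) =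
      ofPowerSeries FieldXY (PowerSeries.mk fun n => const FieldY N * H n) :=
    const_mul_ofPowerSeries _ _
  rw [nonnegXY, h1, const_div_kernel, nonnegX_ofPowerSeries, h2]
  congr 3
  ext1 n
  rw [mul_assoc, nonnegXCoeff_const_mul, hH]

/-- Half-plane walks, in terms of the small roots of the kernel. -/
lemma prod_div_kernel_eq (h𝒮 : ∀ s ∈ 𝒮, -(m : ℤ) ≤ s.1 ∧ s.1 ≤ M) (C : Finset FieldTY)
    (hC : C.card = m)
    (hCs : ∀ u ∈ C, u ≠ 0 ∧
      laurentValue (const FieldY) (fun k => stepCoeffX 𝒮 k yY) m M u = (gen FieldY)⁻¹ ∧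
        u.NoNegativePower) :
    (∏ a ∈ C, (1 - xTXY⁻¹ * embTY a)) / kernel 𝒮 =
      ofPowerSeries FieldXY (PowerSeries.mk fun n =>
        (halfLine (fun k => stepCoeffX 𝒮 k yY) m M n).eval₂ (const FieldY) xXY) := by
  have h := prod_sub_eq_kernel_mul _ M C hC hCs (const FieldY) xXY_ne_zero
  have hx : xTXY ≠ 0 := (map_ne_zero _).mpr xXY_ne_zero
  have hval : stepEval 𝒮 xXY yXY =
      laurentValue (const FieldY) (fun k => stepCoeffX 𝒮 k yY) m M xXY :=
    stepEval_eq_laurentValue (const FieldY) m M h𝒮 _ _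
  rw [div_eq_iff (kernel_ne_zero 𝒮), mul_comm, kernel_eq, hval]
  refine mul_left_cancel₀ (pow_ne_zero m hx) ?_
  refine Eq.trans ?_ h
  rw [← hC, ← Finset.prod_const, ← Finset.prod_mul_distrib]
  refine Finset.prod_congr rfl fun a _ => ?_
  rw [mul_sub, mul_one, mul_inv_cancel_left₀ hx]
  rfl

/-- The kernel in factored form. -/
lemma kernel_eq_prod (h𝒮 : ∀ s ∈ 𝒮, -(m : ℤ) ≤ s.1 ∧ s.1 ≤ M) (hM : 0 < M)
    (hb : stepCoeffX 𝒮 M yY ≠ 0) (R : Finset FieldTY) (hR : R.card = m + M)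
    (hRs : ∀ u ∈ R, u ≠ 0 ∧
      laurentValue (const FieldY) (fun k => stepCoeffX 𝒮 k yY) m M u = (gen FieldY)⁻¹) :
    xTXY ^ m * kernel 𝒮 =
      -(tTXY * stepCoeffX 𝒮 M yTXY * ∏ a ∈ R, (xTXY - embTY a)) := by
  have hx : xTXY ≠ 0 := (map_ne_zero _).mpr xXY_ne_zero
  have h := laurentValue_sub_eq_prod (const FieldY) hM hb (gen FieldY)⁻¹ R hR hRs
    (mapRing (const FieldY)) hx
  have hcomp : (mapRing (const FieldY)).comp (const FieldY) = embY :=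
    RingHom.ext fun c => mapRing_const (const FieldY) c
  have hval : stepEval 𝒮 xTXY yTXY =
      laurentValue embY (fun k => stepCoeffX 𝒮 k yY) m M xTXY :=
    stepEval_eq_laurentValue embY m M h𝒮 _ _
  have hlead : mapRing (const FieldY) (const FieldY (stepCoeffX 𝒮 M yY)) =
      stepCoeffX 𝒮 M yTXY := by
    rw [mapRing_const]
    exact map_stepCoeffX embY _ _
  have ht : tTXY * tTXY⁻¹ = 1 := mul_inv_cancel₀ gen_ne_zero
  rw [hcomp, ← hval, map_inv₀, mapRing_gen, hlead] at h
  have h' : xTXY ^ m * (stepEval 𝒮 xTXY yTXY - tTXY⁻¹) =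
      stepCoeffX 𝒮 M yTXY * ∏ a ∈ R, (xTXY - embTY a) := h
  rw [mul_assoc tTXY, ← h', kernel]
  linear_combination (-(xTXY ^ m)) * ht

/-- Division by the kernel, in terms of the large roots of the kernel. -/
lemma prod_div_kernel_eq_neg_inv (h𝒮 : ∀ s ∈ 𝒮, -(m : ℤ) ≤ s.1 ∧ s.1 ≤ M) (hM : 0 < M)
    (hb : stepCoeffX 𝒮 M yY ≠ 0) [DecidableEq FieldTY] (C D : Finset FieldTY) (hC : C.card = m)
    (hD : D.card = M) (hdisj : Disjoint C D)
    (hRs : ∀ u ∈ C ∪ D, u ≠ 0 ∧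
      laurentValue (const FieldY) (fun k => stepCoeffX 𝒮 k yY) m M u = (gen FieldY)⁻¹) :
    (∏ a ∈ C, (1 - xTXY⁻¹ * embTY a)) / kernel 𝒮 =
      -(tTXY * stepCoeffX 𝒮 M yTXY * ∏ a ∈ D, (xTXY - embTY a))⁻¹ := by
  have hx : xTXY ≠ 0 := (map_ne_zero _).mpr xXY_ne_zero
  have h := kernel_eq_prod h𝒮 hM hb (C ∪ D)
    (by rw [Finset.card_union_of_disjoint hdisj, hC, hD]) hRs
  rw [Finset.prod_union hdisj] at h
  have hprod : ∏ a ∈ C, (xTXY - embTY a) = xTXY ^ m * ∏ a ∈ C, (1 - xTXY⁻¹ * embTY a) := by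
    rw [← hC, ← Finset.prod_const, ← Finset.prod_mul_distrib]
    refine Finset.prod_congr rfl fun a _ => ?_
    rw [mul_sub, mul_one, mul_inv_cancel_left₀ hx]
  set P := ∏ a ∈ C, (1 - xTXY⁻¹ * embTY a)
  set E := ∏ a ∈ D, (xTXY - embTY a)
  have h2 : kernel 𝒮 = -(tTXY * stepCoeffX 𝒮 M yTXY * E) * P := by
    refine mul_left_cancel₀ (pow_ne_zero m hx) ?_
    rw [h, hprod]
    ring
  have hk := kernel_ne_zero 𝒮
  rw [h2] at hk ⊢
  have hP : P ≠ 0 := right_ne_zero_of_mul hk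
  rw [neg_inv, div_eq_iff hk, ← mul_assoc, inv_mul_cancel₀ (left_ne_zero_of_mul hk), one_mul]

end GeneratingFunction

/-! ### The Hadamard model -/

/-- The numerical data of a Hadamard model: its steps lie in `[-m, M] × [-m', M']`, and the extreme
coefficients do not vanish. -/
structure IsHadamardModel (𝒮 : Finset (ℤ × ℤ)) (U V T : ℂ[T;T⁻¹]) (m M m' M' : ℕ) : Prop where
  hadamard : IsHadamard 𝒮 U V T
  pos : 0 < M
  pos' : 0 < M'
  bounds : ∀ s ∈ 𝒮, -(m : ℤ) ≤ s.1 ∧ s.1 ≤ M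
  bounds' : ∀ k, T.coeff k ≠ 0 → -(m' : ℤ) ≤ k ∧ k ≤ M'
  top : stepCoeffX 𝒮 M yY ≠ 0
  bottom : stepCoeffX 𝒮 (-m) yY ≠ 0
  ne_zero : V ≠ 0
  top' : T.coeff M' ≠ 0
  bottom' : m' = 0 ∨ T.coeff (-m') ≠ 0

/-- A step of ordinate `M' > 0` lies off the row `j = 0`, so its abscissa `i` satisfies `V_i ≠ 0`,
and `T_{M'} ≠ 0`. For this `i`, each exponent `k ≠ 0` of `T` gives an actual step `(i, k)`, which
bounds `k`; the exponent 0 lies in the range anyway. -/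
lemma IsHadamard.isHadamardModel {𝒮 : Finset (ℤ × ℤ)} {U V T : ℂ[T;T⁻¹]}
    (hS : IsHadamard 𝒮 U V T) {m M m' M' : ℕ} (hM : 0 < M) (hM' : 0 < M')
    (hm_least : IsLeast (Prod.fst '' (𝒮 : Set (ℤ × ℤ))) (-(m : ℤ)))
    (hM_greatest : IsGreatest (Prod.fst '' (𝒮 : Set (ℤ × ℤ))) (M : ℤ))
    (hm'_least : IsLeast (Prod.snd '' (𝒮 : Set (ℤ × ℤ))) (-(m' : ℤ)))
    (hM'_greatest : IsGreatest (Prod.snd '' (𝒮 : Set (ℤ × ℤ))) (M' : ℤ)) :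
    IsHadamardModel 𝒮 U V T m M m' M' := by
  obtain ⟨sM', hsM', hM'eq⟩ := hM'_greatest.1
  have h := hS.coeff_ne_zero (i := sM'.1) (j := sM'.2) (by omega) hsM'
  refine ⟨hS, hM, hM', fun s hs => ⟨hm_least.2 ⟨s, hs, rfl⟩, hM_greatest.2 ⟨s, hs, rfl⟩⟩,
    fun k hk => ?_, ?_, ?_, ?_, by rw [← hM'eq]; exact h.2, ?_⟩
  · by_cases h0 : k = 0
    · omega
    · have hmem := hS.exists_mem h.1 h0 hk
      exact ⟨hm'_least.2 ⟨_, hmem, rfl⟩, hM'_greatest.2 ⟨_, hmem, rfl⟩⟩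
  · obtain ⟨s, hs, h⟩ := hM_greatest.1
    rw [← h]
    exact stepCoeffX_yY_ne_zero hs
  · obtain ⟨s, hs, h⟩ := hm_least.1
    rw [← h]
    exact stepCoeffX_yY_ne_zero hs
  · rintro rfl
    exact h.1 rfl
  · rcases Nat.eq_zero_or_pos m' with h0 | h0
    · exact .inl h0
    · obtain ⟨s, hs, h⟩ := hm'_least.1
      have h2 := hS.coeff_ne_zero (i := s.1) (j := s.2) (by omega) hs
      rw [h] at h2
      exact .inr h2.2

/-- `A` and `B` contain the solutions of `∑_{-m ≤ k ≤ M} b_k u^k = s` that are finite, resp.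
infinite, at the origin. -/
structure AreRoots {K : Type} [Field K] (b : ℤ → K) (m M : ℕ) (s : Puiseux K)
    (A B : Finset (Puiseux K)) : Prop where
  card_left : A.card = m
  card_right : B.card = M
  left : ∀ X ∈ A, X.NoNegativePower
  right : ∀ X ∈ B, ¬ X.NoNegativePower
  mem_iff : ∀ X, X ∈ A ∨ X ∈ B ↔ X ≠ 0 ∧ laurentValue (const K) b m M X = s

lemma AreRoots.disjoint {K : Type} [Field K] {b : ℤ → K} {m M : ℕ} {s : Puiseux K}
    {A B : Finset (Puiseux K)} (h : AreRoots b m M s A B) : Disjoint A B :=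
  Finset.disjoint_left.mpr fun u hu hu' => h.right u hu' (h.left u hu)

lemma AreRoots.of_mem_left {K : Type} [Field K] {b : ℤ → K} {m M : ℕ} {s : Puiseux K}
    {A B : Finset (Puiseux K)} (h : AreRoots b m M s A B) {u : Puiseux K} (hu : u ∈ A) :
    u ≠ 0 ∧ laurentValue (const K) b m M u = s :=
  (h.mem_iff u).mp (.inl hu)

section Model

variable {𝒮 : Finset (ℤ × ℤ)} {U V T : ℂ[T;T⁻¹]} {m M m' M' : ℕ}

/-- The value `S(x, y)`, in terms of the coefficients `B_k(y)`. -/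
def levelX (𝒮 : Finset (ℤ × ℤ)) (m M : ℕ) : FieldXY :=
  laurentValue (const FieldY) (fun k => stepCoeffX 𝒮 k yY) m M (gen FieldY)⁻¹

/-- The value `T(y)`. -/
def levelY (T : ℂ[T;T⁻¹]) (m M : ℕ) : FieldY :=
  laurentValue (const ℂ) T.coeff m M (gen ℂ)⁻¹

lemma IsHadamardModel.exists_conjugates_x (h : IsHadamardModel 𝒮 U V T m M m' M') :
    ∃ A B, AreRoots (fun k => stepCoeffX 𝒮 k yY) m M (levelX 𝒮 m M) A B ∧ xXY ∈ B ∧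
      ∀ X, X ∈ A ∨ X ∈ B → ∀ q, IsAlgebraic ratFunY (X.coeff q) := by
  obtain ⟨A, B, hA, hB, hAP, hBP, hAB, hxB, halg⟩ :=
    exists_all_conjugates ratFunY hasAllRoots_puiseux_complex _ stepCoeffX_yY_mem_ratFunY m h.pos
      h.top (.inr h.bottom)
  exact ⟨A, B, ⟨hA, hB, hAP, hBP, hAB⟩, hxB, halg⟩

lemma IsHadamardModel.exists_conjugates_y (h : IsHadamardModel 𝒮 U V T m M m' M') :
    ∃ A B, AreRoots T.coeff m' M' (levelY T m' M') A B ∧ yY ∈ B := by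
  obtain ⟨A, B, hA, hB, hAP, hBP, hAB, hyB, -⟩ :=
    exists_all_conjugates ⊤ hasAllRoots_complex T.coeff (fun _ => Subfield.mem_top _) m' h.pos'
      h.top' h.bottom'
  exact ⟨A, B, ⟨hA, hB, hAP, hBP, hAB⟩, hyB⟩

/-- The kernel vanishes when `S(X,y) = 1/t`, a right-hand side with a simple pole and numerator 1.
-/
lemma IsHadamardModel.exists_kernel_roots (h : IsHadamardModel 𝒮 U V T m M m' M') :
    ∃ A B, AreRoots (fun k => stepCoeffX 𝒮 k yY) m M (gen FieldY)⁻¹ A B ∧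
      ∀ X, X ∈ A ∨ X ∈ B → ∀ q, IsAlgebraic ratFunY (X.coeff q) := by
  obtain ⟨A, B, hA, hB, hAP, hBP, hAB, halg⟩ :=
    exists_all_roots ratFunY hasAllRoots_puiseux_complex _ stepCoeffX_yY_mem_ratFunY m h.pos
      h.top (.inr h.bottom) one_pos 1
      (fun k => by
        rw [Polynomial.coeff_one]
        split_ifs
        · exact one_mem _
        · exact zero_mem _)
      (by rw [Polynomial.coeff_one_zero]; exact one_ne_zero) (gen FieldY)⁻¹
      (by rw [pow_one, inv_mul_cancel₀ gen_ne_zero, Polynomial.eval₂_one])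
  exact ⟨A, B, ⟨hA, hB, hAP, hBP, hAB⟩, halg⟩

lemma IsHadamardModel.stepEval_eq (h : IsHadamardModel 𝒮 U V T m M m' M') (X : FieldXY) :
    stepEval 𝒮 X yXY = laurentValue (const FieldY) (fun k => stepCoeffX 𝒮 k yY) m M X :=
  stepEval_eq_laurentValue (const FieldY) m M h.bounds X yY

lemma IsHadamardModel.stepEval_xXY (h : IsHadamardModel 𝒮 U V T m M m' M') :
    stepEval 𝒮 xXY yXY = levelX 𝒮 m M := h.stepEval_eq xXY

lemma IsHadamardModel.laurentEval_eq (h : IsHadamardModel 𝒮 U V T m M m' M') (Y : FieldY) :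
    laurentEval (const ℂ) T Y = laurentValue (const ℂ) T.coeff m' M' Y :=
  laurentEval_eq_laurentValue (const ℂ) T m' M' h.bounds' Y

lemma IsHadamardModel.laurentEval_yY (h : IsHadamardModel 𝒮 U V T m M m' M') :
    laurentEval (const ℂ) T yY = levelY T m' M' := h.laurentEval_eq yY

lemma laurentEval_complexXY_const (T : ℂ[T;T⁻¹]) (Y : FieldY) :
    laurentEval complexXY T (const FieldY Y) = const FieldY (laurentEval (const ℂ) T Y) :=
  (map_laurentEval (const FieldY) (const ℂ) T Y).symm

lemma IsHadamardModel.coe_union_x (h : IsHadamardModel 𝒮 U V T m M m' M') [DecidableEq FieldXY]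
    {A B : Finset FieldXY}
    (hAB : AreRoots (fun k => stepCoeffX 𝒮 k yY) m M (levelX 𝒮 m M) A B) :
    ((A ∪ B : Finset FieldXY) : Set FieldXY) =
      {X : FieldXY | X ≠ 0 ∧ stepEval 𝒮 X yXY = stepEval 𝒮 xXY yXY} := by
  ext X
  rw [Finset.mem_coe, Finset.mem_union, hAB.mem_iff, ← h.stepEval_eq, ← h.stepEval_xXY]
  exact Iff.rfl

lemma IsHadamardModel.coe_union_y (h : IsHadamardModel 𝒮 U V T m M m' M') [DecidableEq FieldY]
    {A B : Finset FieldY} (hAB : AreRoots T.coeff m' M' (levelY T m' M') A B) :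
    ((A ∪ B : Finset FieldY) : Set FieldY) =
      {Y : FieldY | Y ≠ 0 ∧ laurentEval (const ℂ) T Y = laurentEval (const ℂ) T yY} := by
  ext Y
  rw [Finset.mem_coe, Finset.mem_union, hAB.mem_iff, ← h.laurentEval_eq, ← h.laurentEval_yY]
  exact Iff.rfl

lemma IsHadamardModel.coe_union_kernel (h : IsHadamardModel 𝒮 U V T m M m' M')
    [DecidableEq FieldTY] {A B : Finset FieldTY}
    (hAB : AreRoots (fun k => stepCoeffX 𝒮 k yY) m M (gen FieldY)⁻¹ A B) :
    ((A ∪ B : Finset FieldTY) : Set FieldTY) =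
      {X : FieldTY | X ≠ 0 ∧ 1 - tTY * stepEval 𝒮 X yTY = 0} := by
  have hiff : ∀ s t : FieldTY, t ≠ 0 → (s = t⁻¹ ↔ 1 - t * s = 0) := fun s t ht => by
    rw [sub_eq_zero]
    refine ⟨fun hs => by rw [hs, mul_inv_cancel₀ ht], fun hs => ?_⟩
    exact eq_inv_of_mul_eq_one_right hs.symm
  ext X
  rw [Finset.mem_coe, Finset.mem_union, hAB.mem_iff, ← h.stepEval_eq, hiff _ _ gen_ne_zero]
  exact Iff.rfl

lemma IsHadamardModel.laurentEval_V_ne_zero (h : IsHadamardModel 𝒮 U V T m M m' M') {a : FieldXY}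
    (ha : a ≠ 0) (haS : stepEval 𝒮 a yXY = stepEval 𝒮 xXY yXY) : laurentEval complexXY V a ≠ 0 :=
  laurentEval_ne_zero complexXY h.ne_zero ha (notMem_range_of_stepEval_eq h.bounds h.pos h.top haS)

lemma IsHadamardModel.stepEval_x_eq_iff (h : IsHadamardModel 𝒮 U V T m M m' M') (Y : FieldXY) :
    stepEval 𝒮 xXY Y = stepEval 𝒮 xXY yXY ↔
      laurentEval complexXY T Y = laurentEval complexXY T yXY := by
  rw [h.hadamard.stepEval_eq complexXY, h.hadamard.stepEval_eq complexXY, add_right_inj,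
    mul_right_inj' (h.laurentEval_V_ne_zero xXY_ne_zero rfl)]

/-- The conjugates of `y` over `ℂ(T(y))` do not involve `x`. -/
lemma IsHadamardModel.const_image_union (h : IsHadamardModel 𝒮 U V T m M m' M')
    [DecidableEq FieldY] {A B : Finset FieldY} (hAB : AreRoots T.coeff m' M' (levelY T m' M') A B) :
    const FieldY '' ((A ∪ B : Finset FieldY) : Set FieldY) =
      {Y : FieldXY | Y ≠ 0 ∧ laurentEval complexXY T Y = laurentEval complexXY T yXY} := by
  classical
  have hvalXY := laurentEval_eq_laurentValue complexXY T m' M' h.bounds'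
  have hy : laurentEval complexXY T yXY = const FieldY (levelY T m' M') := by
    rw [← h.laurentEval_yY, ← laurentEval_complexXY_const]
    rfl
  -- The solutions found in `FieldY` already number `m' + M'`, the degree of the equation, so
  -- passing to `FieldXY` adds none.
  have hcard : ((A ∪ B).image (const FieldY)).card = m' + M' := by
    rw [Finset.card_image_of_injective _ const_injective,
      Finset.card_union_of_disjoint hAB.disjoint, hAB.card_left, hAB.card_right]
  have hroot : ∀ Y ∈ (A ∪ B).image (const FieldY),
      Y ≠ 0 ∧ laurentValue complexXY T.coeff m' M' Y = const FieldY (levelY T m' M') := by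
    simp only [Finset.forall_mem_image]
    intro Y hY
    obtain ⟨hY0, hY1⟩ := (hAB.mem_iff Y).mp (Finset.mem_union.mp hY)
    refine ⟨(map_ne_zero _).mpr hY0, ?_⟩
    rw [← hvalXY, laurentEval_complexXY_const, h.laurentEval_eq, hY1]
  ext Y
  rw [← Finset.coe_image, Finset.mem_coe,
    mem_iff_of_card_eq complexXY h.pos' h.top' _ _ hcard hroot, ← hvalXY, hy]
  exact Iff.rfl

/-- Half-plane walks of length `n`. -/
def halfPlanePolynomial (𝒮 : Finset (ℤ × ℤ)) (m M n : ℕ) : FieldXY :=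
  (halfLine (fun k => stepCoeffX 𝒮 k yY) m M n).eval₂ (const FieldY) xXY

lemma IsHadamardModel.quadrantGF_eq (h : IsHadamardModel 𝒮 U V T m M m' M')
    {A B : Finset FieldY} (hAB : AreRoots T.coeff m' M' (levelY T m' M') A B) :
    quadrantGF 𝒮 = nonnegY ((∏ a ∈ A, (1 - yTXY⁻¹ * embY a)) *
      ofPowerSeries FieldXY (PowerSeries.mk (halfPlanePolynomial 𝒮 m M))) := by
  rw [← embY_prod_one_sub_inv_mul, yY, inv_inv]
  refine quadrantGF_eq_nonnegY (quadrantPolynomial_eq h.hadamard h.bounds h.bounds' A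
    hAB.card_left (fun u hu => ?_) hAB.left)
  obtain ⟨hu0, hu1⟩ := hAB.of_mem_left hu
  exact ⟨hu0, by rw [h.laurentEval_eq, hu1, h.laurentEval_yY]⟩

lemma IsHadamardModel.quadrantGF_eq_nonnegXY (h : IsHadamardModel 𝒮 U V T m M m' M')
    {A B : Finset FieldXY} (hAB : AreRoots (fun k => stepCoeffX 𝒮 k yY) m M (levelX 𝒮 m M) A B)
    {A' B' : Finset FieldY} (hAB' : AreRoots T.coeff m' M' (levelY T m' M') A' B') :
    quadrantGF 𝒮 = nonnegXY ((∏ a ∈ A, (1 - xTXY⁻¹ * const FieldXY a)) *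
      (∏ a ∈ A', (1 - yTXY⁻¹ * embY a)) / kernel 𝒮) := by
  rw [h.quadrantGF_eq hAB', ← embY_prod_one_sub_inv_mul, ← const_prod_one_sub_inv_mul]
  refine (nonnegXY_div_kernel fun n => ?_).symm
  rw [h.stepEval_xXY, xXY, inv_inv]
  exact nonnegPart_prod_mul_pow _ M A hAB.card_left (fun u hu => hAB.of_mem_left hu) hAB.left n

lemma IsHadamardModel.prod_div_kernel_eq (h : IsHadamardModel 𝒮 U V T m M m' M')
    {C D : Finset FieldTY}
    (hCD : AreRoots (fun k => stepCoeffX 𝒮 k yY) m M (gen FieldY)⁻¹ C D) :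
    (∏ a ∈ C, (1 - xTXY⁻¹ * embTY a)) / kernel 𝒮 =
      ofPowerSeries FieldXY (PowerSeries.mk (halfPlanePolynomial 𝒮 m M)) :=
  _root_.prod_div_kernel_eq h.bounds C hCD.card_left fun u hu =>
    ⟨(hCD.of_mem_left hu).1, (hCD.of_mem_left hu).2, hCD.left u hu⟩

lemma IsHadamardModel.quadrantGF_eq_nonnegY (h : IsHadamardModel 𝒮 U V T m M m' M')
    {C D : Finset FieldTY} (hCD : AreRoots (fun k => stepCoeffX 𝒮 k yY) m M (gen FieldY)⁻¹ C D)
    {A' B' : Finset FieldY} (hAB' : AreRoots T.coeff m' M' (levelY T m' M') A' B') :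
    quadrantGF 𝒮 = nonnegY ((∏ a ∈ C, (1 - xTXY⁻¹ * embTY a)) *
      (∏ a ∈ A', (1 - yTXY⁻¹ * embY a)) / kernel 𝒮) := by
  rw [mul_comm, mul_div_assoc, h.prod_div_kernel_eq hCD, h.quadrantGF_eq hAB']

lemma IsHadamardModel.quadrantGF_eq_neg_nonnegY (h : IsHadamardModel 𝒮 U V T m M m' M')
    {C D : Finset FieldTY} (hCD : AreRoots (fun k => stepCoeffX 𝒮 k yY) m M (gen FieldY)⁻¹ C D)
    {A' B' : Finset FieldY} (hAB' : AreRoots T.coeff m' M' (levelY T m' M') A' B') :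
    quadrantGF 𝒮 = -nonnegY ((∏ a ∈ A', (1 - yTXY⁻¹ * embY a)) /
      (tTXY * stepCoeffX 𝒮 M yTXY * ∏ a ∈ D, (xTXY - embTY a))) := by
  classical
  have hdiv := prod_div_kernel_eq_neg_inv h.bounds h.pos h.top C D hCD.card_left hCD.card_right
    hCD.disjoint fun u hu => (hCD.mem_iff u).mp (Finset.mem_union.mp hu)
  rw [← nonnegY_neg, div_eq_mul_inv, ← mul_neg, ← hdiv, h.prod_div_kernel_eq hCD,
    h.quadrantGF_eq hAB']

lemma IsHadamardModel.stepEvalDx_eq (h : IsHadamardModel 𝒮 U V T m 1 m' M')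
    {A B : Finset FieldXY} (hAB : AreRoots (fun k => stepCoeffX 𝒮 k yY) m 1 (levelX 𝒮 m 1) A B)
    (hx : xXY ∈ B) :
    stepEvalDx 𝒮 xXY yXY = stepCoeffX 𝒮 1 yXY * ∏ a ∈ A, (1 - xXY⁻¹ * a) := by
  have hb : stepCoeffX 𝒮 1 yY ≠ 0 := by exact_mod_cast h.top
  have hd := laurentValueDeriv_eq_prod (const FieldY) (b := fun k => stepCoeffX 𝒮 k yY) (m := m) hb
    xXY_ne_zero A hAB.card_left (fun hxA => hAB.right _ hx (hAB.left _ hxA))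
    fun v hv => hAB.of_mem_left hv
  rw [yXY, stepEvalDx_eq_laurentValueDeriv (const FieldY) m 1 h.bounds, ← map_stepCoeffX]
  exact hd

lemma IsHadamardModel.laurentEvalDeriv_eq (h : IsHadamardModel 𝒮 U V T m M m' 1)
    {A B : Finset FieldY} (hAB : AreRoots T.coeff m' 1 (levelY T m' 1) A B) (hy : yY ∈ B) :
    laurentEvalDeriv (const ℂ) T yY = const ℂ (T.coeff 1) * ∏ a ∈ A, (1 - yY⁻¹ * a) := by
  have hb : T.coeff 1 ≠ 0 := by exact_mod_cast h.top'
  rw [laurentEvalDeriv_eq_laurentValueDeriv (const ℂ) T m' 1 h.bounds']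
  exact laurentValueDeriv_eq_prod (const ℂ) (b := T.coeff) (m := m') hb yY_ne_zero A hAB.card_left
    (fun hyA => hAB.right _ hy (hAB.left _ hyA)) fun v hv => hAB.of_mem_left hv

/-- The case of small forward steps. -/
lemma IsHadamardModel.quadrantGF_eq_of_small_steps (h : IsHadamardModel 𝒮 U V T m 1 m' 1)
    {A B : Finset FieldXY} (hAB : AreRoots (fun k => stepCoeffX 𝒮 k yY) m 1 (levelX 𝒮 m 1) A B)
    (hx : xXY ∈ B) {A' B' : Finset FieldY} (hAB' : AreRoots T.coeff m' 1 (levelY T m' 1) A' B')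
    (hy : yY ∈ B') :
    T.coeff 1 ≠ 0 ∧ quadrantGF 𝒮 = nonnegXY
      (stepEvalDx 𝒮 xTXY yTXY * laurentEvalDeriv complexTXY T yTXY /
        (complexTXY (T.coeff 1) * stepCoeffX 𝒮 1 yTXY * kernel 𝒮)) := by
  have hτ : T.coeff 1 ≠ 0 := by exact_mod_cast h.top'
  have hb : stepCoeffX 𝒮 1 yY ≠ 0 := by exact_mod_cast h.top
  have h1 : stepEvalDx 𝒮 xTXY yTXY =
      stepCoeffX 𝒮 1 yTXY * ∏ a ∈ A, (1 - xTXY⁻¹ * const FieldXY a) := by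
    have h' := congrArg (const FieldXY) (h.stepEvalDx_eq hAB hx)
    rwa [map_stepEvalDx, map_mul, map_stepCoeffX, const_prod_one_sub_inv_mul] at h'
  have h2 : laurentEvalDeriv complexTXY T yTXY =
      complexTXY (T.coeff 1) * ∏ a ∈ A', (1 - yTXY⁻¹ * embY a) := by
    have h' := congrArg embY (h.laurentEvalDeriv_eq hAB' hy)
    rwa [map_laurentEvalDeriv, map_mul, embY_prod_one_sub_inv_mul] at h'
  have h3 : stepCoeffX 𝒮 1 yTXY ≠ 0 := by
    have h' : embY (stepCoeffX 𝒮 1 yY) = stepCoeffX 𝒮 1 yTXY := map_stepCoeffX embY 1 yY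
    rw [← h']
    exact (map_ne_zero embY).mpr hb
  have h4 : complexTXY (T.coeff 1) ≠ 0 := (map_ne_zero _).mpr hτ
  refine ⟨hτ, ?_⟩
  rw [h.quadrantGF_eq_nonnegXY hAB hAB', h1, h2, mul_mul_mul_comm, mul_comm (stepCoeffX 𝒮 1 yTXY),
    mul_div_mul_left _ _ (mul_ne_zero h4 h3)]

end Model

end

/-! ### Conjugates, orbit and the expressions of `Q(x,y)` -/

theorem proposition6p2 (𝒮 : Finset (ℤ × ℤ)) (U V T : LaurentPolynomial ℂ)
    (hS : IsHadamard 𝒮 U V T) (m M m' M' : ℕ) (hM : 0 < M) (hM' : 0 < M')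
    (hm_least : IsLeast (Prod.fst '' (𝒮 : Set (ℤ × ℤ))) (-(m : ℤ)))
    (hM_greatest : IsGreatest (Prod.fst '' (𝒮 : Set (ℤ × ℤ))) (M : ℤ))
    (hm'_least : IsLeast (Prod.snd '' (𝒮 : Set (ℤ × ℤ))) (-(m' : ℤ)))
    (hM'_greatest : IsGreatest (Prod.snd '' (𝒮 : Set (ℤ × ℤ))) (M' : ℤ)) :
    ∃ (xr : ℕ → FieldXY) (yr : ℕ → FieldY) (Xr : ℕ → FieldTY),
      -- the solutions `x_0 = x, …, x_{m+M-1}` of `S(X,y) = S(x,y)`, which are Puiseux series in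
      -- `x̄` with coefficients in an algebraic closure of `ℚ(y)`; exactly `x_1, …, x_m` do not
      -- involve positive powers of `x`
      (Set.BijOn xr (Set.Iio (m + M))
          {X : FieldXY | X ≠ 0 ∧ stepEval 𝒮 X yXY = stepEval 𝒮 xXY yXY} ∧
        (∀ i < m + M, ∀ q : ℚ, IsAlgebraic ratFunY ((xr i).coeff q)) ∧
        xr 0 = xXY ∧
        ∀ i < m + M, (xr i).NoNegativePower ↔ i ∈ Set.Icc 1 m) ∧
      -- the equation `S(x,Y) = S(x,y)` reads `T(Y) = T(y)`
      (∀ Y : FieldXY, Y ≠ 0 →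
        (stepEval 𝒮 xXY Y = stepEval 𝒮 xXY yXY ↔
          laurentEval complexXY T Y = laurentEval complexXY T yXY)) ∧
      -- its solutions `y_0 = y, …, y_{m'+M'-1}`, which are Puiseux series in `ȳ` with
      -- coefficients in `ℂ`; exactly `y_1, …, y_{m'}` do not involve positive powers of `y`
      (Set.BijOn (fun j => Puiseux.const FieldY (yr j)) (Set.Iio (m' + M'))
          {Y : FieldXY | Y ≠ 0 ∧ stepEval 𝒮 xXY Y = stepEval 𝒮 xXY yXY} ∧
        Set.BijOn yr (Set.Iio (m' + M'))
          {Y : FieldY | Y ≠ 0 ∧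
            laurentEval (Puiseux.const ℂ) T Y = laurentEval (Puiseux.const ℂ) T yY} ∧
        yr 0 = yY ∧
        ∀ j < m' + M', (yr j).NoNegativePower ↔ j ∈ Set.Icc 1 m') ∧
      -- the orbit of `(x,y)`
      orbit 𝒮 (xXY, yXY) =
        (xr '' Set.Iio (m + M)) ×ˢ ((fun j => Puiseux.const FieldY (yr j)) '' Set.Iio (m' + M')) ∧
      -- the first expression of `Q(x,y)`
      quadrantGF 𝒮 = nonnegXY
        ((∏ i ∈ Finset.Icc 1 m, (1 - xTXY⁻¹ * Puiseux.const FieldXY (xr i))) *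
          (∏ j ∈ Finset.Icc 1 m', (1 - yTXY⁻¹ * embY (yr j))) / kernel 𝒮) ∧
      -- the roots `X_1, …, X_{m+M}` of `1 - t S(X,y)`, which are Puiseux series in `t` with
      -- coefficients in an algebraic closure of `ℚ(y)`; exactly `X_1, …, X_m` are finite at `t = 0`
      (Set.BijOn Xr (Set.Icc 1 (m + M))
          {X : FieldTY | X ≠ 0 ∧ 1 - tTY * stepEval 𝒮 X yTY = 0} ∧
        (∀ i ∈ Set.Icc 1 (m + M), ∀ q : ℚ, IsAlgebraic ratFunY ((Xr i).coeff q)) ∧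
        ∀ i ∈ Set.Icc 1 (m + M), (Xr i).NoNegativePower ↔ i ≤ m) ∧
      -- the second expression of `Q(x,y)`, in its two forms
      quadrantGF 𝒮 = nonnegY
        ((∏ i ∈ Finset.Icc 1 m, (1 - xTXY⁻¹ * embTY (Xr i))) *
          (∏ j ∈ Finset.Icc 1 m', (1 - yTXY⁻¹ * embY (yr j))) / kernel 𝒮) ∧
      quadrantGF 𝒮 = -nonnegY
        ((∏ j ∈ Finset.Icc 1 m', (1 - yTXY⁻¹ * embY (yr j))) /
          (tTXY * stepCoeffX 𝒮 M yTXY *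
            ∏ i ∈ Finset.Icc (m + 1) (m + M), (xTXY - embTY (Xr i)))) ∧
      -- small forward steps; `T.coeff 1` is the leading coefficient of `T` when `M' = 1`
      (M = 1 → stepEvalDx 𝒮 xXY yXY =
        stepCoeffX 𝒮 1 yXY * ∏ i ∈ Finset.Icc 1 m, (1 - xXY⁻¹ * xr i)) ∧
      (M' = 1 → laurentEvalDeriv (Puiseux.const ℂ) T yY =
        Puiseux.const ℂ (T.coeff 1) * ∏ j ∈ Finset.Icc 1 m', (1 - yY⁻¹ * yr j)) ∧
      (M = 1 → M' = 1 → T.coeff 1 ≠ 0 ∧ quadrantGF 𝒮 = nonnegXY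
        (stepEvalDx 𝒮 xTXY yTXY * laurentEvalDeriv complexTXY T yTXY /
          (complexTXY (T.coeff 1) * stepCoeffX 𝒮 1 yTXY * kernel 𝒮))) := by
  classical
  have h := hS.isHadamardModel hM hM' hm_least hM_greatest hm'_least hM'_greatest
  obtain ⟨A, B, hAB, hxB, halgAB⟩ := h.exists_conjugates_x
  obtain ⟨A', B', hAB', hyB'⟩ := h.exists_conjugates_y
  obtain ⟨C, D, hCD, halgCD⟩ := h.exists_kernel_roots
  obtain ⟨xr, hxA, hx0, hxbij, hxP⟩ :=
    exists_enumeration_from_zero hAB.card_left hAB.card_right hAB.left hAB.right hxB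
  obtain ⟨yr, hyA, hy0, hybij, hyP⟩ :=
    exists_enumeration_from_zero hAB'.card_left hAB'.card_right hAB'.left hAB'.right hyB'
  have : Inhabited FieldTY := ⟨0⟩
  obtain ⟨Xr, hXC, hXD, hXbij, hXP⟩ :=
    exists_enumeration_from_one hCD.card_left hCD.card_right hCD.left hCD.right
  have halgx : ∀ i < m + M, ∀ q : ℚ, IsAlgebraic ratFunY ((xr i).coeff q) := fun i hi =>
    halgAB _ (Finset.mem_union.mp (Finset.mem_coe.mp (hxbij.mapsTo hi)))
  have halgX : ∀ i ∈ Set.Icc 1 (m + M), ∀ q : ℚ, IsAlgebraic ratFunY ((Xr i).coeff q) :=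
    fun i hi => halgCD _ (Finset.mem_union.mp (Finset.mem_coe.mp (hXbij.mapsTo hi)))
  have hprodA := Finset.prod_eq_of_image_eq hxA (by rw [hAB.card_left, Nat.card_Icc]; rfl)
    (fun a => 1 - xTXY⁻¹ * Puiseux.const FieldXY a)
  have hprodA' := Finset.prod_eq_of_image_eq hyA (by rw [hAB'.card_left, Nat.card_Icc]; rfl)
    (fun a => 1 - yTXY⁻¹ * embY a)
  have hprodC := Finset.prod_eq_of_image_eq hXC (by rw [hCD.card_left, Nat.card_Icc]; rfl)
    (fun a => 1 - xTXY⁻¹ * embTY a)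
  have hprodD := Finset.prod_eq_of_image_eq hXD
    (by rw [hCD.card_right, Nat.card_Icc]; omega) (fun a => xTXY - embTY a)
  have hyconst : Set.BijOn (fun j => Puiseux.const FieldY (yr j)) (Set.Iio (m' + M'))
      {Y : FieldXY | Y ≠ 0 ∧ laurentEval complexXY T Y = laurentEval complexXY T yXY} := by
    rw [← h.const_image_union hAB']
    exact (Puiseux.const_injective.injOn.bijOn_image).comp hybij
  rw [h.coe_union_x hAB] at hxbij
  rw [h.coe_union_y hAB'] at hybij
  rw [h.coe_union_kernel hCD] at hXbij
  refine ⟨xr, yr, Xr, ⟨hxbij, halgx, hx0, hxP⟩, fun Y _ => h.stepEval_x_eq_iff Y,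
    ⟨?_, hybij, hy0, hyP⟩, ?_, ?_, ⟨hXbij, halgX, hXP⟩, ?_, ?_, ?_, ?_, ?_⟩
  · simpa only [h.stepEval_x_eq_iff] using hyconst
  · rw [hxbij.image_eq, hyconst.image_eq]
    exact orbit_eq_prod hS complexXY xXY_ne_zero yXY_ne_zero
      fun a ha => h.laurentEval_V_ne_zero ha
  · rw [hprodA, hprodA']
    exact h.quadrantGF_eq_nonnegXY hAB hAB'
  · rw [hprodC, hprodA']
    exact h.quadrantGF_eq_nonnegY hCD hAB'
  · rw [hprodD, hprodA']
    exact h.quadrantGF_eq_neg_nonnegY hCD hAB'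
  · rintro rfl
    rw [h.stepEvalDx_eq hAB hxB,
      Finset.prod_eq_of_image_eq hxA (by rw [hAB.card_left, Nat.card_Icc]; rfl)
        (fun a => 1 - xXY⁻¹ * a)]
  · rintro rfl
    rw [h.laurentEvalDeriv_eq hAB' hyB',
      Finset.prod_eq_of_image_eq hyA (by rw [hAB'.card_left, Nat.card_Icc]; rfl)
        (fun a => 1 - yY⁻¹ * a)]
  · rintro rfl rfl
    exact h.quadrantGF_eq_of_small_steps hAB hxB hAB' hyB'
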